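/- For integers $m\ge n\ge 1$ and real $\beta>0$, the Laguerre $\beta$-ensemble $\mathrm{LE}^{\beta}_{m,n}$ is the random configuration of $n$ points $\lambda_1\le\lambda_2\le\cdots\le\lambda_n$ in $(0,\infty)$ whose joint density (on ordered configurations) is proportional to $$\prod_{1\le i<j\le n}|\lambda_i-\lambda_j|^{\beta}\,\prod_{i=1}^{n}\lambda_i^{\frac{\beta}{2}(m+1-n)-1}e^{-\frac{\beta}{2}\lambda_i}.$$ Let $\lambda_n$ be its largest point. **Theorem.** There exist absolute constants $C_0,c,c',c''>0$ such that for every $0<\varepsilon<c'$, all integers $m\ge n\ge 1$ and all real $\beta\ge 1$, $$\mathbb{P}\bigl\{\lambda_n\le(\sqrt m+\sqrt n)^2(1-\varepsilon)\bigr\}\ \ge\ \begin{cases}\exp\bigl\{-c\beta(\varepsilon\sqrt{mn})^2\bigr\} & \text{if } \varepsilon\ge c''\frac{\sqrt n}{\sqrt m},\\[2pt] C_0^{\beta}\exp\bigl\{-c\beta(\varepsilon^{3/2}m^{3/4}n^{1/4})^2\bigr\} & \text{if } 0<\varepsilon\le c''\frac{\sqrt n}{\sqrt m}.\end{cases}$$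 The constants can be chosen so that, in addition, in the square case $m=n$, for every $0<\varepsilon<c'$, every $n\ge1$ and every $\beta\ge1$, $$\mathbb{P}\{\lambda_n\le 4n(1-\varepsilon)\}\ \ge\ C_0^{\beta}\exp\bigl\{-c\beta(n\varepsilon^{3/2})^2\bigr\}.$$ -/

import Mathlib

open MeasureTheory

noncomputable section

/-- The unnormalized joint density of the ordered points of the Laguerre `β`-ensemble with
parameters `m ≥ n`:
`∏_{i<j} |x i - x j| ^ β * ∏_i (x i) ^ (β / 2 * (m + 1 - n) - 1) * exp (-(β / 2) * x i)`. -/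
def laguerreDensity (β : ℝ) (m n : ℕ) (x : Fin n → ℝ) : ℝ :=
  (∏ i : Fin n, ∏ j ∈ Finset.Ioi i, |x i - x j| ^ β) *
    ∏ i : Fin n, (x i ^ (β / 2 * ((m : ℝ) + 1 - (n : ℝ)) - 1) * Real.exp (-(β / 2) * x i))

/-- The ordered configurations `0 < x 0 ≤ x 1 ≤ ⋯ ≤ x (n - 1)` of `n` points. -/
def orderedConfigurations (n : ℕ) : Set (Fin n → ℝ) :=
  {x | (∀ i, 0 < x i) ∧ Monotone x}

/-- The measure on ordered configurations with density `laguerreDensity β m n` with respect to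
Lebesgue measure, before normalization. -/
def laguerreWeight (β : ℝ) (m n : ℕ) : Measure (Fin n → ℝ) :=
  (volume.restrict (orderedConfigurations n)).withDensity
    (fun x => ENNReal.ofReal (laguerreDensity β m n x))

/-- The law of the ordered points `λ₁ ≤ ⋯ ≤ λₙ` of the Laguerre `β`-ensemble: the measure with
joint density proportional to `laguerreDensity β m n`, divided by its total mass. -/
def laguerreEnsemble (β : ℝ) (m n : ℕ) : Measure (Fin n → ℝ) :=
  (laguerreWeight β m n Set.univ)⁻¹ • laguerreWeight β m n

end

/-!
The idea is to write the event that all points lie below `z` as the survival of a scalar Markov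
chain driven by independent gamma variables, and to bound the survival probability from below by a
change of measure together with an exponential barrier.

**The chain.** The Laguerre ensemble is the spectrum of a random bidiagonal matrix, but no
matrices are needed. For poles `x` and positive weights `w`, the zeros `y` of
`1 - ∑ w i / (t - x i)` interlace with `x`, and so do the zeros `v` of `∑ w i / (t - x i)`; in
both cases the passage from the weights to the zeros is a bijection with an explicit Jacobian made
of Vandermonde products (`lintegral_rankOneWeights`, `lintegral_spectralWeights`). Integrating the
same density of two interlacing configurations in both ways relates the law of the resolvent
`∑ w i / (z - x i)` for `n` points to that for fewer points (`resolventIntegral_fractionStep`,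
`resolventIntegralZero_fractionStep`). The relation is a step `T ↦ g / (z (1 - T))` of a continued
fraction, with an independent gamma variable `g`, and the points stay below `z` exactly when all
positions `T` stay below `1`. Hence the weight of `{λ_max < z}` is a constant times the survival
probability of a chain of `2 n - 1` steps, and the constant does not depend on `z`
(`exists_laguerreWeight_lt_eq`). In particular no Selberg integral has to be evaluated.

**Change of measure.** If a gamma variable of shape `β κ / 2` is multiplied by `1 - t`, then by
the Cauchy–Schwarz inequality the square of the new survival probability is at most
`(1 - t ^ 2) ^ (-β κ / 2)` times the old one (`sq_totalSurvival_le`). So it suffices to find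
scaling factors for which the chain survives with probability `1 / 2`, at a total cost
`∑ β κ t ^ 2` of the required order.

**Bulk regime.** The constant positions `√m / (√m + √n)` and `√n / (√m + √n)` are invariant under
the steps with `g` equal to `m` and `n` when `z = (√m + √n) ^ 2`. For `ε` of order at least
`√(n / m)`, scaling every gamma variable by `1 - 3 ε` leaves so much room that a union bound over
the steps suffices (`half_le_totalSurvival_crude`). The cost is of order `β ε ^ 2 m n`.

**Edge regime.** For `ε = √(n / m) η` with small `η`, the decrease of the shape parameters along
the chain produces a drift towards survival that beats the deficit `η` for all but about `n η` of
the steps. Scaling the gamma variables in these steps by `1 - 32 η` costs a factor of order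
`exp (-β (n η) n η ^ 2)`, that is `exp (-C β n ^ 2 η ^ 3)`. In suitable coordinates `p`, `q` of
the position, the failure probability is then bounded by an exponential `exp (-Θ p)`, with a rate
`Θ` proportional to the local drift; this bound is reproduced by every step of the chain up to
errors whose sum is of order `1 / (n η ^ (3 / 2))` (`barrier_step_large`, `barrier_step_small`,
`half_le_totalSurvival_edge`). If `n η ^ (3 / 2)` is bounded, `η` is first increased, which is
what the factor `C₀ ^ β` pays for.
-/

/-! ### Vandermonde and Cauchy determinants -/

section

open Finset Polynomial

/-- The absolute Vandermonde product `∏_{i<j} |x i - x j|`. -/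
noncomputable def absVandermonde {n : ℕ} (x : Fin n → ℝ) : ℝ :=
  ∏ i : Fin n, ∏ j ∈ Finset.Ioi i, |x i - x j|

lemma abs_det_vandermonde {n : ℕ} (x : Fin n → ℝ) :
    |(Matrix.vandermonde x).det| = absVandermonde x := by
  simp [Matrix.det_vandermonde, absVandermonde, Finset.abs_prod, abs_sub_comm]

lemma absVandermonde_pos {n : ℕ} {x : Fin n → ℝ} (hx : Function.Injective x) :
    0 < absVandermonde x := by
  refine Finset.prod_pos fun i _ => Finset.prod_pos fun j hj => ?_
  have : i ≠ j := (Finset.mem_Ioi.1 hj).ne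
  exact abs_pos.2 (sub_ne_zero.2 fun h => this (hx h))

/-- Every unordered pair occurs twice in the product. -/
lemma prod_prod_erase_abs_sub {n : ℕ} (x : Fin n → ℝ) :
    ∏ i, ∏ j ∈ univ.erase i, |x i - x j| = absVandermonde x ^ 2 := by
  have h1 : ∀ i : Fin n, ∏ j ∈ univ.erase i, |x i - x j| =
      (∏ j ∈ Ioi i, |x i - x j|) * ∏ j ∈ Iio i, |x i - x j| := by
    intro i
    rw [← Finset.prod_union]
    · congr 1
      ext j
      simp only [mem_erase, mem_univ, and_true, mem_union, mem_Ioi, mem_Iio]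
      exact ⟨fun h => (lt_or_gt_of_ne h).symm, fun h => h.elim (fun h => h.ne') fun h => h.ne⟩
    · rw [Finset.disjoint_left]
      intro j hj hj'
      exact absurd (mem_Ioi.1 hj) (not_lt.2 (mem_Iio.1 hj').le)
  simp_rw [h1, Finset.prod_mul_distrib]
  rw [sq, absVandermonde]
  congr 1
  rw [Finset.prod_comm' (t' := univ) (s' := fun j => Ioi j)]
  · simp_rw [abs_sub_comm]
  · simp

/-- Both determinants are the product of a Vandermonde determinant and the determinant of the
coefficients of the `p j`. -/
lemma det_eval_mul_det_vandermonde {n : ℕ} (p : Fin n → ℝ[X]) (hp : ∀ j, (p j).natDegree < n)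
    (a b : Fin n → ℝ) :
    (Matrix.of fun i j => (p j).eval (a i)).det * (Matrix.vandermonde b).det =
      (Matrix.of fun i j => (p j).eval (b i)).det * (Matrix.vandermonde a).det := by
  have key : ∀ a : Fin n → ℝ, (Matrix.of fun i j => (p j).eval (a i)) =
      Matrix.vandermonde a * Matrix.of fun (k j : Fin n) => (p j).coeff k := by
    intro a
    ext i j
    simp only [Matrix.of_apply, Matrix.mul_apply, Matrix.vandermonde_apply]
    rw [Polynomial.eval_eq_sum_range' (hp j), Finset.sum_range]
    exact Finset.sum_congr rfl fun k _ => mul_comm _ _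
  rw [key a, key b, Matrix.det_mul, Matrix.det_mul]
  ring

/-- The determinant of the evaluations at `a` of the `n` products `∏_{k ≠ j} (X - y k)`. -/
lemma abs_det_eval_nodal_erase {n : ℕ} (a : Fin n → ℝ) {y : Fin n → ℝ}
    (hy : Function.Injective y) :
    |(Matrix.of fun i j => ∏ k ∈ univ.erase j, (a i - y k)).det| =
      absVandermonde a * absVandermonde y := by
  have hdeg : ∀ j : Fin n, (∏ k ∈ univ.erase j, (X - C (y k))).natDegree < n := by
    intro j
    rw [Polynomial.natDegree_finsetProd_X_sub_C_eq_card, Finset.card_erase_of_mem (mem_univ _),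
      Finset.card_fin]
    exact Nat.sub_lt (Fin.pos j) one_pos
  have h := det_eval_mul_det_vandermonde (fun j => ∏ k ∈ univ.erase j, (X - C (y k))) hdeg a y
  simp only [Polynomial.eval_prod, eval_sub, eval_X, eval_C] at h
  have hd : (Matrix.of fun i j => ∏ k ∈ univ.erase j, (y i - y k)) =
      Matrix.diagonal fun i => ∏ k ∈ univ.erase i, (y i - y k) := by
    ext i j
    by_cases hij : i = j
    · subst hij; simp
    · rw [Matrix.diagonal_apply_ne _ hij, Matrix.of_apply]
      exact Finset.prod_eq_zero (mem_erase.2 ⟨hij, mem_univ i⟩) (sub_self _)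
  rw [hd, Matrix.det_diagonal] at h
  have h2 := congrArg abs h
  simp only [abs_mul, abs_det_vandermonde, Finset.abs_prod, prod_prod_erase_abs_sub] at h2
  have hpos := absVandermonde_pos hy
  apply mul_right_cancel₀ hpos.ne'
  rw [h2]; ring

lemma absVandermonde_cons {n : ℕ} (s : ℝ) (x : Fin n → ℝ) :
    absVandermonde (Fin.cons s x : Fin (n + 1) → ℝ) = (∏ i, |s - x i|) * absVandermonde x := by
  unfold absVandermonde
  rw [Fin.prod_univ_succ]
  congr 1
  · rw [Fin.Ioi_zero_eq_map, Finset.prod_map]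
    simp
  · refine Finset.prod_congr rfl fun i _ => ?_
    rw [Fin.Ioi_succ, Finset.prod_map]
    simp

/-- The determinant of the evaluations at `a` of `∏ k, (X - y k)` and of the `n` products
`∏_{k ≠ j} (X - y k)`. -/
lemma abs_det_eval_nodal_cons {n : ℕ} (a : Fin (n + 1) → ℝ) {y : Fin n → ℝ}
    (hy : Function.Injective y) :
    |(Matrix.of fun i j => (Fin.cons (∏ k, (a i - y k))
        (fun j => ∏ k ∈ univ.erase j, (a i - y k)) : Fin (n + 1) → ℝ) j).det| =
      absVandermonde a * absVandermonde y := by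
  set p : Fin (n + 1) → ℝ[X] := Fin.cons (∏ k, (X - C (y k)))
        (fun j => ∏ k ∈ univ.erase j, (X - C (y k))) with hp
  have hdeg : ∀ j, (p j).natDegree < n + 1 := by
    intro j
    refine Fin.cases ?_ (fun j => ?_) j
    · rw [hp, Fin.cons_zero, Polynomial.natDegree_finsetProd_X_sub_C_eq_card]; simp
    · rw [hp, Fin.cons_succ, Polynomial.natDegree_finsetProd_X_sub_C_eq_card]
      exact lt_of_le_of_lt (Finset.card_le_univ _) (by simp)
  have hev : ∀ b : ℝ, ∀ j, (p j).eval b = (Fin.cons (∏ k, (b - y k))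
        (fun j => ∏ k ∈ univ.erase j, (b - y k)) : Fin (n + 1) → ℝ) j := by
    intro b j
    refine Fin.cases ?_ (fun j => ?_) j
    · simp [hp, Polynomial.eval_prod]
    · simp [hp, Polynomial.eval_prod]
  -- an auxiliary evaluation point off the `y k` makes the matrix block triangular
  obtain ⟨s, hs⟩ := Set.Infinite.exists_notMem_finite (Set.infinite_univ (α := ℝ))
    (Set.finite_range y)
  have hs' : ∀ k, s - y k ≠ 0 := fun k h => hs.2 ⟨k, (sub_eq_zero.1 h).symm⟩
  have h := det_eval_mul_det_vandermonde p hdeg a (Fin.cons s y)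
  simp only [hev] at h
  have hd : (Matrix.of fun i j => (Fin.cons (∏ k, ((Fin.cons s y : Fin (n + 1) → ℝ) i - y k))
        (fun j => ∏ k ∈ univ.erase j, ((Fin.cons s y : Fin (n + 1) → ℝ) i - y k)) :
          Fin (n + 1) → ℝ) j).det =
      (∏ k, (s - y k)) * ∏ i, ∏ k ∈ univ.erase i, (y i - y k) := by
    rw [Matrix.det_succ_column_zero, Fin.sum_univ_succ]
    have h0 : ∀ i : Fin n, ∏ k, (y i - y k) = 0 :=
      fun i => Finset.prod_eq_zero (mem_univ i) (sub_self _)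
    have hm : (Matrix.of fun i j => (Fin.cons (∏ k, ((Fin.cons s y : Fin (n + 1) → ℝ) i - y k))
        (fun j => ∏ k ∈ univ.erase j, ((Fin.cons s y : Fin (n + 1) → ℝ) i - y k)) :
          Fin (n + 1) → ℝ) j).submatrix (Fin.succAbove 0) Fin.succ =
        Matrix.diagonal fun i => ∏ k ∈ univ.erase i, (y i - y k) := by
      ext i j
      simp only [Matrix.submatrix_apply, Fin.zero_succAbove, Matrix.of_apply, Fin.cons_succ]
      by_cases hij : i = j
      · subst hij; simp
      · rw [Matrix.diagonal_apply_ne _ hij]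
        exact Finset.prod_eq_zero (mem_erase.2 ⟨hij, mem_univ i⟩) (sub_self _)
    rw [hm, Matrix.det_diagonal]
    simp [h0]
  rw [hd] at h
  have h2 := congrArg abs h
  simp only [abs_mul, abs_det_vandermonde, Finset.abs_prod, prod_prod_erase_abs_sub,
    absVandermonde_cons] at h2
  have hpos := absVandermonde_pos hy
  have hpos2 : 0 < ∏ k, |s - y k| := Finset.prod_pos fun k _ => abs_pos.2 (hs' k)
  apply mul_right_cancel₀ (mul_pos hpos2 hpos).ne'
  rw [h2]; ring

end

/-! ### Partial fractions and interlacing points -/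

section

open Finset Polynomial

/-- The numerator `∑ i, w i * ∏_{l ≠ i} (X - x l)` of the partial fraction sum
`∑ i, w i / (X - x i)`. -/
noncomputable def fractionNumerator {n : ℕ} (x w : Fin n → ℝ) : ℝ[X] :=
  ∑ i, C (w i) * ∏ l ∈ univ.erase i, (X - C (x l))

lemma degree_fractionNumerator_lt {n : ℕ} (x w : Fin n → ℝ) :
    (fractionNumerator x w).degree < n := by
  unfold fractionNumerator
  refine lt_of_le_of_lt (Polynomial.degree_sum_le _ _) ?_
  rw [Finset.sup_lt_iff (WithBot.bot_lt_coe _)]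
  intro i _
  rw [← Polynomial.smul_eq_C_mul]
  refine lt_of_le_of_lt (Polynomial.degree_smul_le _ _) ?_
  rw [Polynomial.degree_eq_natDegree
    (Polynomial.Monic.ne_zero (monic_prod_of_monic _ _ fun _ _ => monic_X_sub_C _)),
    Polynomial.natDegree_finsetProd_X_sub_C_eq_card, Finset.card_erase_of_mem (mem_univ _),
    Finset.card_fin]
  exact_mod_cast Nat.sub_lt (Fin.pos i) one_pos

lemma eval_node_fractionNumerator {n : ℕ} (x w : Fin n → ℝ) (k : Fin n) :
    (fractionNumerator x w).eval (x k) = w k * ∏ l ∈ univ.erase k, (x k - x l) := by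
  unfold fractionNumerator
  simp only [eval_finsetSum, eval_mul, eval_C, eval_prod, eval_sub, eval_X]
  refine Finset.sum_eq_single k (fun i _ hik => ?_) (fun h => absurd (mem_univ _) h)
  rw [Finset.prod_eq_zero (mem_erase.2 ⟨hik.symm, mem_univ k⟩) (sub_self _), mul_zero]

lemma eval_fractionNumerator {n : ℕ} (x w : Fin n → ℝ) {t : ℝ} (ht : ∀ i, t ≠ x i) :
    (fractionNumerator x w).eval t = (∑ i, w i / (t - x i)) * ∏ i, (t - x i) := by
  unfold fractionNumerator
  simp only [eval_finsetSum, eval_mul, eval_C, eval_prod, eval_sub, eval_X, Finset.sum_mul]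
  refine Finset.sum_congr rfl fun i _ => ?_
  rw [← Finset.mul_prod_erase univ _ (mem_univ i)]
  have := sub_ne_zero.2 (ht i)
  field_simp

lemma coeff_fractionNumerator {n : ℕ} (x w : Fin (n + 1) → ℝ) :
    (fractionNumerator x w).coeff n = ∑ i, w i := by
  unfold fractionNumerator
  rw [Polynomial.finsetSum_coeff]
  refine Finset.sum_congr rfl fun i _ => ?_
  rw [Polynomial.coeff_C_mul]
  have h1 : (∏ l ∈ univ.erase i, (X - C (x l))).Monic :=
    monic_prod_of_monic _ _ fun _ _ => monic_X_sub_C _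
  have h2 : (∏ l ∈ univ.erase i, (X - C (x l))).natDegree = n := by
    rw [Polynomial.natDegree_finsetProd_X_sub_C_eq_card, Finset.card_erase_of_mem (mem_univ _),
      Finset.card_fin, Nat.add_sub_cancel]
  have h3 := h1.coeff_natDegree
  rw [h2] at h3
  rw [h3, mul_one]

lemma prod_erase_sub_ne_zero {n : ℕ} {x : Fin n → ℝ} (hx : Function.Injective x) (k : Fin n) :
    ∏ l ∈ univ.erase k, (x k - x l) ≠ 0 :=
  Finset.prod_ne_zero_iff.2 fun _ hl => sub_ne_zero.2 fun h =>
    (mem_erase.1 hl).1 (hx h).symm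

/-- Lagrange interpolation: a polynomial of degree less than the number of nodes is the numerator
of its partial fraction decomposition. -/
lemma eq_fractionNumerator {n : ℕ} {x : Fin n → ℝ} (hx : Function.Injective x) {p : ℝ[X]}
    (hp : p.degree < n) {w : Fin n → ℝ}
    (hw : ∀ k, p.eval (x k) = w k * ∏ l ∈ univ.erase k, (x k - x l)) :
    p = fractionNumerator x w := by
  refine Polynomial.eq_of_degree_sub_lt_of_eval_index_eq (s := univ) (v := x) hx.injOn ?_ ?_
  · refine lt_of_le_of_lt (Polynomial.degree_sub_le _ _) ?_
    simpa using max_lt hp (degree_fractionNumerator_lt x w)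
  · intro i _
    rw [hw, eval_node_fractionNumerator]

lemma fractionNumerator_injective {n : ℕ} {x : Fin n → ℝ} (hx : Function.Injective x)
    {w w' : Fin n → ℝ} (h : fractionNumerator x w = fractionNumerator x w') : w = w' := by
  funext k
  have := congrArg (eval (x k)) h
  rw [eval_node_fractionNumerator, eval_node_fractionNumerator] at this
  exact mul_right_cancel₀ (prod_erase_sub_ne_zero hx k) this

/-- At consecutive nodes the products `∏_{l ≠ k} (x k - x l)` have opposite signs. -/
lemma prod_erase_sub_mul_neg {n : ℕ} {x : Fin (n + 1) → ℝ} (hx : StrictMono x) (i : Fin n) :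
    (∏ l ∈ univ.erase i.castSucc, (x i.castSucc - x l)) *
      ∏ l ∈ univ.erase i.succ, (x i.succ - x l) < 0 := by
  have hne : i.castSucc ≠ i.succ := (Fin.castSucc_lt_succ).ne
  have hlt : x i.castSucc < x i.succ := hx Fin.castSucc_lt_succ
  rw [← Finset.mul_prod_erase _ _ (mem_erase.2 ⟨hne.symm, mem_univ i.succ⟩),
    ← Finset.mul_prod_erase (univ.erase i.succ) _ (mem_erase.2 ⟨hne, mem_univ i.castSucc⟩),
    Finset.erase_right_comm (a := i.succ)]
  rw [mul_mul_mul_comm, ← Finset.prod_mul_distrib]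
  refine mul_neg_of_neg_of_pos (by nlinarith) (Finset.prod_pos fun l hl => ?_)
  simp only [mem_erase, mem_univ, and_true] at hl
  rcases lt_or_gt_of_ne hl.2 with h | h
  · have h1 : x l < x i.castSucc := hx h
    nlinarith
  · have h1 : i.succ < l := lt_of_le_of_ne (Fin.castSucc_lt_iff_succ_le.1 h) (Ne.symm hl.1)
    have h2 := hx h1
    nlinarith

lemma prod_erase_sub_last_pos {n : ℕ} {x : Fin (n + 1) → ℝ} (hx : StrictMono x) :
    0 < ∏ l ∈ univ.erase (Fin.last n), (x (Fin.last n) - x l) :=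
  Finset.prod_pos fun l hl => sub_pos.2 <| hx <|
    lt_of_le_of_ne (Fin.le_last l) (mem_erase.1 hl).1

lemma exists_root_of_eval_mul_neg (p : ℝ[X]) {a b : ℝ} (hab : a < b)
    (h : p.eval a * p.eval b < 0) : ∃ t, a < t ∧ t < b ∧ p.eval t = 0 := by
  rcases mul_neg_iff.1 h with ⟨h1, h2⟩ | ⟨h1, h2⟩
  · obtain ⟨t, ht, h0⟩ := intermediate_value_Ioo' hab.le p.continuous.continuousOn
      (show (0 : ℝ) ∈ Set.Ioo _ _ from ⟨h2, h1⟩)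
    exact ⟨t, ht.1, ht.2, h0⟩
  · obtain ⟨t, ht, h0⟩ := intermediate_value_Ioo hab.le p.continuous.continuousOn
      (show (0 : ℝ) ∈ Set.Ioo _ _ from ⟨h1, h2⟩)
    exact ⟨t, ht.1, ht.2, h0⟩

lemma degree_prod_X_sub_C {n : ℕ} (y : Fin n → ℝ) :
    (∏ j, (X - C (y j))).degree = (n : WithBot ℕ) := by
  rw [Polynomial.degree_eq_natDegree (Polynomial.monic_prod_X_sub_C y univ).ne_zero,
    Polynomial.natDegree_finsetProd_X_sub_C_eq_card, Finset.card_fin]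

lemma eq_of_prod_X_sub_C_eq {n : ℕ} {y y' : Fin n → ℝ} (hy : StrictMono y) (hy' : StrictMono y')
    (h : ∏ j, (X - C (y j)) = ∏ j, (X - C (y' j))) : y = y' := by
  refine (StrictMono.range_inj hy hy').1 ?_
  have key : ∀ (u : Fin n → ℝ) (t : ℝ), t ∈ Set.range u ↔ (∏ j, (X - C (u j))).eval t = 0 := by
    intro u t
    simp only [Polynomial.eval_prod, eval_sub, eval_X, eval_C, Finset.prod_eq_zero_iff, mem_univ,
      true_and, Set.mem_range, sub_eq_zero]
    exact ⟨fun ⟨j, hj⟩ => ⟨j, hj.symm⟩, fun ⟨j, hj⟩ => ⟨j, hj.symm⟩⟩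
  ext t
  rw [key, key, h]

/-! ### Positive rank-one perturbations -/

/-- The configurations `y` with `x 0 < y 0 < x 1 < y 1 < ⋯ < x (n - 1) < y (n - 1)`. -/
def interlaceAbove {n : ℕ} (x : Fin n → ℝ) : Set (Fin n → ℝ) :=
  {y | (∀ i, x i < y i) ∧ ∀ i j, i < j → y i < x j}

lemma strictMono_of_mem_interlaceAbove {n : ℕ} {x y : Fin n → ℝ} (hy : y ∈ interlaceAbove x) :
    StrictMono y := fun i j hij => (hy.2 i j hij).trans (hy.1 j)

/-- The weights `w` for which `1 - ∑ i, w i / (t - x i) = ∏ i, (t - y i) / (t - x i)`: if `x` are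
the eigenvalues of a symmetric matrix and `y` those of its perturbation by `v vᵀ`, then `w i` is
the squared component of `v` along the `i`-th eigenvector. -/
noncomputable def rankOneWeights {n : ℕ} (x y : Fin n → ℝ) (i : Fin n) : ℝ :=
  (y i - x i) * ∏ j ∈ univ.erase i, ((x i - y j) / (x i - x j))

lemma rankOneWeights_mul_prod {n : ℕ} {x : Fin n → ℝ} (hx : Function.Injective x)
    (y : Fin n → ℝ) (i : Fin n) :
    rankOneWeights x y i * ∏ l ∈ univ.erase i, (x i - x l) = -∏ j, (x i - y j) := by
  have h := prod_erase_sub_ne_zero hx i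
  rw [rankOneWeights, Finset.prod_div_distrib, ← Finset.mul_prod_erase univ _ (mem_univ i)]
  field_simp
  ring

lemma prod_X_sub_C_eq_sub_fractionNumerator {n : ℕ} {x : Fin n → ℝ} (hx : Function.Injective x)
    (y : Fin n → ℝ) :
    ∏ j, (X - C (y j)) = ∏ j, (X - C (x j)) - fractionNumerator x (rankOneWeights x y) := by
  have h : ∏ j, (X - C (x j)) - ∏ j, (X - C (y j)) =
      fractionNumerator x (rankOneWeights x y) := by
    refine eq_fractionNumerator hx ?_ fun k => ?_
    · refine lt_of_lt_of_eq (Polynomial.degree_sub_lt_left ?_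
        (Polynomial.monic_prod_X_sub_C x univ).ne_zero ?_)
        (degree_prod_X_sub_C x)
      · rw [degree_prod_X_sub_C, degree_prod_X_sub_C]
      · rw [(Polynomial.monic_prod_X_sub_C x univ).leadingCoeff,
          (Polynomial.monic_prod_X_sub_C y univ).leadingCoeff]
    · rw [rankOneWeights_mul_prod hx]
      simp only [eval_sub, eval_prod, eval_X, eval_C]
      rw [Finset.prod_eq_zero (mem_univ k) (sub_self _), zero_sub]
  rw [← h]; ring

lemma rankOneWeights_pos {n : ℕ} {x y : Fin n → ℝ} (hx : StrictMono x)
    (hy : y ∈ interlaceAbove x) (i : Fin n) : 0 < rankOneWeights x y i := by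
  refine mul_pos (sub_pos.2 (hy.1 i)) (Finset.prod_pos fun j hj => ?_)
  rcases lt_or_gt_of_ne (mem_erase.1 hj).1 with h | h
  · exact div_pos (sub_pos.2 (hy.2 j i h)) (sub_pos.2 (hx h))
  · exact div_pos_of_neg_of_neg (sub_neg.2 ((hx h).trans (hy.1 j))) (sub_neg.2 (hx h))

lemma sum_rankOneWeights_div {n : ℕ} {x : Fin n → ℝ} (hx : Function.Injective x)
    (y : Fin n → ℝ) {t : ℝ} (ht : ∀ i, t ≠ x i) :
    ∑ i, rankOneWeights x y i / (t - x i) = 1 - (∏ i, (t - y i)) / ∏ i, (t - x i) := by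
  have h := congrArg (eval t) (prod_X_sub_C_eq_sub_fractionNumerator hx y)
  rw [eval_sub, eval_fractionNumerator x _ ht] at h
  simp only [eval_prod, eval_sub, eval_X, eval_C] at h
  have h0 : ∏ i, (t - x i) ≠ 0 := Finset.prod_ne_zero_iff.2 fun i _ => sub_ne_zero.2 (ht i)
  rw [h]
  field_simp
  ring

lemma sum_rankOneWeights {n : ℕ} {x : Fin n → ℝ} (hx : Function.Injective x) (y : Fin n → ℝ) :
    ∑ i, rankOneWeights x y i = ∑ i, y i - ∑ i, x i := by
  cases n with
  | zero => simp
  | succ n =>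
    have h := congrArg (fun p => coeff p n) (prod_X_sub_C_eq_sub_fractionNumerator hx y)
    simp only [coeff_sub, coeff_fractionNumerator] at h
    have h1 := Polynomial.prod_X_sub_C_coeff_card_pred univ x (by simp)
    have h2 := Polynomial.prod_X_sub_C_coeff_card_pred univ y (by simp)
    simp only [Finset.card_fin, Nat.add_sub_cancel] at h1 h2
    rw [h1, h2] at h
    linarith

lemma prod_rankOneWeights {n : ℕ} {x y : Fin n → ℝ} (hx : StrictMono x)
    (hy : y ∈ interlaceAbove x) :
    ∏ i, rankOneWeights x y i = (∏ i, ∏ j, |x i - y j|) / absVandermonde x ^ 2 := by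
  have h : ∀ i, rankOneWeights x y i =
      (∏ j, |x i - y j|) / ∏ l ∈ univ.erase i, |x i - x l| := by
    intro i
    have h1 := congrArg abs (rankOneWeights_mul_prod hx.injective y i)
    rw [abs_mul, abs_neg, abs_of_pos (rankOneWeights_pos hx hy i), Finset.abs_prod,
      Finset.abs_prod] at h1
    rw [← h1, mul_div_assoc, div_self, mul_one]
    rw [← Finset.abs_prod]
    exact abs_ne_zero.2 (prod_erase_sub_ne_zero hx.injective i)
  simp_rw [h, Finset.prod_div_distrib, prod_prod_erase_abs_sub]

lemma rankOneWeights_injOn {n : ℕ} {x : Fin n → ℝ} (hx : StrictMono x) :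
    Set.InjOn (rankOneWeights x) (interlaceAbove x) := by
  intro y hy y' hy' h
  refine eq_of_prod_X_sub_C_eq (strictMono_of_mem_interlaceAbove hy)
    (strictMono_of_mem_interlaceAbove hy') ?_
  rw [prod_X_sub_C_eq_sub_fractionNumerator hx.injective y, h,
    ← prod_X_sub_C_eq_sub_fractionNumerator hx.injective y']

/-- The zeros of `1 - ∑ i, w i / (t - x i)` interlace with its poles, with one zero above the last
pole. -/
lemma exists_interlaceAbove_root {n : ℕ} {x w : Fin n → ℝ} (hx : StrictMono x)
    (hw : ∀ i, 0 < w i) (i : Fin n) :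
    ∃ t, x i < t ∧ (∀ j, i < j → t < x j) ∧
      (∏ j, (X - C (x j)) - fractionNumerator x w).eval t = 0 := by
  obtain ⟨n, rfl⟩ : ∃ k, n = k + 1 := ⟨n - 1, by have := i.pos; omega⟩
  set p := ∏ j, (X - C (x j)) - fractionNumerator x w with hp
  have hev : ∀ k, p.eval (x k) = -(w k * ∏ l ∈ univ.erase k, (x k - x l)) := by
    intro k
    rw [hp, eval_sub, eval_node_fractionNumerator, eval_prod,
      Finset.prod_eq_zero (mem_univ k) (by simp), zero_sub]
  refine Fin.lastCases ?_ (fun i => ?_) i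
  · have h1 : p.eval (x (Fin.last n)) < 0 := by
      rw [hev]
      exact neg_neg_of_pos (mul_pos (hw _) (prod_erase_sub_last_pos hx))
    have hs : 0 < ∑ k, w k := Finset.sum_pos (fun k _ => hw k) ⟨0, mem_univ _⟩
    have hlast : ∀ k, x k ≤ x (Fin.last n) := fun k => hx.monotone (Fin.le_last k)
    -- at distance `∑ k, w k` above the last pole the partial fraction sum is at most `1`
    have h2 : 0 ≤ p.eval (x (Fin.last n) + ∑ k, w k) := by
      have hne : ∀ k, x (Fin.last n) + ∑ k, w k ≠ x k := fun k => by
        have := hlast k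
        linarith
      rw [hp, eval_sub, eval_fractionNumerator x w hne, eval_prod]
      simp only [eval_sub, eval_X, eval_C]
      have hpos : 0 < ∏ i, (x (Fin.last n) + ∑ k, w k - x i) :=
        Finset.prod_pos fun k _ => by
          have := hlast k
          linarith
      have hle : ∑ i, w i / (x (Fin.last n) + ∑ k, w k - x i) ≤ ∑ i, w i / ∑ k, w k := by
        refine Finset.sum_le_sum fun k _ => ?_
        have := hlast k
        exact div_le_div_of_nonneg_left (hw k).le hs (by linarith)
      rw [← Finset.sum_div, div_self hs.ne'] at hle
      nlinarith
    obtain ⟨t, ht, h0⟩ := intermediate_value_Ioc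
      (show x (Fin.last n) ≤ x (Fin.last n) + ∑ k, w k by linarith) p.continuous.continuousOn
      (show (0 : ℝ) ∈ Set.Ioc _ _ from ⟨h1, h2⟩)
    exact ⟨t, ht.1, fun j hj => absurd (Fin.le_last j) (not_le.2 hj), h0⟩
  · obtain ⟨t, h1, h2, h3⟩ := exists_root_of_eval_mul_neg p (hx (Fin.castSucc_lt_succ (i := i)))
      (by
        rw [hev, hev]
        have h := prod_erase_sub_mul_neg hx i
        have h' := mul_pos (hw i.castSucc) (hw i.succ)
        nlinarith)
    exact ⟨t, h1, fun j hj => h2.trans_le (hx.monotone (Fin.castSucc_lt_iff_succ_le.1 hj)), h3⟩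

/-- Every vector of positive weights arises from the zeros of `1 - ∑ i, w i / (t - x i)`. -/
lemma rankOneWeights_image {n : ℕ} {x : Fin n → ℝ} (hx : StrictMono x) :
    rankOneWeights x '' interlaceAbove x = {w | ∀ i, 0 < w i} := by
  refine Set.Subset.antisymm ?_ fun w hw => ?_
  · rintro _ ⟨y, hy, rfl⟩ i
    exact rankOneWeights_pos hx hy i
  · choose y h1 h2 h3 using exists_interlaceAbove_root hx hw
    have hy : y ∈ interlaceAbove x := ⟨h1, h2⟩
    refine ⟨y, hy, fractionNumerator_injective hx.injective ?_⟩
    have hinj := (strictMono_of_mem_interlaceAbove hy).injective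
    have hm : ∏ j, (X - C (y j)) = ∏ j, (X - C (x j)) - fractionNumerator x w := by
      refine Polynomial.eq_of_degree_sub_lt_of_eval_index_eq (s := univ) (v := y) hinj.injOn ?_ ?_
      · rw [← sub_add]
        refine lt_of_le_of_lt (Polynomial.degree_add_le _ _) (max_lt ?_ ?_)
        · rw [Finset.card_fin]
          refine lt_of_lt_of_eq (Polynomial.degree_sub_lt_left ?_
            (Polynomial.monic_prod_X_sub_C y univ).ne_zero ?_)
            (degree_prod_X_sub_C y)
          · rw [degree_prod_X_sub_C, degree_prod_X_sub_C]
          · rw [(Polynomial.monic_prod_X_sub_C x univ).leadingCoeff,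
              (Polynomial.monic_prod_X_sub_C y univ).leadingCoeff]
        · rw [Finset.card_fin]
          exact degree_fractionNumerator_lt x w
      · intro i _
        rw [h3 i, eval_prod, Finset.prod_eq_zero (mem_univ i) (by simp)]
    have h4 := prod_X_sub_C_eq_sub_fractionNumerator hx.injective y
    rw [hm] at h4
    exact (sub_right_injective h4).symm

/-! ### Zeros of positive partial fraction sums -/

/-- The configurations `v` with `y 0 < v 0 < y 1 < ⋯ < v (n - 1) < y n`. -/
def interlaceWithin {n : ℕ} (y : Fin (n + 1) → ℝ) : Set (Fin n → ℝ) :=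
  {v | ∀ i, y i.castSucc < v i ∧ v i < y i.succ}

lemma strictMono_of_mem_interlaceWithin {n : ℕ} {y : Fin (n + 1) → ℝ} {v : Fin n → ℝ}
    (hy : StrictMono y) (hv : v ∈ interlaceWithin y) : StrictMono v := fun i j hij =>
  ((hv i).2.trans_le (hy.monotone (Fin.succ_le_castSucc_iff.2 hij))).trans (hv j).1

/-- The weights `w` of total mass `r` for which
`∑ j, w j / (t - y j) = r * ∏ i, (t - v i) / ∏ j, (t - y j)`: for `r = 1` these are the weights
of the spectral measure of a Jacobi matrix with eigenvalues `y`, when `v` are the eigenvalues of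
the matrix with first row and column removed. -/
noncomputable def spectralWeights {n : ℕ} (y : Fin (n + 1) → ℝ) (r : ℝ) (v : Fin n → ℝ)
    (j : Fin (n + 1)) : ℝ :=
  r * ∏ i, ((y j - v i) / (y j - y (j.succAbove i)))

lemma prod_erase_eq_prod_succAbove {n : ℕ} (f : Fin (n + 1) → ℝ) (j : Fin (n + 1)) :
    ∏ l ∈ univ.erase j, f l = ∏ i, f (j.succAbove i) := by
  rw [← Finset.compl_singleton, ← Fin.image_succAbove_univ,
    Finset.prod_image Fin.succAbove_right_injective.injOn]

lemma spectralWeights_mul_prod {n : ℕ} {y : Fin (n + 1) → ℝ} (hy : Function.Injective y) (r : ℝ)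
    (v : Fin n → ℝ) (j : Fin (n + 1)) :
    spectralWeights y r v j * ∏ l ∈ univ.erase j, (y j - y l) = r * ∏ i, (y j - v i) := by
  have h := prod_erase_sub_ne_zero hy j
  rw [spectralWeights, Finset.prod_div_distrib,
    ← prod_erase_eq_prod_succAbove (fun l => y j - y l) j]
  field_simp

lemma fractionNumerator_spectralWeights {n : ℕ} {y : Fin (n + 1) → ℝ}
    (hy : Function.Injective y) (r : ℝ) (v : Fin n → ℝ) :
    fractionNumerator y (spectralWeights y r v) = C r * ∏ i, (X - C (v i)) := by
  symm
  refine eq_fractionNumerator hy ?_ fun k => ?_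
  · rw [← Polynomial.smul_eq_C_mul]
    refine lt_of_le_of_lt (Polynomial.degree_smul_le _ _) ?_
    rw [degree_prod_X_sub_C]
    exact_mod_cast Nat.lt_succ_self n
  · rw [spectralWeights_mul_prod hy]
    simp [eval_prod]

lemma spectralWeights_pos {n : ℕ} {y : Fin (n + 1) → ℝ} (hy : StrictMono y) {r : ℝ} (hr : 0 < r)
    {v : Fin n → ℝ} (hv : v ∈ interlaceWithin y) (j : Fin (n + 1)) :
    0 < spectralWeights y r v j := by
  refine mul_pos hr (Finset.prod_pos fun i _ => ?_)
  rcases lt_or_ge i.castSucc j with h | h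
  · rw [Fin.succAbove_of_castSucc_lt _ _ h]
    exact div_pos (sub_pos.2 ((hv i).2.trans_le (hy.monotone (Fin.castSucc_lt_iff_succ_le.1 h))))
      (sub_pos.2 (hy h))
  · rw [Fin.succAbove_of_le_castSucc _ _ h]
    exact div_pos_of_neg_of_neg (sub_neg.2 ((hy.monotone h).trans_lt (hv i).1))
      (sub_neg.2 (hy (h.trans_lt Fin.castSucc_lt_succ)))

lemma sum_spectralWeights_div {n : ℕ} {y : Fin (n + 1) → ℝ} (hy : Function.Injective y) (r : ℝ)
    (v : Fin n → ℝ) {t : ℝ} (ht : ∀ i, t ≠ y i) :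
    ∑ i, spectralWeights y r v i / (t - y i) = r * (∏ i, (t - v i)) / ∏ i, (t - y i) := by
  have h := congrArg (eval t) (fractionNumerator_spectralWeights hy r v)
  rw [eval_fractionNumerator y _ ht] at h
  simp only [eval_prod, eval_sub, eval_X, eval_C, eval_mul] at h
  have h0 : ∏ i, (t - y i) ≠ 0 := Finset.prod_ne_zero_iff.2 fun i _ => sub_ne_zero.2 (ht i)
  rw [← h]
  field_simp

lemma sum_spectralWeights {n : ℕ} {y : Fin (n + 1) → ℝ} (hy : Function.Injective y) (r : ℝ)
    (v : Fin n → ℝ) : ∑ i, spectralWeights y r v i = r := by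
  have h := congrArg (fun p => coeff p n) (fractionNumerator_spectralWeights hy r v)
  simp only [coeff_fractionNumerator, coeff_C_mul] at h
  have h1 := (Polynomial.monic_prod_X_sub_C v univ).coeff_natDegree
  rw [Polynomial.natDegree_finsetProd_X_sub_C_eq_card, Finset.card_fin] at h1
  rw [h, h1, mul_one]

lemma prod_spectralWeights {n : ℕ} {y : Fin (n + 1) → ℝ} (hy : StrictMono y) {r : ℝ} (hr : 0 < r)
    {v : Fin n → ℝ} (hv : v ∈ interlaceWithin y) :
    ∏ i, spectralWeights y r v i =
      r ^ (n + 1) * (∏ i, ∏ j, |y i - v j|) / absVandermonde y ^ 2 := by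
  have h : ∀ i, spectralWeights y r v i =
      r * (∏ j, |y i - v j|) / ∏ l ∈ univ.erase i, |y i - y l| := by
    intro i
    have h1 := congrArg abs (spectralWeights_mul_prod hy.injective r v i)
    rw [abs_mul, abs_mul, abs_of_pos hr, abs_of_pos (spectralWeights_pos hy hr hv i),
      Finset.abs_prod, Finset.abs_prod] at h1
    rw [← h1, mul_div_assoc, div_self, mul_one]
    rw [← Finset.abs_prod]
    exact abs_ne_zero.2 (prod_erase_sub_ne_zero hy.injective i)
  simp_rw [h, Finset.prod_div_distrib, prod_prod_erase_abs_sub, Finset.prod_mul_distrib]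
  simp

/-- The spectral weights as a function of `u = (r, v 0, …, v (n - 1))`. -/
noncomputable def spectralWeightsCons {n : ℕ} (y : Fin (n + 1) → ℝ) (u : Fin (n + 1) → ℝ) :
    Fin (n + 1) → ℝ :=
  spectralWeights y (u 0) (Fin.tail u)

lemma spectralWeightsCons_injOn {n : ℕ} {y : Fin (n + 1) → ℝ} (hy : StrictMono y) :
    Set.InjOn (spectralWeightsCons y) {u | 0 < u 0 ∧ Fin.tail u ∈ interlaceWithin y} := by
  rintro u ⟨hu, hu'⟩ v ⟨_, hv'⟩ h
  simp only [spectralWeightsCons] at h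
  have h0 : u 0 = v 0 := by
    rw [← sum_spectralWeights hy.injective (u 0) (Fin.tail u), h,
      sum_spectralWeights hy.injective]
  have h1 := fractionNumerator_spectralWeights hy.injective (u 0) (Fin.tail u)
  rw [h, fractionNumerator_spectralWeights hy.injective, h0] at h1
  have h2 := mul_left_cancel₀ (by simpa using h0 ▸ hu.ne') h1
  have h3 := eq_of_prod_X_sub_C_eq (strictMono_of_mem_interlaceWithin hy hv')
    (strictMono_of_mem_interlaceWithin hy hu') h2
  rw [← Fin.cons_self_tail u, ← Fin.cons_self_tail v, h0, h3]

/-- Every vector of positive weights arises from its total mass and the zeros of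
`∑ j, w j / (t - y j)`. -/
lemma spectralWeightsCons_image {n : ℕ} {y : Fin (n + 1) → ℝ} (hy : StrictMono y) :
    spectralWeightsCons y '' {u | 0 < u 0 ∧ Fin.tail u ∈ interlaceWithin y} =
      {w | ∀ i, 0 < w i} := by
  refine Set.Subset.antisymm ?_ fun w hw => ?_
  · rintro _ ⟨u, hu, rfl⟩ i
    exact spectralWeights_pos hy hu.1 hu.2 i
  · have hs : 0 < ∑ k, w k := Finset.sum_pos (fun k _ => hw k) ⟨0, mem_univ _⟩
    have hroot : ∀ i : Fin n, ∃ t, y i.castSucc < t ∧ t < y i.succ ∧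
        (fractionNumerator y w).eval t = 0 := by
      intro i
      refine exists_root_of_eval_mul_neg _ (hy Fin.castSucc_lt_succ) ?_
      rw [eval_node_fractionNumerator, eval_node_fractionNumerator]
      have h := prod_erase_sub_mul_neg hy i
      have h' := mul_pos (hw i.castSucc) (hw i.succ)
      nlinarith
    choose v h1 h2 h3 using hroot
    have hv : v ∈ interlaceWithin y := fun i => ⟨h1 i, h2 i⟩
    have hinj := (strictMono_of_mem_interlaceWithin hy hv).injective
    refine ⟨Fin.cons (∑ k, w k) v, ⟨by simpa using hs, by simpa using hv⟩, ?_⟩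
    simp only [spectralWeightsCons, Fin.cons_zero, Fin.tail_cons]
    refine fractionNumerator_injective hy.injective ?_
    rw [fractionNumerator_spectralWeights hy.injective]
    symm
    refine Polynomial.eq_of_degree_sub_lt_of_eval_index_eq (s := univ) (v := v) hinj.injOn ?_ ?_
    · -- both polynomials have degree at most `n` and leading coefficient `∑ k, w k`
      rw [Finset.card_fin, Polynomial.degree_lt_iff_coeff_zero]
      intro k hk
      have hb := degree_fractionNumerator_lt y w
      have hb' : (C (∑ k, w k) * ∏ i, (X - C (v i))).degree < ((n + 1 : ℕ) : WithBot ℕ) := by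
        rw [← Polynomial.smul_eq_C_mul]
        refine lt_of_le_of_lt (Polynomial.degree_smul_le _ _) ?_
        rw [degree_prod_X_sub_C]
        exact_mod_cast Nat.lt_succ_self n
      rcases eq_or_lt_of_le hk with rfl | hk
      · rw [coeff_sub, coeff_fractionNumerator, coeff_C_mul]
        have h1 := (Polynomial.monic_prod_X_sub_C v univ).coeff_natDegree
        rw [Polynomial.natDegree_finsetProd_X_sub_C_eq_card, Finset.card_fin] at h1
        rw [h1, mul_one, sub_self]
      · rw [coeff_sub, Polynomial.degree_lt_iff_coeff_zero _ _ |>.1 hb k hk,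
          Polynomial.degree_lt_iff_coeff_zero _ _ |>.1 hb' k hk, sub_zero]
    · intro i _
      rw [h3 i, eval_mul, eval_prod, Finset.prod_eq_zero (mem_univ i) (by simp), mul_zero]

end

/-! ### Change of variables from interlacing points to residues -/

section

open Finset Polynomial

lemma measurableSet_interlaceAbove {n : ℕ} (x : Fin n → ℝ) : MeasurableSet (interlaceAbove x) := by
  have : interlaceAbove x = (⋂ i, {y | x i < y i}) ∩ ⋂ i, ⋂ j, ⋂ (_ : i < j), {y | y i < x j} := by
    ext y; simp [interlaceAbove]
  rw [this]
  refine (MeasurableSet.iInter fun i =>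
    measurableSet_lt measurable_const (measurable_pi_apply i)).inter
    (MeasurableSet.iInter fun i => MeasurableSet.iInter fun j => MeasurableSet.iInter fun _ =>
      measurableSet_lt (measurable_pi_apply i) measurable_const)

lemma measurableSet_interlaceWithin {n : ℕ} (y : Fin (n + 1) → ℝ) :
    MeasurableSet (interlaceWithin y) := by
  have : interlaceWithin y = ⋂ i, {v | y (Fin.castSucc i) < v i} ∩ {v | v i < y (Fin.succ i)} := by
    ext v; simp [interlaceWithin]
  rw [this]
  exact MeasurableSet.iInter fun i => (measurableSet_lt measurable_const
    (measurable_pi_apply i)).inter (measurableSet_lt (measurable_pi_apply i) measurable_const)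

lemma hasFDerivAt_prod_sub {n : ℕ} (a : ℝ) (y : Fin n → ℝ) :
    HasFDerivAt (fun y : Fin n → ℝ => ∏ j, (a - y j))
      (∑ j, (∏ k ∈ univ.erase j, (a - y k)) •
        (-(ContinuousLinearMap.proj j : (Fin n → ℝ) →L[ℝ] ℝ))) y := by
  refine HasFDerivAt.finsetProd (u := univ) fun j _ => ?_
  exact (hasFDerivAt_apply j y).const_sub a

lemma hasFDerivAt_rankOneWeights {n : ℕ} {x : Fin n → ℝ} (hx : Function.Injective x)
    (y : Fin n → ℝ) :
    HasFDerivAt (rankOneWeights x) (Matrix.toLin' (Matrix.of fun i j =>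
      (∏ l ∈ univ.erase i, (x i - x l))⁻¹ * ∏ k ∈ univ.erase j, (x i - y k))).toContinuousLinearMap
      y := by
  rw [hasFDerivAt_pi']
  intro i
  have h : (fun y => rankOneWeights x y i) =
      fun y => (-(∏ l ∈ univ.erase i, (x i - x l))⁻¹) * ∏ j, (x i - y j) := by
    funext y
    rw [neg_mul, ← mul_neg, ← rankOneWeights_mul_prod hx,
      mul_comm (rankOneWeights x y i), inv_mul_cancel_left₀ (prod_erase_sub_ne_zero hx i)]
  rw [h]
  refine ((hasFDerivAt_prod_sub (x i) y).const_mul _).congr_fderiv ?_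
  ext v
  simp [Matrix.mulVec, dotProduct, Finset.mul_sum, mul_assoc]

/-- Up to the row factors `(∏_{l ≠ i} (x i - x l))⁻¹`, the Jacobian is the determinant of
`abs_det_eval_nodal_erase`. -/
lemma abs_det_fderiv_rankOneWeights {n : ℕ} {x y : Fin n → ℝ} (hx : Function.Injective x)
    (hy : Function.Injective y) :
    |(Matrix.toLin' (Matrix.of fun i j => (∏ l ∈ univ.erase i, (x i - x l))⁻¹ *
      ∏ k ∈ univ.erase j, (x i - y k))).toContinuousLinearMap.det| =
      absVandermonde y / absVandermonde x := by
  have h : (Matrix.of fun i j => (∏ l ∈ univ.erase i, (x i - x l))⁻¹ *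
      ∏ k ∈ univ.erase j, (x i - y k)) =
      Matrix.diagonal (fun i => (∏ l ∈ univ.erase i, (x i - x l))⁻¹) *
        Matrix.of fun i j => ∏ k ∈ univ.erase j, (x i - y k) := by
    ext i j
    simp [Matrix.diagonal_mul]
  rw [ContinuousLinearMap.det, LinearMap.coe_toContinuousLinearMap, LinearMap.det_toLin', h,
    Matrix.det_mul, Matrix.det_diagonal, abs_mul, abs_det_eval_nodal_erase x hy]
  simp only [Finset.abs_prod, abs_inv, Finset.prod_inv_distrib, prod_prod_erase_abs_sub]
  have := absVandermonde_pos hx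
  field_simp

/-- Change of variables from the weights of a rank-one perturbation to the perturbed
eigenvalues. -/
theorem lintegral_rankOneWeights {n : ℕ} {x : Fin n → ℝ} (hx : StrictMono x)
    (F : (Fin n → ℝ) → ENNReal) :
    ∫⁻ w in {w | ∀ i, 0 < w i}, F w =
      ∫⁻ y in interlaceAbove x, ENNReal.ofReal (absVandermonde y / absVandermonde x) *
        F (rankOneWeights x y) := by
  rw [← rankOneWeights_image hx, lintegral_image_eq_lintegral_abs_det_fderiv_mul volume
    (measurableSet_interlaceAbove x)
    (fun y _ => (hasFDerivAt_rankOneWeights hx.injective y).hasFDerivWithinAt)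
    (rankOneWeights_injOn hx)]
  refine setLIntegral_congr_fun (measurableSet_interlaceAbove x) fun y hy => ?_
  rw [abs_det_fderiv_rankOneWeights hx.injective (strictMono_of_mem_interlaceAbove hy).injective]

lemma hasFDerivAt_spectralWeightsCons {n : ℕ} {y : Fin (n + 1) → ℝ} (hy : Function.Injective y)
    (u : Fin (n + 1) → ℝ) :
    HasFDerivAt (spectralWeightsCons y) (Matrix.toLin' (Matrix.of fun i j =>
      (∏ l ∈ univ.erase i, (y i - y l))⁻¹ * ((Fin.cons (∏ k, (y i - Fin.tail u k))
        (fun j => ∏ k ∈ univ.erase j, (y i - Fin.tail u k)) : Fin (n + 1) → ℝ) j *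
          (Fin.cons 1 (fun _ => -u 0) : Fin (n + 1) → ℝ) j))).toContinuousLinearMap u := by
  rw [hasFDerivAt_pi']
  intro i
  have h : (fun u => spectralWeightsCons y u i) =
      fun u => (∏ l ∈ univ.erase i, (y i - y l))⁻¹ * (u 0 * ∏ j, (y i - Fin.tail u j)) := by
    funext u
    rw [← spectralWeights_mul_prod hy, mul_comm (spectralWeights y _ _ i),
      inv_mul_cancel_left₀ (prod_erase_sub_ne_zero hy i)]
    rfl
  rw [h]
  have ht : HasFDerivAt (fun u : Fin (n + 1) → ℝ => (Fin.tail u : Fin n → ℝ))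
      (ContinuousLinearMap.pi fun j : Fin n =>
        (ContinuousLinearMap.proj j.succ : (Fin (n + 1) → ℝ) →L[ℝ] ℝ)) u :=
    (ContinuousLinearMap.pi fun j : Fin n =>
        (ContinuousLinearMap.proj j.succ : (Fin (n + 1) → ℝ) →L[ℝ] ℝ)).hasFDerivAt
  have hp := (hasFDerivAt_prod_sub (y i) (Fin.tail u)).comp u ht
  refine (((hasFDerivAt_apply (0 : Fin (n + 1)) u).mul hp).const_mul _).congr_fderiv ?_
  ext v
  simp [Matrix.mulVec, dotProduct, Finset.mul_sum, mul_assoc, Fin.sum_univ_succ]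
  rw [add_comm]
  congr 2
  refine Finset.sum_congr rfl fun j _ => ?_
  ring

/-- Up to row and column factors, the Jacobian is the determinant of `abs_det_eval_nodal_cons`. -/
lemma abs_det_fderiv_spectralWeightsCons {n : ℕ} {y : Fin (n + 1) → ℝ}
    (hy : Function.Injective y) {u : Fin (n + 1) → ℝ} (hu : 0 < u 0)
    (hv : Function.Injective (Fin.tail u)) :
    |(Matrix.toLin' (Matrix.of fun i j =>
      (∏ l ∈ univ.erase i, (y i - y l))⁻¹ * ((Fin.cons (∏ k, (y i - Fin.tail u k))
        (fun j => ∏ k ∈ univ.erase j, (y i - Fin.tail u k)) : Fin (n + 1) → ℝ) j *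
          (Fin.cons 1 (fun _ => -u 0) : Fin (n + 1) → ℝ) j))).toContinuousLinearMap.det| =
      u 0 ^ n * absVandermonde (Fin.tail u) / absVandermonde y := by
  have h : (Matrix.of fun i j =>
      (∏ l ∈ univ.erase i, (y i - y l))⁻¹ * ((Fin.cons (∏ k, (y i - Fin.tail u k))
        (fun j => ∏ k ∈ univ.erase j, (y i - Fin.tail u k)) : Fin (n + 1) → ℝ) j *
          (Fin.cons 1 (fun _ => -u 0) : Fin (n + 1) → ℝ) j)) =
      Matrix.diagonal (fun i => (∏ l ∈ univ.erase i, (y i - y l))⁻¹) *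
        ((Matrix.of fun i j => (Fin.cons (∏ k, (y i - Fin.tail u k))
        (fun j => ∏ k ∈ univ.erase j, (y i - Fin.tail u k)) : Fin (n + 1) → ℝ) j) *
        Matrix.diagonal (Fin.cons 1 (fun _ => -u 0) : Fin (n + 1) → ℝ)) := by
    ext i j
    simp [Matrix.diagonal_mul, Matrix.mul_diagonal]
  rw [ContinuousLinearMap.det, LinearMap.coe_toContinuousLinearMap, LinearMap.det_toLin', h,
    Matrix.det_mul, Matrix.det_mul, Matrix.det_diagonal, Matrix.det_diagonal, abs_mul, abs_mul,
    abs_det_eval_nodal_cons y hv]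
  simp only [Finset.abs_prod, abs_inv, Finset.prod_inv_distrib, prod_prod_erase_abs_sub]
  have := absVandermonde_pos hy
  simp only [Fin.prod_univ_succ, Fin.cons_zero, Fin.cons_succ, abs_one, abs_neg, abs_of_pos hu,
    Finset.prod_const, Finset.card_fin, one_mul]
  field_simp

/-- Change of variables from the weights of a partial fraction sum to its total mass and its
zeros. -/
theorem lintegral_spectralWeights {n : ℕ} {y : Fin (n + 1) → ℝ} (hy : StrictMono y)
    {F : (Fin (n + 1) → ℝ) → ENNReal} (hF : Measurable F) :
    ∫⁻ w in {w | ∀ i, 0 < w i}, F w =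
      ∫⁻ v in interlaceWithin y, ∫⁻ r in Set.Ioi 0,
        ENNReal.ofReal (r ^ n * absVandermonde v / absVandermonde y) *
          F (spectralWeights y r v) := by
  have hms : MeasurableSet {u : Fin (n + 1) → ℝ | 0 < u 0 ∧ Fin.tail u ∈ interlaceWithin y} := by
    refine (measurableSet_lt measurable_const (measurable_pi_apply 0)).inter ?_
    refine measurableSet_interlaceWithin y |>.preimage ?_
    exact measurable_pi_lambda _ fun i => measurable_pi_apply _
  rw [← spectralWeightsCons_image hy, lintegral_image_eq_lintegral_abs_det_fderiv_mul volume
    hms (fun u _ => (hasFDerivAt_spectralWeightsCons hy.injective u).hasFDerivWithinAt)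
    (spectralWeightsCons_injOn hy)]
  have h1 : ∀ u ∈ {u : Fin (n + 1) → ℝ | 0 < u 0 ∧ Fin.tail u ∈ interlaceWithin y},
      ENNReal.ofReal |(Matrix.toLin' (Matrix.of fun i j =>
      (∏ l ∈ univ.erase i, (y i - y l))⁻¹ * ((Fin.cons (∏ k, (y i - Fin.tail u k))
        (fun j => ∏ k ∈ univ.erase j, (y i - Fin.tail u k)) : Fin (n + 1) → ℝ) j *
          (Fin.cons 1 (fun _ => -u 0) : Fin (n + 1) → ℝ) j))).toContinuousLinearMap.det| *
        F (spectralWeightsCons y u) =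
      ENNReal.ofReal (u 0 ^ n * absVandermonde (Fin.tail u) / absVandermonde y) *
        F (spectralWeights y (u 0) (Fin.tail u)) := by
    intro u hu
    rw [abs_det_fderiv_spectralWeightsCons hy.injective hu.1
      (strictMono_of_mem_interlaceWithin hy hu.2).injective]
    rfl
  rw [setLIntegral_congr_fun hms h1]
  set G : ℝ × (Fin n → ℝ) → ENNReal := fun q =>
    ENNReal.ofReal (q.1 ^ n * absVandermonde q.2 / absVandermonde y) *
        F (spectralWeights y q.1 q.2) with hG
  have hGm : Measurable G := by
    refine Measurable.mul ?_ (hF.comp ?_)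
    · refine ENNReal.measurable_ofReal.comp ?_
      unfold absVandermonde
      fun_prop
    · unfold spectralWeights
      fun_prop
  have hmp := volume_preserving_piFinSuccAbove (fun _ : Fin (n + 1) => ℝ) 0
  have hset : {u : Fin (n + 1) → ℝ | 0 < u 0 ∧ Fin.tail u ∈ interlaceWithin y} =
      (MeasurableEquiv.piFinSuccAbove (fun _ : Fin (n + 1) => ℝ) 0) ⁻¹'
        (Set.Ioi 0 ×ˢ interlaceWithin y) := by
    ext u
    simp [Fin.tail_def]
  rw [hset]
  have h2 := hmp.setLIntegral_comp_preimage (f := G)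
    ((measurableSet_Ioi (a := (0 : ℝ))).prod (measurableSet_interlaceWithin y)) hGm
  refine Eq.trans ?_ (h2.trans ?_)
  · rfl
  · rw [Measure.volume_eq_prod, ← Measure.prod_restrict, lintegral_prod_symm' _ hGm]

end

/-! ### The integrals attached to the two interlacing densities -/

section

open Finset

/-- The strictly increasing configurations of `n` points in `(0, z)`. -/
def strictChamber (n : ℕ) (z : ℝ) : Set (Fin n → ℝ) :=
  {x | StrictMono x ∧ ∀ i, 0 < x i ∧ x i < z}

/-- One step `T ↦ g / (z * (1 - T))` of the continued fraction chain, killed when `T ≥ 1`: the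
variable `g > 0` has the unnormalized density `g ^ s * exp (-(β / 2) * g)`. -/
noncomputable def fractionStep (β s z : ℝ) (f : ℝ → ENNReal) (T : ℝ) : ENNReal :=
  if T < 1 then ∫⁻ g in Set.Ioi 0, ENNReal.ofReal (g ^ s * Real.exp (-(β / 2) * g)) *
    f (g / (z * (1 - T))) else 0

lemma measurable_fractionStep (β s z : ℝ) {f : ℝ → ENNReal} (hf : Measurable f) :
    Measurable (fractionStep β s z f) := by
  unfold fractionStep
  refine Measurable.ite measurableSet_Iio ?_ measurable_const
  refine Measurable.lintegral_prod_right' (f := fun q : ℝ × ℝ =>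
    ENNReal.ofReal (q.2 ^ s * Real.exp (-(β / 2) * q.2)) * f (q.2 / (z * (1 - q.1)))) ?_
  refine Measurable.mul ?_ (hf.comp (by fun_prop))
  exact ENNReal.measurable_ofReal.comp (by fun_prop)

/-- The integral of `ψ (∑ i, w i / (z - x i))` over the configurations `x` of the Laguerre
ensemble with largest point below `z` and independent gamma weights `w`. The exponent of the
factors `x i` is `a`. -/
noncomputable def resolventIntegral (β a z : ℝ) (n : ℕ) (ψ : ℝ → ENNReal) : ENNReal :=
  ∫⁻ x in strictChamber n z, ∫⁻ w in {w : Fin n → ℝ | ∀ i, 0 < w i},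
    ENNReal.ofReal (absVandermonde x ^ β * (∏ i, x i) ^ a * Real.exp (-(β / 2) * ∑ i, x i) *
      ((∏ i, w i) ^ (β / 2 - 1) * Real.exp (-(β / 2) * ∑ i, w i))) * ψ (∑ i, w i / (z - x i))

/-- The analogue of `resolventIntegral` for configurations `0, x 0, …, x (n - 1)` with an additional
point at `0`. The weight `w 0` of that point has the exponent `a`, which is written as
`(a + 1 - β / 2) + (β / 2 - 1)` in order to keep the product over all weights. -/
noncomputable def resolventIntegralZero (β a z : ℝ) (n : ℕ) (φ : ℝ → ENNReal) : ENNReal :=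
  ∫⁻ x in strictChamber n z, ∫⁻ w in {w : Fin (n + 1) → ℝ | ∀ i, 0 < w i},
    ENNReal.ofReal (absVandermonde x ^ β * (∏ i, x i) ^ (a + β / 2) *
      Real.exp (-(β / 2) * ∑ i, x i) * (w 0 ^ (a + 1 - β / 2) * (∏ i, w i) ^ (β / 2 - 1) *
        Real.exp (-(β / 2) * ∑ i, w i))) *
      φ (∑ i, w i / (z - (Fin.cons 0 x : Fin (n + 1) → ℝ) i))

/-- The joint density of two interlacing configurations `x` and `y`, where `P` stands for the
product of the points of one of them and `s` for the sum of the points of `y`. Both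
`resolventIntegral` and `resolventIntegralZero` are integrals of such a density, in two ways
each. -/
noncomputable def interlacingDensity {k l : ℕ} (β a P s : ℝ) (x : Fin k → ℝ) (y : Fin l → ℝ) : ℝ :=
  absVandermonde x * absVandermonde y * (∏ i, ∏ j, |x i - y j|) ^ (β / 2 - 1) * P ^ a *
    Real.exp (-(β / 2) * s)

lemma measurableSet_strictMono (n : ℕ) : MeasurableSet {x : Fin n → ℝ | StrictMono x} := by
  have : {x : Fin n → ℝ | StrictMono x} = ⋂ i, ⋂ j, ⋂ (_ : i < j), {x | x i < x j} := by
    ext x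
    simp only [Set.mem_ofPred_eq, Set.mem_iInter]
    exact ⟨fun h i j hij => h hij, fun h i j hij => h i j hij⟩
  rw [this]
  exact MeasurableSet.iInter fun i => MeasurableSet.iInter fun j => MeasurableSet.iInter fun _ =>
      measurableSet_lt (measurable_pi_apply i) (measurable_pi_apply j)

lemma measurableSet_strictChamber (n : ℕ) (z : ℝ) : MeasurableSet (strictChamber n z) := by
  have : strictChamber n z = {x | StrictMono x} ∩ ⋂ i, {x | 0 < x i} ∩ {x | x i < z} := by
    ext x; simp [strictChamber]
  rw [this]
  exact (measurableSet_strictMono n).inter (MeasurableSet.iInter fun i =>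
    (measurableSet_lt measurable_const (measurable_pi_apply i)).inter
      (measurableSet_lt (measurable_pi_apply i) measurable_const))

lemma strictMono_cons_zero {n : ℕ} {z : ℝ} {x : Fin n → ℝ} (hx : x ∈ strictChamber n z) :
    StrictMono (Fin.cons 0 x : Fin (n + 1) → ℝ) := by
  rw [Fin.strictMono_iff_lt_succ]
  intro i
  rcases Fin.eq_zero_or_eq_succ i.castSucc with h | ⟨j, h⟩
  · rw [h, Fin.cons_zero, Fin.cons_succ]
    exact (hx.2 i).1
  · rw [h, Fin.cons_succ, Fin.cons_succ]
    refine hx.1 ?_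
    have := congrArg Fin.val h
    simp at this
    exact Fin.lt_def.2 (by omega)

/-- The pointwise identity behind the change of variables to the eigenvalues of a rank-one
perturbation. -/
lemma rankOne_density_identity {β a u v p d s t : ℝ} (hu : 0 < u) (hv : 0 < v) (hd : 0 < d) :
    v / u * (u ^ β * p ^ a * Real.exp (-(β / 2) * s) *
      ((d / u ^ 2) ^ (β / 2 - 1) * Real.exp (-(β / 2) * (t - s)))) =
    u * v * d ^ (β / 2 - 1) * p ^ a * Real.exp (-(β / 2) * t) := by
  obtain ⟨u, rfl⟩ : ∃ w, u = Real.exp w := ⟨_, (Real.exp_log hu).symm⟩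
  obtain ⟨d, rfl⟩ : ∃ w, d = Real.exp w := ⟨_, (Real.exp_log hd).symm⟩
  have h1 : Real.exp d / Real.exp u ^ 2 = Real.exp (d - 2 * u) := by
    rw [Real.exp_sub, ← Real.exp_nat_mul]; norm_num
  rw [h1, ← Real.exp_mul, ← Real.exp_mul, ← Real.exp_mul]
  have h2 : v / Real.exp u * (Real.exp (u * β) * p ^ a * Real.exp (-(β / 2) * s) *
      (Real.exp ((d - 2 * u) * (β / 2 - 1)) * Real.exp (-(β / 2) * (t - s)))) =
      v * p ^ a * (Real.exp (-u) * Real.exp (u * β) * Real.exp (-(β / 2) * s) *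
        Real.exp ((d - 2 * u) * (β / 2 - 1)) * Real.exp (-(β / 2) * (t - s))) := by
    rw [Real.exp_neg]; field_simp
  have h3 : Real.exp u * v * Real.exp (d * (β / 2 - 1)) * p ^ a * Real.exp (-(β / 2) * t) =
      v * p ^ a * (Real.exp u * Real.exp (d * (β / 2 - 1)) * Real.exp (-(β / 2) * t)) := by ring
  rw [h2, h3]
  simp only [← Real.exp_add]
  congr 2
  ring

lemma prod_prod_abs_sub_pos_of_mem_interlaceAbove {n : ℕ} {x y : Fin n → ℝ} (hx : StrictMono x)
    (hy : y ∈ interlaceAbove x) : 0 < ∏ i, ∏ j, |x i - y j| := by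
  refine Finset.prod_pos fun i _ => Finset.prod_pos fun j _ => abs_pos.2 (sub_ne_zero.2 ?_)
  rcases lt_or_ge j i with h | h
  · exact (hy.2 j i h).ne'
  · exact ((hx.monotone h).trans_lt (hy.1 j)).ne

lemma prod_prod_abs_sub_pos_of_mem_interlaceWithin {n : ℕ} {y : Fin (n + 1) → ℝ} {v : Fin n → ℝ}
    (hy : StrictMono y) (hv : v ∈ interlaceWithin y) : 0 < ∏ i, ∏ j, |y i - v j| := by
  refine Finset.prod_pos fun i _ => Finset.prod_pos fun j _ => abs_pos.2 (sub_ne_zero.2 ?_)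
  rcases lt_or_ge j.castSucc i with h | h
  · exact ((hv j).2.trans_le (hy.monotone (Fin.castSucc_lt_iff_succ_le.1 h))).ne'
  · exact ((hy.monotone h).trans_lt (hv j).1).ne

/-- The substitution `y = ` zeros of `1 - ∑ i, w i / (t - x i)` for the weights `w`. -/
lemma resolventIntegral_eq_interlaceAbove (β a z : ℝ) (n : ℕ) (ψ : ℝ → ENNReal) :
    resolventIntegral β a z n ψ = ∫⁻ x in strictChamber n z, ∫⁻ y in interlaceAbove x,
      ENNReal.ofReal (interlacingDensity β a (∏ i, x i) (∑ i, y i) x y) *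
        ψ (1 - (∏ i, (z - y i)) / ∏ i, (z - x i)) := by
  refine setLIntegral_congr_fun (measurableSet_strictChamber n z) fun x hx => ?_
  rw [lintegral_rankOneWeights hx.1]
  refine setLIntegral_congr_fun (measurableSet_interlaceAbove x) fun y hy => ?_
  have hu := absVandermonde_pos hx.1.injective
  have hv := absVandermonde_pos (strictMono_of_mem_interlaceAbove hy).injective
  rw [sum_rankOneWeights_div hx.1.injective y fun i => (hx.2 i).2.ne', ← mul_assoc,
    ← ENNReal.ofReal_mul (div_pos hv hu).le, prod_rankOneWeights hx.1 hy,
    sum_rankOneWeights hx.1.injective, rankOne_density_identity hu hv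
      (prod_prod_abs_sub_pos_of_mem_interlaceAbove hx.1 hy)]
  rfl

/-- The pointwise identity behind the change of variables from the gamma weights of the points
`0, x 0, …, x (n - 1)` to the eigenvalues of a rank-one perturbation. -/
lemma rankOne_density_identity_zero {β a u v p q d s t : ℝ} (hu : 0 < u) (hv : 0 < v)
    (hd : 0 < d) (hp : 0 < p) (hq : 0 < q) :
    v / (p * u) * (u ^ β * p ^ (a + β / 2) * Real.exp (-(β / 2) * s) *
      ((q / p) ^ (a + 1 - β / 2) * (q * d / (p * u) ^ 2) ^ (β / 2 - 1) *
        Real.exp (-(β / 2) * (t - s)))) =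
    u * v * d ^ (β / 2 - 1) * q ^ a * Real.exp (-(β / 2) * t) := by
  obtain ⟨u, rfl⟩ : ∃ w, u = Real.exp w := ⟨_, (Real.exp_log hu).symm⟩
  obtain ⟨v, rfl⟩ : ∃ w, v = Real.exp w := ⟨_, (Real.exp_log hv).symm⟩
  obtain ⟨d, rfl⟩ : ∃ w, d = Real.exp w := ⟨_, (Real.exp_log hd).symm⟩
  obtain ⟨p, rfl⟩ : ∃ w, p = Real.exp w := ⟨_, (Real.exp_log hp).symm⟩
  obtain ⟨q, rfl⟩ : ∃ w, q = Real.exp w := ⟨_, (Real.exp_log hq).symm⟩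
  simp only [← Real.exp_add, ← Real.exp_sub, ← Real.exp_mul, ← Real.exp_nat_mul]
  congr 1
  push_cast
  ring

/-- The pointwise identity behind the change of variables to the total mass and the zeros of a
partial fraction sum. -/
lemma spectral_density_identity {β a u v p d s r : ℝ} {n : ℕ} (hu : 0 < u) (hv : 0 < v)
    (hd : 0 < d) (hr : 0 < r) :
    r ^ n * u / v * (v ^ β * p ^ a * Real.exp (-(β / 2) * s) *
      ((r ^ (n + 1) * d / v ^ 2) ^ (β / 2 - 1) * Real.exp (-(β / 2) * r))) =
    u * v * d ^ (β / 2 - 1) * p ^ a * Real.exp (-(β / 2) * s) *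
      (r ^ (((n + 1 : ℕ) : ℝ) * (β / 2) - 1) * Real.exp (-(β / 2) * r)) := by
  have h : r ^ n * u / v * (v ^ β * (r ^ (n + 1) * d / v ^ 2) ^ (β / 2 - 1)) =
      u * v * d ^ (β / 2 - 1) * r ^ (((n + 1 : ℕ) : ℝ) * (β / 2) - 1) := by
    obtain ⟨u, rfl⟩ : ∃ w, u = Real.exp w := ⟨_, (Real.exp_log hu).symm⟩
    obtain ⟨v, rfl⟩ : ∃ w, v = Real.exp w := ⟨_, (Real.exp_log hv).symm⟩
    obtain ⟨d, rfl⟩ : ∃ w, d = Real.exp w := ⟨_, (Real.exp_log hd).symm⟩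
    obtain ⟨r, rfl⟩ : ∃ w, r = Real.exp w := ⟨_, (Real.exp_log hr).symm⟩
    simp only [← Real.exp_add, ← Real.exp_sub, ← Real.exp_mul, ← Real.exp_nat_mul]
    congr 1
    push_cast
    ring
  linear_combination (p ^ a * Real.exp (-(β / 2) * s) * Real.exp (-(β / 2) * r)) * h

/-- The pointwise identity behind the change of variables from the weights of the points
`0, x 0, …, x (n - 1)` to the total mass and the zeros of a partial fraction sum. -/
lemma spectral_density_identity_zero {β a u v p q d s r : ℝ} {n : ℕ} (hu : 0 < u) (hv : 0 < v)
    (hd : 0 < d) (hr : 0 < r) (hp : 0 < p) (hq : 0 < q) :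
    r ^ n * u / (p * v) * (v ^ β * p ^ (a + β / 2) * Real.exp (-(β / 2) * s) *
      ((r * (q / p)) ^ (a + 1 - β / 2) * (r ^ (n + 1) * (q * d) / (p * v) ^ 2) ^ (β / 2 - 1) *
        Real.exp (-(β / 2) * r))) =
    u * v * d ^ (β / 2 - 1) * q ^ a * Real.exp (-(β / 2) * s) *
      (r ^ (a + n * (β / 2)) * Real.exp (-(β / 2) * r)) := by
  obtain ⟨u, rfl⟩ : ∃ w, u = Real.exp w := ⟨_, (Real.exp_log hu).symm⟩
  obtain ⟨v, rfl⟩ : ∃ w, v = Real.exp w := ⟨_, (Real.exp_log hv).symm⟩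
  obtain ⟨d, rfl⟩ : ∃ w, d = Real.exp w := ⟨_, (Real.exp_log hd).symm⟩
  obtain ⟨r, rfl⟩ : ∃ w, r = Real.exp w := ⟨_, (Real.exp_log hr).symm⟩
  obtain ⟨p, rfl⟩ : ∃ w, p = Real.exp w := ⟨_, (Real.exp_log hp).symm⟩
  obtain ⟨q, rfl⟩ : ∃ w, q = Real.exp w := ⟨_, (Real.exp_log hq).symm⟩
  simp only [← Real.exp_add, ← Real.exp_sub, ← Real.exp_mul, ← Real.exp_nat_mul]
  congr 1
  push_cast
  ring

lemma absVandermonde_cons_zero {n : ℕ} {z : ℝ} {x : Fin n → ℝ} (hx : x ∈ strictChamber n z) :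
    absVandermonde (Fin.cons 0 x : Fin (n + 1) → ℝ) = (∏ i, x i) * absVandermonde x := by
  rw [absVandermonde_cons]
  congr 1
  exact Finset.prod_congr rfl fun i _ => by rw [zero_sub, abs_neg, abs_of_pos (hx.2 i).1]

lemma prod_prod_abs_cons_zero {k l : ℕ} (x : Fin k → ℝ) {y : Fin l → ℝ} (hy : ∀ j, 0 < y j) :
    ∏ i, ∏ j, |(Fin.cons 0 x : Fin (k + 1) → ℝ) i - y j| =
      (∏ j, y j) * ∏ i, ∏ j, |x i - y j| := by
  rw [Fin.prod_univ_succ]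
  congr 1
  exact Finset.prod_congr rfl fun j _ => by rw [Fin.cons_zero, zero_sub, abs_neg, abs_of_pos (hy j)]

lemma prod_sub_cons_zero {n : ℕ} (z : ℝ) (x : Fin n → ℝ) :
    ∏ i, (z - (Fin.cons 0 x : Fin (n + 1) → ℝ) i) = z * ∏ i, (z - x i) := by
  rw [Fin.prod_univ_succ]; simp

lemma ne_cons_zero {n : ℕ} {z : ℝ} (hz : 0 < z) {x : Fin n → ℝ} (hx : x ∈ strictChamber n z)
    (i : Fin (n + 1)) : z ≠ (Fin.cons 0 x : Fin (n + 1) → ℝ) i := by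
  refine Fin.cases ?_ (fun i => ?_) i
  · exact hz.ne'
  · exact (hx.2 i).2.ne'

lemma pos_of_mem_interlaceAbove_cons {n : ℕ} {z : ℝ} {x : Fin n → ℝ}
    (hx : x ∈ strictChamber n z) {y : Fin (n + 1) → ℝ}
    (hy : y ∈ interlaceAbove (Fin.cons 0 x : Fin (n + 1) → ℝ)) (i : Fin (n + 1)) : 0 < y i :=
  lt_of_le_of_lt (by
    refine Fin.cases ?_ (fun i => ?_) i
    · simp
    · exact (hx.2 i).1.le) (hy.1 i)

lemma pos_of_mem_interlaceWithin_cons {n : ℕ} {z : ℝ} {x : Fin n → ℝ}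
    (hx : x ∈ strictChamber n z) {y : Fin n → ℝ}
    (hy : y ∈ interlaceWithin (Fin.cons 0 x : Fin (n + 1) → ℝ)) (i : Fin n) : 0 < y i :=
  lt_of_le_of_lt (by
    refine (strictMono_cons_zero hx).monotone (Fin.zero_le i.castSucc) |>.trans' ?_
    simp) (hy i).1

/-- The substitution of `resolventIntegral_eq_interlaceAbove` with an additional pole at `0`. -/
lemma resolventIntegralZero_eq_interlaceAbove (β a : ℝ) {z : ℝ} (hz : 0 < z) (n : ℕ)
    (φ : ℝ → ENNReal) :
    resolventIntegralZero β a z n φ = ∫⁻ x in strictChamber n z,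
      ∫⁻ y in interlaceAbove (Fin.cons 0 x : Fin (n + 1) → ℝ),
      ENNReal.ofReal (interlacingDensity β a (∏ i, y i) (∑ i, y i) x y) *
        φ (1 - (∏ i, (z - y i)) / (z * ∏ i, (z - x i))) := by
  refine setLIntegral_congr_fun (measurableSet_strictChamber n z) fun x hx => ?_
  have hc := strictMono_cons_zero hx
  rw [lintegral_rankOneWeights hc]
  refine setLIntegral_congr_fun (measurableSet_interlaceAbove _) fun y hy => ?_
  have hu := absVandermonde_pos hx.1.injective
  have hv := absVandermonde_pos (strictMono_of_mem_interlaceAbove hy).injective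
  have hypos := pos_of_mem_interlaceAbove_cons hx hy
  have hp : 0 < ∏ i, x i := Finset.prod_pos fun i _ => (hx.2 i).1
  have hq : 0 < ∏ i, y i := Finset.prod_pos fun i _ => hypos i
  have hd := prod_prod_abs_sub_pos_of_mem_interlaceAbove hc hy
  rw [prod_prod_abs_cons_zero x hypos] at hd
  replace hd := (pos_iff_pos_of_mul_pos hd).1 hq
  have hw0 : rankOneWeights (Fin.cons 0 x : Fin (n + 1) → ℝ) y 0 = (∏ i, y i) / ∏ i, x i := by
    have h := rankOneWeights_mul_prod hc.injective y 0
    rw [prod_erase_eq_prod_succAbove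
      (fun l => (Fin.cons 0 x : Fin (n + 1) → ℝ) 0 - (Fin.cons 0 x : Fin (n + 1) → ℝ) l) 0] at h
    simp only [Fin.cons_zero, Fin.zero_succAbove, Fin.cons_succ, zero_sub, Finset.prod_neg,
      Finset.card_fin] at h
    rw [eq_div_iff hp.ne']
    have h1 : (-1 : ℝ) ^ n ≠ 0 := by positivity
    apply mul_left_cancel₀ h1
    rw [pow_succ] at h
    linarith
  rw [sum_rankOneWeights_div hc.injective y (ne_cons_zero hz hx), ← mul_assoc,
    absVandermonde_cons_zero hx,
    ← ENNReal.ofReal_mul (div_pos hv (mul_pos hp hu)).le, prod_rankOneWeights hc hy,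
    sum_rankOneWeights hc.injective, hw0, prod_prod_abs_cons_zero x hypos, prod_sub_cons_zero,
    absVandermonde_cons_zero hx]
  have hs : ∑ i, (Fin.cons 0 x : Fin (n + 1) → ℝ) i = ∑ i, x i := by
    rw [Fin.sum_univ_succ]; simp
  rw [hs, rankOne_density_identity_zero hu hv hd hp hq]
  rfl

lemma measurable_absVandermonde (n : ℕ) : Measurable (absVandermonde (n := n)) := by
  unfold absVandermonde
  fun_prop

/-- The substitution of the total mass `r` and the zeros `x` of `∑ j, w j / (t - y j)` for the
weights `w`. -/
lemma resolventIntegral_succ_eq_interlaceWithin (β a z : ℝ) (n : ℕ) {ψ : ℝ → ENNReal}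
    (hψ : Measurable ψ) :
    resolventIntegral β a z (n + 1) ψ = ∫⁻ y in strictChamber (n + 1) z,
      ∫⁻ x in interlaceWithin y,
      ENNReal.ofReal (interlacingDensity β a (∏ i, y i) (∑ i, y i) x y) *
        ∫⁻ r in Set.Ioi 0,
          ENNReal.ofReal (r ^ (((n + 1 : ℕ) : ℝ) * (β / 2) - 1) * Real.exp (-(β / 2) * r)) *
            ψ (r * (∏ i, (z - x i)) / ∏ i, (z - y i)) := by
  refine setLIntegral_congr_fun (measurableSet_strictChamber (n + 1) z) fun y hy => ?_
  have hm : Measurable fun w : Fin (n + 1) → ℝ =>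
      ENNReal.ofReal (absVandermonde y ^ β * (∏ i, y i) ^ a * Real.exp (-(β / 2) * ∑ i, y i) *
      ((∏ i, w i) ^ (β / 2 - 1) * Real.exp (-(β / 2) * ∑ i, w i))) *
        ψ (∑ i, w i / (z - y i)) :=
    (ENNReal.measurable_ofReal.comp (by fun_prop)).mul (hψ.comp (by fun_prop))
  rw [lintegral_spectralWeights hy.1 hm]
  refine setLIntegral_congr_fun (measurableSet_interlaceWithin _) fun x hx => ?_
  have hv := absVandermonde_pos hy.1.injective
  have hu := absVandermonde_pos (strictMono_of_mem_interlaceWithin hy.1 hx).injective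
  have hd := prod_prod_abs_sub_pos_of_mem_interlaceWithin hy.1 hx
  rw [← lintegral_const_mul']
  swap
  · exact ENNReal.ofReal_ne_top
  refine setLIntegral_congr_fun measurableSet_Ioi fun r hr => ?_
  replace hr : 0 < r := hr
  rw [sum_spectralWeights_div hy.1.injective r x fun i => (hy.2 i).2.ne', ← mul_assoc,
    ← mul_assoc (ENNReal.ofReal (interlacingDensity _ _ _ _ _ _)),
    ← ENNReal.ofReal_mul (by positivity), prod_spectralWeights hy.1 hr hx,
    sum_spectralWeights hy.1.injective, spectral_density_identity hu hv hd hr,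
    interlacingDensity, ← ENNReal.ofReal_mul' (by positivity)]
  simp_rw [abs_sub_comm (x _) (y _)]
  rw [Finset.prod_comm]

/-- The substitution of `resolventIntegral_succ_eq_interlaceWithin` with an additional pole at
`0`. -/
lemma resolventIntegralZero_eq_interlaceWithin (β a : ℝ) {z : ℝ} (hz : 0 < z) (n : ℕ)
    {φ : ℝ → ENNReal} (hφ : Measurable φ) :
    resolventIntegralZero β a z n φ = ∫⁻ y in strictChamber n z,
      ∫⁻ x in interlaceWithin (Fin.cons 0 y : Fin (n + 1) → ℝ),
      ENNReal.ofReal (interlacingDensity β a (∏ i, x i) (∑ i, y i) x y) *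
        ∫⁻ r in Set.Ioi 0,
          ENNReal.ofReal (r ^ (a + n * (β / 2)) * Real.exp (-(β / 2) * r)) *
            φ (r * (∏ i, (z - x i)) / (z * ∏ i, (z - y i))) := by
  refine setLIntegral_congr_fun (measurableSet_strictChamber n z) fun y hy => ?_
  have hc := strictMono_cons_zero hy
  have hm : Measurable fun w : Fin (n + 1) → ℝ =>
      ENNReal.ofReal (absVandermonde y ^ β * (∏ i, y i) ^ (a + β / 2) *
      Real.exp (-(β / 2) * ∑ i, y i) * (w 0 ^ (a + 1 - β / 2) * (∏ i, w i) ^ (β / 2 - 1) *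
        Real.exp (-(β / 2) * ∑ i, w i))) *
      φ (∑ i, w i / (z - (Fin.cons 0 y : Fin (n + 1) → ℝ) i)) :=
    (ENNReal.measurable_ofReal.comp (by fun_prop)).mul (hφ.comp (by fun_prop))
  rw [lintegral_spectralWeights hc hm]
  refine setLIntegral_congr_fun (measurableSet_interlaceWithin _) fun x hx => ?_
  have hxpos := pos_of_mem_interlaceWithin_cons hy hx
  have hv := absVandermonde_pos hy.1.injective
  have hu := absVandermonde_pos (strictMono_of_mem_interlaceWithin hc hx).injective
  have hd := prod_prod_abs_sub_pos_of_mem_interlaceWithin hc hx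
  have hp : 0 < ∏ i, y i := Finset.prod_pos fun i _ => (hy.2 i).1
  have hq : 0 < ∏ i, x i := Finset.prod_pos fun i _ => hxpos i
  rw [prod_prod_abs_cons_zero y hxpos] at hd
  replace hd := (pos_iff_pos_of_mul_pos hd).1 hq
  rw [← lintegral_const_mul']
  swap
  · exact ENNReal.ofReal_ne_top
  refine setLIntegral_congr_fun measurableSet_Ioi fun r hr => ?_
  replace hr : 0 < r := hr
  have hw0 : spectralWeights (Fin.cons 0 y : Fin (n + 1) → ℝ) r x 0 =
      r * ((∏ i, x i) / ∏ i, y i) := by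
    rw [spectralWeights, ← Finset.prod_div_distrib]
    congr 1
    refine Finset.prod_congr rfl fun i _ => ?_
    rw [Fin.cons_zero, Fin.zero_succAbove, Fin.cons_succ, zero_sub, zero_sub, neg_div_neg_eq]
  rw [sum_spectralWeights_div hc.injective r x (ne_cons_zero hz hy), ← mul_assoc,
    ← mul_assoc (ENNReal.ofReal (interlacingDensity _ _ _ _ _ _)),
    absVandermonde_cons_zero hy, ← ENNReal.ofReal_mul (by positivity),
    prod_spectralWeights hc hr hx, hw0, prod_prod_abs_cons_zero y hxpos,
    sum_spectralWeights hc.injective, absVandermonde_cons_zero hy,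
    spectral_density_identity_zero hu hv hd hr hp hq, prod_sub_cons_zero,
    interlacingDensity, ← ENNReal.ofReal_mul' (by positivity)]
  simp_rw [abs_sub_comm (x _) (y _)]
  rw [Finset.prod_comm]

end

/-! ### Recursion between the two integrals -/

section

open Finset

/-- An iterated integral over a family of sets as an integral over the whole space, for swapping the
order of integration. -/
lemma setLIntegral_setLIntegral_eq_ite {α γ : Type*} [MeasurableSpace α] [MeasurableSpace γ]
    {μ : Measure α} {ν : Measure γ} {S : Set α} (hS : MeasurableSet S) {T : α → Set γ}
    (hT : ∀ a, MeasurableSet (T a)) (g : α → γ → ENNReal) {F : α → γ → ENNReal}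
    (hF : ∀ a b, (a ∈ S ∧ b ∈ T a → F a b = g a b) ∧ (¬(a ∈ S ∧ b ∈ T a) → F a b = 0)) :
    ∫⁻ a in S, ∫⁻ b in T a, g a b ∂ν ∂μ = ∫⁻ a, ∫⁻ b, F a b ∂ν ∂μ := by
  rw [← lintegral_indicator hS]
  refine lintegral_congr fun a => ?_
  by_cases ha : a ∈ S
  · rw [Set.indicator_of_mem ha, ← lintegral_indicator (hT a)]
    refine lintegral_congr fun b => ?_
    by_cases hb : b ∈ T a
    · rw [Set.indicator_of_mem hb, (hF a b).1 ⟨ha, hb⟩]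
    · rw [Set.indicator_of_notMem hb, (hF a b).2 fun h => hb h.2]
  · rw [Set.indicator_of_notMem ha]
    simp [fun b => (hF a b).2 fun h => ha h.1]

lemma lt_of_prod_sub_pos {n : ℕ} {z : ℝ} {y : Fin n → ℝ} (h : ∀ i j, i < j → y i < z)
    (hp : 0 < ∏ i, (z - y i)) (i : Fin n) : y i < z := by
  by_cases hi : ∃ j, i < j
  · obtain ⟨j, hj⟩ := hi
    exact h i j hj
  · push Not at hi
    rw [← Finset.mul_prod_erase _ _ (mem_univ i)] at hp
    have h2 : 0 < ∏ j ∈ univ.erase i, (z - y j) := Finset.prod_pos fun j hj =>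
      sub_pos.2 (h j i (lt_of_le_of_ne (hi j) (mem_erase.1 hj).1))
    exact sub_pos.1 ((pos_iff_pos_of_mul_pos hp).2 h2)

lemma prod_sub_pos {n : ℕ} {z : ℝ} {y : Fin n → ℝ} (hy : y ∈ strictChamber n z) :
    0 < ∏ i, (z - y i) := Finset.prod_pos fun i _ => sub_pos.2 (hy.2 i).2

/-- Among the interlacing pairs with `x` below `z`, those with `y` below `z` are the ones with
positive characteristic polynomial `∏ i, (t - y i)` at `z`: at most the last point of `y` can
exceed `z`. -/
lemma mem_interlaceAbove_iff {n : ℕ} {z : ℝ} {x y : Fin n → ℝ} :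
    ((x ∈ strictChamber n z ∧ y ∈ interlaceAbove x) ∧ 0 < ∏ i, (z - y i)) ↔
      y ∈ strictChamber n z ∧ x ∈ interlaceWithin (Fin.cons 0 y : Fin (n + 1) → ℝ) := by
  constructor
  · rintro ⟨⟨hx, hy⟩, hp⟩
    refine ⟨⟨strictMono_of_mem_interlaceAbove hy, fun i => ⟨(hx.2 i).1.trans (hy.1 i),
      lt_of_prod_sub_pos (fun i j hij => (hy.2 i j hij).trans (hx.2 j).2) hp i⟩⟩, fun i => ⟨?_, ?_⟩⟩
    · rcases Fin.eq_zero_or_eq_succ i.castSucc with h | ⟨j, h⟩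
      · rw [h, Fin.cons_zero]; exact (hx.2 i).1
      · rw [h, Fin.cons_succ]
        refine hy.2 j i ?_
        have := congrArg Fin.val h
        simp at this
        exact Fin.lt_def.2 (by omega)
    · rw [Fin.cons_succ]; exact hy.1 i
  · rintro ⟨hy, hx⟩
    have hc := strictMono_cons_zero hy
    have hlt : ∀ i, x i < y i := fun i => by simpa using (hx i).2
    refine ⟨⟨⟨strictMono_of_mem_interlaceWithin hc hx, fun i =>
      ⟨pos_of_mem_interlaceWithin_cons hy hx i, (hlt i).trans (hy.2 i).2⟩⟩, hlt,
      fun i j hij => ?_⟩, prod_sub_pos hy⟩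
    refine lt_of_le_of_lt ?_ (hx j).1
    have h := hc.monotone (Fin.succ_le_castSucc_iff.2 hij)
    simpa using h

/-- The analogue of `mem_interlaceAbove_iff` with an additional point `0` below `x`. -/
lemma mem_interlaceAbove_cons_iff {n : ℕ} {z : ℝ} {x : Fin n → ℝ} {y : Fin (n + 1) → ℝ}
    (hz : 0 < z) :
    ((x ∈ strictChamber n z ∧ y ∈ interlaceAbove (Fin.cons 0 x : Fin (n + 1) → ℝ)) ∧
      0 < ∏ i, (z - y i)) ↔ y ∈ strictChamber (n + 1) z ∧ x ∈ interlaceWithin y := by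
  constructor
  · rintro ⟨⟨hx, hy⟩, hp⟩
    have hlt : ∀ i, (Fin.cons 0 x : Fin (n + 1) → ℝ) i < z := by
      intro i
      refine Fin.cases ?_ (fun i => ?_) i
      · simpa using hz
      · simpa using (hx.2 i).2
    refine ⟨⟨strictMono_of_mem_interlaceAbove hy, fun i =>
      ⟨pos_of_mem_interlaceAbove_cons hx hy i,
      lt_of_prod_sub_pos (fun i j hij => (hy.2 i j hij).trans (hlt j)) hp i⟩⟩, fun i => ⟨?_, ?_⟩⟩
    · simpa using hy.2 i.castSucc i.succ Fin.castSucc_lt_succ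
    · simpa using hy.1 i.succ
  · rintro ⟨hy, hx⟩
    have hxz : x ∈ strictChamber n z := ⟨strictMono_of_mem_interlaceWithin hy.1 hx, fun i =>
      ⟨(hy.2 _).1.trans (hx i).1, (hx i).2.trans (hy.2 _).2⟩⟩
    refine ⟨⟨hxz, fun i => ?_, fun i j hij => ?_⟩, prod_sub_pos hy⟩
    · refine Fin.cases ?_ (fun i => ?_) i
      · simpa using (hy.2 0).1
      · simpa using (hx i).2
    · obtain ⟨k, rfl⟩ := Fin.exists_succ_eq.2 (Fin.ne_zero_of_lt hij)
      rw [Fin.cons_succ]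
      exact (hy.1.monotone (Fin.le_castSucc_iff.2 hij)).trans_lt (hx k).1

lemma measurableSet_mem_interlaceAbove {α : Type*} [MeasurableSpace α] {n : ℕ}
    {f g : α → Fin n → ℝ} (hf : Measurable f) (hg : Measurable g) :
    MeasurableSet {p | g p ∈ interlaceAbove (f p)} := by
  have : {p | g p ∈ interlaceAbove (f p)} =
      (⋂ i, {p | f p i < g p i}) ∩ ⋂ i, ⋂ j, ⋂ (_ : i < j), {p | g p i < f p j} := by
    ext y; simp [interlaceAbove]
  rw [this]
  have hf' : ∀ i, Measurable fun p => f p i := fun i => (measurable_pi_apply i).comp hf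
  have hg' : ∀ i, Measurable fun p => g p i := fun i => (measurable_pi_apply i).comp hg
  exact (MeasurableSet.iInter fun i => measurableSet_lt (hf' i) (hg' i)).inter
    (MeasurableSet.iInter fun i => MeasurableSet.iInter fun j => MeasurableSet.iInter fun _ =>
      measurableSet_lt (hg' i) (hf' j))

lemma measurable_interlacingDensity {α : Type*} [MeasurableSpace α] {k l : ℕ} (β a : ℝ)
    {P s : α → ℝ} {x : α → Fin k → ℝ} {y : α → Fin l → ℝ} (hP : Measurable P) (hs : Measurable s)
    (hx : Measurable x) (hy : Measurable y) :
    Measurable fun p => interlacingDensity β a (P p) (s p) (x p) (y p) := by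
  unfold interlacingDensity
  have h1 := (measurable_absVandermonde k).comp hx
  have h2 := (measurable_absVandermonde l).comp hy
  simp only [Function.comp_def] at h1 h2
  fun_prop

/-- A pair `x`, `y` of interlacing configurations of `n` points is obtained by perturbing `x` with
rank one, or as the zeros of the partial fraction sum with poles `0` and `y`. At `z` the first
description has the argument `1 - ∏ (z - y) / ∏ (z - x)`, and the second one the argument
`r * ∏ (z - x) / (z * ∏ (z - y))`, which is one step of the continued fraction with a gamma variable
`r` of shape `a + n * (β / 2) + 1`. -/
theorem resolventIntegral_fractionStep (β a : ℝ) {z : ℝ} (hz : 0 < z) (n : ℕ)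
    {φ : ℝ → ENNReal} (hφ : Measurable φ) :
    resolventIntegral β a z n (fractionStep β (a + n * (β / 2)) z φ) =
      resolventIntegralZero β a z n φ := by
  classical
  rw [resolventIntegral_eq_interlaceAbove, resolventIntegralZero_eq_interlaceWithin β a hz n hφ]
  set F : (Fin n → ℝ) → (Fin n → ℝ) → ENNReal := fun x y =>
    if x ∈ strictChamber n z ∧ y ∈ interlaceAbove x then
      ENNReal.ofReal (interlacingDensity β a (∏ i, x i) (∑ i, y i) x y) *
        fractionStep β (a + n * (β / 2)) z φ (1 - (∏ i, (z - y i)) / ∏ i, (z - x i)) else 0 with hF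
  have hm : Measurable (Function.uncurry F) := by
    refine Measurable.ite ?_ (Measurable.mul ?_ ?_) measurable_const
    · exact ((measurableSet_strictChamber n z).preimage measurable_fst).inter
        (measurableSet_mem_interlaceAbove measurable_fst measurable_snd)
    · exact ENNReal.measurable_ofReal.comp (measurable_interlacingDensity β a (by fun_prop)
        (by fun_prop) measurable_fst measurable_snd)
    · exact (measurable_fractionStep _ _ _ hφ).comp (by fun_prop)
  rw [setLIntegral_setLIntegral_eq_ite (measurableSet_strictChamber n z)
    (fun x => measurableSet_interlaceAbove x) _ (F := F) fun x y =>
      ⟨fun h => if_pos h, fun h => if_neg h⟩, lintegral_lintegral_swap hm.aemeasurable]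
  symm
  refine setLIntegral_setLIntegral_eq_ite (measurableSet_strictChamber n z)
    (fun y => measurableSet_interlaceWithin _) _ fun y x => ⟨fun h => ?_, fun h => ?_⟩
  · obtain ⟨h1, h2⟩ := mem_interlaceAbove_iff.2 h
    have hx := prod_sub_pos h1.1
    rw [hF]
    simp only
    rw [if_pos h1, fractionStep, if_pos (by have := div_pos h2 hx; linarith)]
    congr 1
    refine setLIntegral_congr_fun measurableSet_Ioi fun r _ => ?_
    congr 2
    rw [sub_sub_cancel]
    field_simp
  · rw [hF]
    simp only
    split_ifs with h1
    · have h2 : ¬0 < ∏ i, (z - y i) := fun h2 => h (mem_interlaceAbove_iff.1 ⟨h1, h2⟩)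
      have hx := prod_sub_pos h1.1
      have h3 := div_nonpos_of_nonpos_of_nonneg (not_lt.1 h2) hx.le
      rw [fractionStep, if_neg (by linarith), mul_zero]
    · rfl

/-- A pair `x`, `y` of interlacing configurations of `n` and `n + 1` points is obtained by
perturbing `0, x` with rank one, or as the zeros of the partial fraction sum with poles `y`. The two
descriptions differ by one step of the continued fraction with a gamma variable of shape
`(n + 1) * (β / 2)`. -/
theorem resolventIntegralZero_fractionStep (β a : ℝ) {z : ℝ} (hz : 0 < z) (n : ℕ)
    {ψ : ℝ → ENNReal} (hψ : Measurable ψ) :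
    resolventIntegralZero β a z n
      (fractionStep β (((n + 1 : ℕ) : ℝ) * (β / 2) - 1) z ψ) =
      resolventIntegral β a z (n + 1) ψ := by
  classical
  rw [resolventIntegralZero_eq_interlaceAbove β a hz, resolventIntegral_succ_eq_interlaceWithin
    β a z n hψ]
  set F : (Fin n → ℝ) → (Fin (n + 1) → ℝ) → ENNReal := fun x y =>
    if x ∈ strictChamber n z ∧ y ∈ interlaceAbove (Fin.cons 0 x : Fin (n + 1) → ℝ) then
      ENNReal.ofReal (interlacingDensity β a (∏ i, y i) (∑ i, y i) x y) *
        fractionStep β (((n + 1 : ℕ) : ℝ) * (β / 2) - 1) z ψ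
          (1 - (∏ i, (z - y i)) / (z * ∏ i, (z - x i))) else 0 with hF
  have hcons : Measurable fun p : (Fin n → ℝ) × (Fin (n + 1) → ℝ) =>
      (Fin.cons 0 p.1 : Fin (n + 1) → ℝ) := by
    refine measurable_pi_lambda _ fun i => ?_
    refine Fin.cases ?_ (fun i => ?_) i
    · simp
    · simp only [Fin.cons_succ]; fun_prop
  have hm : Measurable (Function.uncurry F) := by
    refine Measurable.ite ?_ (Measurable.mul ?_ ?_) measurable_const
    · exact ((measurableSet_strictChamber n z).preimage measurable_fst).inter
        (measurableSet_mem_interlaceAbove hcons measurable_snd)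
    · exact ENNReal.measurable_ofReal.comp (measurable_interlacingDensity β a (by fun_prop)
        (by fun_prop) measurable_fst measurable_snd)
    · exact (measurable_fractionStep _ _ _ hψ).comp (by fun_prop)
  rw [setLIntegral_setLIntegral_eq_ite (measurableSet_strictChamber n z)
    (fun x => measurableSet_interlaceAbove _) _ (F := F) fun x y =>
      ⟨fun h => if_pos h, fun h => if_neg h⟩, lintegral_lintegral_swap hm.aemeasurable]
  symm
  refine setLIntegral_setLIntegral_eq_ite (measurableSet_strictChamber (n + 1) z)
    (fun y => measurableSet_interlaceWithin _) _ fun y x => ⟨fun h => ?_, fun h => ?_⟩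
  · obtain ⟨h1, h2⟩ := (mem_interlaceAbove_cons_iff hz).2 h
    have hx := prod_sub_pos h1.1
    rw [hF]
    simp only
    rw [if_pos h1, fractionStep,
      if_pos (by have := div_pos h2 (mul_pos hz hx); linarith)]
    congr 1
    refine setLIntegral_congr_fun measurableSet_Ioi fun r _ => ?_
    congr 2
    rw [sub_sub_cancel]
    field_simp
  · rw [hF]
    simp only
    split_ifs with h1
    · have h2 : ¬0 < ∏ i, (z - y i) := fun h2 =>
        h ((mem_interlaceAbove_cons_iff hz).1 ⟨h1, h2⟩)
      have hx := prod_sub_pos h1.1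
      have h3 := div_nonpos_of_nonpos_of_nonneg (not_lt.1 h2) (mul_pos hz hx).le
      rw [fractionStep, if_neg (by linarith), mul_zero]
    · rfl

end

/-! ### The gamma chain and the law of the largest point -/

section

open Finset ProbabilityTheory

lemma lintegral_gammaMeasure {a r : ℝ} (f : ℝ → ENNReal) :
    ∫⁻ x, f x ∂gammaMeasure a r = ∫⁻ x in Set.Ioi 0,
      ENNReal.ofReal (r ^ a / Real.Gamma a * x ^ (a - 1) * Real.exp (-(r * x))) * f x := by
  have hm : Measurable (gammaPDF a r) := (measurable_gammaPDFReal a r).ennreal_ofReal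
  rw [gammaMeasure, lintegral_withDensity_eq_lintegral_mul_non_measurable _ hm
    (Filter.Eventually.of_forall fun x => ENNReal.ofReal_lt_top)]
  rw [← setLIntegral_congr (Ioi_ae_eq_Ici (μ := volume)).symm,
    ← lintegral_indicator measurableSet_Ici]
  refine lintegral_congr fun x => ?_
  rcases lt_or_ge x 0 with h | h
  · rw [Set.indicator_of_notMem (by simpa using h), Pi.mul_apply, gammaPDF_of_neg h, zero_mul]
  · rw [Set.indicator_of_mem (by simpa using h), Pi.mul_apply, gammaPDF_of_nonneg h]

/-- One step of the continued fraction chain with a gamma variable `g` of mean `κ`, multiplied by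
`1 - t`: the expectation of `f ((1 - t) * g / (z * (1 - T)))`, or zero if `T ≥ 1`. -/
noncomputable def chainStep (β z κ t : ℝ) (f : ℝ → ENNReal) (T : ℝ) : ENNReal :=
  if T < 1 then ∫⁻ g, f ((1 - t) * g / (z * (1 - T))) ∂gammaMeasure (β / 2 * κ) (β / 2) else 0

lemma fractionStep_eq_chainStep {β κ : ℝ} (hβ : 0 < β) (hκ : 0 < κ) (z : ℝ) (f : ℝ → ENNReal)
    (T : ℝ) :
    fractionStep β (β / 2 * κ - 1) z f T =
      ENNReal.ofReal (Real.Gamma (β / 2 * κ) / (β / 2) ^ (β / 2 * κ)) *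
        chainStep β z κ 0 f T := by
  unfold fractionStep chainStep
  split_ifs with h
  · have h1 : 0 < Real.Gamma (β / 2 * κ) := Real.Gamma_pos_of_pos (by positivity)
    rw [lintegral_gammaMeasure, ← lintegral_const_mul' _ _ ENNReal.ofReal_ne_top]
    refine setLIntegral_congr_fun measurableSet_Ioi fun g hg => ?_
    replace hg : 0 < g := hg
    rw [← mul_assoc, ← ENNReal.ofReal_mul (by positivity), sub_zero, one_mul]
    congr 2
    field_simp
  · rw [mul_zero]

/-- The probability that the chain stays below `1` at its present position and during its last
`2 * j` steps, as a function of that position. The means of the gamma variables of these steps are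
`n - j, m - j + 1, …, n - 1, m`, and they are scaled by `1 - tR i` and `1 - tA i`. -/
noncomputable def chainSurvival (β z : ℝ) (m n : ℕ) (tR tA : ℕ → ℝ) : ℕ → ℝ → ENNReal
  | 0 => fun T => if T < 1 then 1 else 0
  | j + 1 => chainStep β z ((n : ℝ) - (j + 1)) (tR (j + 1))
      (chainStep β z ((m : ℝ) - j) (tA (j + 1)) (chainSurvival β z m n tR tA j))

/-- The probability that the chain started at `0` stays below `1` during all its `2 * n - 1` steps.
The means of the gamma variables are `m - n + 1, 1, m - n + 2, 2, …, n - 1, m`. -/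
noncomputable def totalSurvival (β z : ℝ) (m n : ℕ) (tR tA : ℕ → ℝ) : ENNReal :=
  chainStep β z ((m : ℝ) - n + 1) (tA n) (chainSurvival β z m n tR tA (n - 1)) 0

lemma measurable_chainStep {β κ : ℝ} (hβ : 0 < β) (hκ : 0 < κ) (z t : ℝ) {f : ℝ → ENNReal}
    (hf : Measurable f) : Measurable (chainStep β z κ t f) := by
  have := isProbabilityMeasure_gammaMeasure (a := β / 2 * κ) (r := β / 2) (by positivity)
    (by positivity)
  unfold chainStep
  refine Measurable.ite measurableSet_Iio ?_ measurable_const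
  refine Measurable.lintegral_prod_right' (f := fun q : ℝ × ℝ =>
    f ((1 - t) * q.2 / (z * (1 - q.1)))) ?_
  exact hf.comp (by fun_prop)

lemma measurable_chainSurvival {β : ℝ} (hβ : 0 < β) (z : ℝ) {m n : ℕ} (hmn : n ≤ m)
    (tR tA : ℕ → ℝ) {j : ℕ} (hj : j < n) : Measurable (chainSurvival β z m n tR tA j) := by
  induction j with
  | zero => exact Measurable.ite measurableSet_Iio measurable_const measurable_const
  | succ j ih =>
    have h1 : (j : ℝ) + 1 < n := by exact_mod_cast hj
    have h2 : (n : ℝ) ≤ m := by exact_mod_cast hmn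
    exact measurable_chainStep hβ (by linarith) _ _
      (measurable_chainStep hβ (by linarith) _ _ (ih (by omega)))

lemma chainStep_le_one {β κ : ℝ} (hβ : 0 < β) (hκ : 0 < κ) (z t : ℝ) {f : ℝ → ENNReal}
    (hf : ∀ T, f T ≤ 1) (T : ℝ) : chainStep β z κ t f T ≤ 1 := by
  have := isProbabilityMeasure_gammaMeasure (a := β / 2 * κ) (r := β / 2) (by positivity)
    (by positivity)
  unfold chainStep
  split_ifs
  · refine (lintegral_mono fun g => hf _).trans ?_
    simp
  · exact zero_le_one

lemma chainSurvival_le_one {β : ℝ} (hβ : 0 < β) (z : ℝ) {m n : ℕ} (hmn : n ≤ m)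
    (tR tA : ℕ → ℝ) {j : ℕ} (hj : j < n) (T : ℝ) : chainSurvival β z m n tR tA j T ≤ 1 := by
  induction j generalizing T with
  | zero =>
    simp only [chainSurvival]
    split_ifs <;> simp
  | succ j ih =>
    have h1 : (j : ℝ) + 1 < n := by exact_mod_cast hj
    have h2 : (n : ℝ) ≤ m := by exact_mod_cast hmn
    exact chainStep_le_one hβ (by linarith) _ _
      (chainStep_le_one hβ (by linarith) _ _ (ih (by omega))) T

lemma totalSurvival_le_one {β : ℝ} (hβ : 0 < β) (z : ℝ) {m n : ℕ} (hmn : n ≤ m) (hn : 1 ≤ n)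
    (tR tA : ℕ → ℝ) : totalSurvival β z m n tR tA ≤ 1 := by
  have h2 : (n : ℝ) ≤ m := by exact_mod_cast hmn
  exact chainStep_le_one hβ (by linarith) _ _
    (chainSurvival_le_one hβ z hmn tR tA (by omega)) 0

lemma resolventIntegral_const_mul (β a z : ℝ) (n : ℕ) {c : ENNReal} (hc : c ≠ ⊤)
    (ψ : ℝ → ENNReal) :
    resolventIntegral β a z n (fun T => c * ψ T) = c * resolventIntegral β a z n ψ := by
  unfold resolventIntegral
  simp_rw [mul_left_comm _ c, lintegral_const_mul' c _ hc]

lemma resolventIntegralZero_const_mul (β a z : ℝ) (n : ℕ) {c : ENNReal} (hc : c ≠ ⊤)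
    (ψ : ℝ → ENNReal) :
    resolventIntegralZero β a z n (fun T => c * ψ T) = c * resolventIntegralZero β a z n ψ := by
  unfold resolventIntegralZero
  simp_rw [mul_left_comm _ c, lintegral_const_mul' c _ hc]

lemma resolventIntegral_zero (β a z : ℝ) (ψ : ℝ → ENNReal) :
    resolventIntegral β a z 0 ψ = ψ 0 := by
  have h : strictChamber 0 z = Set.univ := by
    ext x
    simp only [strictChamber, Set.mem_ofPred_eq, Set.mem_univ, iff_true]
    exact ⟨fun i => i.elim0, fun i => i.elim0⟩
  have h2 : {w : Fin 0 → ℝ | ∀ i, 0 < w i} = Set.univ := by ext; simp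
  unfold resolventIntegral
  rw [h, h2]
  simp [absVandermonde, volume_pi]

lemma gamma_const_ne {β κ : ℝ} (hβ : 0 < β) (hκ : 0 < κ) :
    ENNReal.ofReal (Real.Gamma (β / 2 * κ) / (β / 2) ^ (β / 2 * κ)) ≠ 0 := by
  have h1 : 0 < Real.Gamma (β / 2 * κ) := Real.Gamma_pos_of_pos (by positivity)
  exact (ENNReal.ofReal_pos.2 (by positivity)).ne'

/-- Alternating the two recursions removes the points one by one, and each removal contributes two
steps to the chain. -/
lemma exists_resolventIntegral_eq_mul_chainSurvival {β : ℝ} (hβ : 0 < β) {m n : ℕ} (hmn : n ≤ m)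
    {j k : ℕ} (hjk : j + k + 1 = n) : ∃ C : ENNReal, C ≠ 0 ∧ C ≠ ⊤ ∧ ∀ z : ℝ, 0 < z →
      resolventIntegral β (β / 2 * ((m : ℝ) + 1 - n) - 1) z n (fun _ => 1) =
        C * resolventIntegralZero β (β / 2 * ((m : ℝ) + 1 - n) - 1) z k
          (chainSurvival β z m n 0 0 j) := by
  have h2 : (n : ℝ) ≤ m := by exact_mod_cast hmn
  induction j generalizing k with
  | zero =>
    refine ⟨_, gamma_const_ne hβ (κ := n) (by exact_mod_cast (by omega : 0 < n)),
      ENNReal.ofReal_ne_top, fun z hz => ?_⟩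
    obtain rfl : n = k + 1 := by omega
    rw [← resolventIntegralZero_fractionStep _ _ hz _ measurable_const,
      ← resolventIntegralZero_const_mul _ _ _ _ ENNReal.ofReal_ne_top]
    congr 1
    funext T
    rw [mul_comm _ (β / 2), fractionStep_eq_chainStep hβ (by positivity)]
    congr 1
    have := isProbabilityMeasure_gammaMeasure (a := β / 2 * ((k + 1 : ℕ) : ℝ)) (r := β / 2)
      (by positivity) (by positivity)
    simp only [chainStep, lintegral_one, measure_univ, chainSurvival]
  | succ j ih =>
    obtain ⟨C, hC0, hCt, hC⟩ := ih (k := k + 1) (by omega)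
    have h1 : (n : ℝ) = j + k + 2 := by
      have : ((j + 1 + k + 1 : ℕ) : ℝ) = n := by exact_mod_cast hjk
      push_cast at this
      linarith
    have hk : (0 : ℝ) ≤ k := Nat.cast_nonneg k
    have hκ1 : 0 < (m : ℝ) - j := by linarith
    have hκ2 : 0 < (n : ℝ) - (j + 1) := by linarith
    refine ⟨C * (ENNReal.ofReal (Real.Gamma (β / 2 * ((m : ℝ) - j)) /
      (β / 2) ^ (β / 2 * ((m : ℝ) - j))) *
      ENNReal.ofReal (Real.Gamma (β / 2 * ((n : ℝ) - (j + 1))) /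
      (β / 2) ^ (β / 2 * ((n : ℝ) - (j + 1))))), ?_, ?_, fun z hz => ?_⟩
    · exact mul_ne_zero hC0 (mul_ne_zero (gamma_const_ne hβ hκ1) (gamma_const_ne hβ hκ2))
    · exact ENNReal.mul_ne_top hCt (ENNReal.mul_ne_top ENNReal.ofReal_ne_top ENNReal.ofReal_ne_top)
    · have hm := measurable_chainSurvival hβ z hmn 0 0 (j := j) (by omega)
      rw [hC z hz, mul_assoc C, ← resolventIntegral_fractionStep _ _ hz _ hm]
      congr 1
      have e1 : β / 2 * ((m : ℝ) + 1 - n) - 1 + ((k + 1 : ℕ) : ℝ) * (β / 2) =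
          β / 2 * ((m : ℝ) - j) - 1 := by
        rw [h1]; push_cast; ring
      rw [e1, funext (fractionStep_eq_chainStep hβ hκ1 z _),
        resolventIntegral_const_mul _ _ _ _ ENNReal.ofReal_ne_top, mul_assoc]
      congr 1
      rw [← resolventIntegralZero_fractionStep _ _ hz _ (measurable_chainStep hβ hκ1 _ _ hm)]
      have e2 : ((k + 1 : ℕ) : ℝ) * (β / 2) - 1 = β / 2 * ((n : ℝ) - (j + 1)) - 1 := by
        rw [h1]; push_cast; ring
      rw [e2, funext (fractionStep_eq_chainStep hβ hκ2 z _),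
        resolventIntegralZero_const_mul _ _ _ _ ENNReal.ofReal_ne_top]
      rfl

lemma exists_resolventIntegral_eq_mul_totalSurvival {β : ℝ} (hβ : 0 < β) {m n : ℕ} (hmn : n ≤ m)
    (hn : 1 ≤ n) : ∃ C : ENNReal, C ≠ 0 ∧ C ≠ ⊤ ∧ ∀ z : ℝ, 0 < z →
      resolventIntegral β (β / 2 * ((m : ℝ) + 1 - n) - 1) z n (fun _ => 1) =
        C * totalSurvival β z m n 0 0 := by
  have h2 : (n : ℝ) ≤ m := by exact_mod_cast hmn
  obtain ⟨C, hC0, hCt, hC⟩ := exists_resolventIntegral_eq_mul_chainSurvival hβ hmn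
    (j := n - 1) (k := 0) (by omega)
  have hκ : 0 < (m : ℝ) - n + 1 := by linarith
  refine ⟨C * ENNReal.ofReal (Real.Gamma (β / 2 * ((m : ℝ) - n + 1)) /
      (β / 2) ^ (β / 2 * ((m : ℝ) - n + 1))), mul_ne_zero hC0 (gamma_const_ne hβ hκ),
      ENNReal.mul_ne_top hCt ENNReal.ofReal_ne_top, fun z hz => ?_⟩
  have hm := measurable_chainSurvival hβ z hmn 0 0 (j := n - 1) (by omega)
  rw [hC z hz, mul_assoc C, ← resolventIntegral_fractionStep _ _ hz _ hm, resolventIntegral_zero]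
  congr 1
  have e1 : β / 2 * ((m : ℝ) + 1 - n) - 1 + ((0 : ℕ) : ℝ) * (β / 2) =
      β / 2 * ((m : ℝ) - n + 1) - 1 := by
    push_cast; ring
  rw [e1, fractionStep_eq_chainStep hβ hκ]
  rfl

lemma integral_gamma_weights_pos_lt_top {β : ℝ} (hβ : 0 < β) (n : ℕ) :
    ∫⁻ w in {w : Fin n → ℝ | ∀ i, 0 < w i}, ENNReal.ofReal
      ((∏ i, w i) ^ (β / 2 - 1) * Real.exp (-(β / 2) * ∑ i, w i)) ≠ 0 ∧
    ∫⁻ w in {w : Fin n → ℝ | ∀ i, 0 < w i}, ENNReal.ofReal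
      ((∏ i, w i) ^ (β / 2 - 1) * Real.exp (-(β / 2) * ∑ i, w i)) ≠ ⊤ := by
  have hset : {w : Fin n → ℝ | ∀ i, 0 < w i} = Set.univ.pi fun _ => Set.Ioi 0 := by
    ext w; simp
  constructor
  · rw [← pos_iff_ne_zero, setLIntegral_pos_iff (by fun_prop)]
    have hsub : {w : Fin n → ℝ | ∀ i, 0 < w i} ⊆ (Function.support fun w : Fin n → ℝ =>
        ENNReal.ofReal ((∏ i, w i) ^ (β / 2 - 1) * Real.exp (-(β / 2) * ∑ i, w i))) := by
      intro w hw
      have hp : 0 < ∏ i, w i := Finset.prod_pos fun i _ => hw i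
      exact (ENNReal.ofReal_pos.2 (by positivity)).ne'
    rw [Set.inter_eq_right.2 hsub, hset]
    refine (isOpen_set_pi Set.finite_univ fun _ _ => isOpen_Ioi).measure_pos _ ?_
    exact ⟨fun _ => 1, by simp⟩
  · have h1 : Integrable (fun x : ℝ => x ^ (β / 2 - 1) * Real.exp (-(β / 2) * x))
        (volume.restrict (Set.Ioi 0)) := by
      have := integrableOn_rpow_mul_exp_neg_mul_rpow (p := 1) (s := β / 2 - 1) (b := β / 2)
        (by linarith) one_pos (by linarith)
      simpa [IntegrableOn] using this
    have h2 := Integrable.fintype_prod (f := fun (_ : Fin n) (x : ℝ) =>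
      x ^ (β / 2 - 1) * Real.exp (-(β / 2) * x)) (fun _ => h1)
    rw [← Measure.restrict_pi_pi, ← volume_pi, ← hset] at h2
    refine ne_of_lt ?_
    have h3 := h2.lintegral_lt_top
    refine lt_of_eq_of_lt (setLIntegral_congr_fun (hset ▸ MeasurableSet.univ_pi fun _ =>
      measurableSet_Ioi) fun w hw => ?_) h3
    rw [Finset.prod_mul_distrib, ← Real.finsetProd_rpow _ _ fun i _ => (hw i).le,
      ← Real.exp_sum, Finset.mul_sum]

lemma laguerreDensity_eq {β : ℝ} (m n : ℕ) {x : Fin n → ℝ} (hx : ∀ i, 0 < x i) :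
    laguerreDensity β m n x = absVandermonde x ^ β *
      (∏ i, x i) ^ (β / 2 * ((m : ℝ) + 1 - n) - 1) * Real.exp (-(β / 2) * ∑ i, x i) := by
  unfold laguerreDensity absVandermonde
  rw [Finset.prod_mul_distrib, Real.finsetProd_rpow _ _ fun i _ => (hx i).le, ← Real.exp_sum,
    Finset.mul_sum, mul_assoc]
  congr 1
  rw [← Real.finsetProd_rpow _ _ fun i _ => Finset.prod_nonneg fun j _ => abs_nonneg _]
  exact Finset.prod_congr rfl fun i _ => Real.finsetProd_rpow _ _ (fun j _ => abs_nonneg _) _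

lemma laguerreWeight_lt {β : ℝ} (hβ : 0 < β) (m : ℕ) {n : ℕ} (hn : 1 ≤ n) (z : ℝ) :
    laguerreWeight β m n {x | x ⟨n - 1, Nat.sub_lt hn Nat.one_pos⟩ < z} =
      ∫⁻ x in strictChamber n z, ENNReal.ofReal (laguerreDensity β m n x) := by
  have hms : MeasurableSet {x : Fin n → ℝ | x ⟨n - 1, Nat.sub_lt hn Nat.one_pos⟩ < z} :=
    measurableSet_lt (measurable_pi_apply _) measurable_const
  have hmo : MeasurableSet (orderedConfigurations n) := by
    have : orderedConfigurations n = (⋂ i, {x | 0 < x i}) ∩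
        ⋂ i, ⋂ j, ⋂ (_ : i ≤ j), {x | x i ≤ x j} := by
      ext x
      simp only [orderedConfigurations, Set.mem_ofPred_eq, Set.mem_inter_iff, Set.mem_iInter]
      exact Iff.rfl
    rw [this]
    exact (MeasurableSet.iInter fun i => measurableSet_lt measurable_const
      (measurable_pi_apply i)).inter (MeasurableSet.iInter fun i => MeasurableSet.iInter fun j =>
        MeasurableSet.iInter fun _ => measurableSet_le (measurable_pi_apply i)
          (measurable_pi_apply j))
  rw [laguerreWeight, withDensity_apply _ hms, Measure.restrict_restrict hms,
    ← lintegral_indicator (hms.inter hmo), ← lintegral_indicator (measurableSet_strictChamber n z)]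
  refine lintegral_congr fun x => ?_
  by_cases hx : x ∈ strictChamber n z
  · rw [Set.indicator_of_mem hx, Set.indicator_of_mem]
    exact ⟨(hx.2 _).2, fun i => (hx.2 i).1, hx.1.monotone⟩
  · rw [Set.indicator_of_notMem hx]
    by_cases hx' : x ∈ {x : Fin n → ℝ | x ⟨n - 1, Nat.sub_lt hn Nat.one_pos⟩ < z} ∩
        orderedConfigurations n
    · rw [Set.indicator_of_mem hx']
      obtain ⟨h1, h2, h3⟩ := hx'
      -- an ordered configuration with two equal points has density zero
      have h4 : ¬Function.Injective x := fun h4 => hx ⟨h3.strictMono_of_injective h4, fun i =>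
        ⟨h2 i, (h3 (Fin.le_def.2 (Nat.le_sub_one_of_lt i.2))).trans_lt h1⟩⟩
      obtain ⟨i, j, hij, hne⟩ : ∃ i j, x i = x j ∧ i < j := by
        simp only [Function.Injective, not_forall] at h4
        obtain ⟨i, j, h, hne⟩ := h4
        rcases lt_or_gt_of_ne hne with h' | h'
        · exact ⟨i, j, h, h'⟩
        · exact ⟨j, i, h.symm, h'⟩
      have h5 : absVandermonde x = 0 := Finset.prod_eq_zero (mem_univ i)
        (Finset.prod_eq_zero (mem_Ioi.2 hne) (by rw [hij, sub_self, abs_zero]))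
      rw [laguerreDensity_eq m n h2, h5, Real.zero_rpow hβ.ne', zero_mul, zero_mul,
        ENNReal.ofReal_zero]
    · rw [Set.indicator_of_notMem hx']

/-- The weight of the configurations below `z` is a constant multiple of the probability that the
chain with parameter `z` survives. -/
theorem exists_laguerreWeight_lt_eq {β : ℝ} (hβ : 0 < β) {m n : ℕ} (hmn : n ≤ m) (hn : 1 ≤ n) :
    ∃ C : ENNReal, C ≠ 0 ∧ C ≠ ⊤ ∧ ∀ z : ℝ, 0 < z →
      laguerreWeight β m n {x | x ⟨n - 1, Nat.sub_lt hn Nat.one_pos⟩ < z} =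
        C * totalSurvival β z m n 0 0 := by
  obtain ⟨C, hC0, hCt, hC⟩ := exists_resolventIntegral_eq_mul_totalSurvival hβ hmn hn
  obtain ⟨hG0, hGt⟩ := integral_gamma_weights_pos_lt_top hβ n
  set G := ∫⁻ w in {w : Fin n → ℝ | ∀ i, 0 < w i}, ENNReal.ofReal
      ((∏ i, w i) ^ (β / 2 - 1) * Real.exp (-(β / 2) * ∑ i, w i)) with hG
  refine ⟨G⁻¹ * C, mul_ne_zero (ENNReal.inv_ne_zero.2 hGt) hC0,
    ENNReal.mul_ne_top (ENNReal.inv_ne_top.2 hG0) hCt, fun z hz => ?_⟩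
  have h : resolventIntegral β (β / 2 * ((m : ℝ) + 1 - n) - 1) z n (fun _ => 1) =
      G * ∫⁻ x in strictChamber n z, ENNReal.ofReal (laguerreDensity β m n x) := by
    rw [← lintegral_const_mul' _ _ hGt]
    refine setLIntegral_congr_fun (measurableSet_strictChamber n z) fun x hx => ?_
    have hx0 : ∀ i, 0 < x i := fun i => (hx.2 i).1
    simp only [mul_one]
    have hp : 0 < ∏ i, x i := Finset.prod_pos fun i _ => hx0 i
    have hv := absVandermonde_pos hx.1.injective
    simp_rw [ENNReal.ofReal_mul (p := absVandermonde x ^ β *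
      (∏ i, x i) ^ (β / 2 * ((m : ℝ) + 1 - n) - 1) * Real.exp (-(β / 2) * ∑ i, x i))
      (by positivity)]
    rw [lintegral_const_mul' _ _ ENNReal.ofReal_ne_top, laguerreDensity_eq m n hx0, mul_comm]
  rw [laguerreWeight_lt hβ m hn, mul_assoc, ← hC z hz, h, ← mul_assoc,
    ENNReal.inv_mul_cancel hG0 hGt, one_mul]

end

/-! ### Exponential moments and tilting of gamma variables -/

section

open Finset ProbabilityTheory

lemma lintegral_exp_gammaMeasure {a r s : ℝ} (ha : 0 < a) (hr : 0 < r) (hs : s < r) :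
    ∫⁻ g, ENNReal.ofReal (Real.exp (s * g)) ∂gammaMeasure a r =
      ENNReal.ofReal ((1 - s / r) ^ (-a)) := by
  have hrs : 0 < r - s := sub_pos.2 hs
  have hG : 0 < Real.Gamma a := Real.Gamma_pos_of_pos ha
  have h1 : (1 : ENNReal) = ∫⁻ _, 1 ∂gammaMeasure a (r - s) := by
    have := isProbabilityMeasure_gammaMeasure ha hrs
    simp
  rw [lintegral_gammaMeasure] at h1
  rw [lintegral_gammaMeasure, ← mul_one (ENNReal.ofReal ((1 - s / r) ^ (-a))), h1,
    ← lintegral_const_mul' _ _ ENNReal.ofReal_ne_top]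
  refine setLIntegral_congr_fun measurableSet_Ioi fun g hg => ?_
  replace hg : 0 < g := hg
  have e : 1 - s / r = (r - s) / r := by field_simp
  have hp : 0 ≤ (1 - s / r) ^ (-a) := Real.rpow_nonneg (by rw [e]; positivity) _
  rw [mul_one, ← ENNReal.ofReal_mul (by positivity), ← ENNReal.ofReal_mul hp, e, Real.rpow_neg
    (by positivity), Real.div_rpow hrs.le hr.le]
  have h2 : Real.exp (-(r * g)) * Real.exp (s * g) = Real.exp (-((r - s) * g)) := by
    rw [← Real.exp_add]; ring_nf
  have h3 : 0 < (r - s) ^ a := by positivity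
  congr 1
  rw [mul_assoc, h2]
  field_simp

lemma one_sub_rpow_neg_le_exp {x a : ℝ} (hx : 0 ≤ x) (hx' : x ≤ 1 / 2) (ha : 0 ≤ a) :
    (1 - x) ^ (-a) ≤ Real.exp (a * (x + x ^ 2)) := by
  have h1 : 0 < 1 - x := by linarith
  have h2 : Real.exp (-(x + x ^ 2)) ≤ 1 - x := by
    have h3 := Real.quadratic_le_exp_of_nonneg (x := x + x ^ 2) (by positivity)
    have h4 : 0 ≤ x ^ 2 * (1 - x - x ^ 2 - x ^ 3) := by
      refine mul_nonneg (sq_nonneg x) ?_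
      have h5 : x ^ 2 ≤ 1 / 4 := by nlinarith
      have h6 : x ^ 3 ≤ 1 / 8 := by nlinarith [mul_le_mul h5 hx' hx (by norm_num)]
      linarith
    rw [Real.exp_neg, inv_le_comm₀ (Real.exp_pos _) h1, inv_eq_one_div, div_le_iff₀ h1]
    refine le_trans ?_ (mul_le_mul_of_nonneg_right h3 h1.le)
    nlinarith
  rw [Real.rpow_neg h1.le, inv_le_comm₀ (Real.rpow_pos_of_pos h1 _) (Real.exp_pos _),
    ← Real.exp_neg]
  calc Real.exp (-(a * (x + x ^ 2))) = Real.exp (-(x + x ^ 2)) ^ a := by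
        rw [← Real.exp_mul]; ring_nf
    _ ≤ (1 - x) ^ a := Real.rpow_le_rpow (Real.exp_pos _).le h2 ha

lemma lintegral_exp_gammaMeasure_le {β κ s : ℝ} (hβ : 0 < β) (hκ : 0 < κ) (hs : 0 ≤ s)
    (hs' : s ≤ β / 4) :
    ∫⁻ g, ENNReal.ofReal (Real.exp (s * g)) ∂gammaMeasure (β / 2 * κ) (β / 2) ≤
      ENNReal.ofReal (Real.exp (κ * s + 2 * κ * s ^ 2 / β)) := by
  rw [lintegral_exp_gammaMeasure (by positivity) (by positivity) (by linarith)]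
  refine ENNReal.ofReal_le_ofReal ((one_sub_rpow_neg_le_exp (by positivity) ?_
    (by positivity)).trans (le_of_eq ?_))
  · rw [div_le_div_iff₀ (by positivity) (by positivity)]; linarith
  · congr 1
    field_simp

/-- The law of a scaled gamma variable as a gamma law with an exponential density. -/
lemma lintegral_gammaMeasure_scaled {a r t : ℝ} (hr : 0 < r) (ht' : t < 1)
    (f : ℝ → ENNReal) :
    ∫⁻ g, f ((1 - t) * g) ∂gammaMeasure a r =
      ∫⁻ g, ENNReal.ofReal ((1 - t) ^ (-a) * Real.exp (-(r * t / (1 - t)) * g)) * f g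
        ∂gammaMeasure a r := by
  have h1 : 0 < 1 - t := by linarith
  rw [lintegral_gammaMeasure, lintegral_gammaMeasure]
  have himg : (fun h : ℝ => h / (1 - t)) '' Set.Ioi 0 = Set.Ioi 0 := by
    ext x
    constructor
    · rintro ⟨h, hh, rfl⟩
      exact div_pos hh h1
    · intro hx
      exact ⟨x * (1 - t), mul_pos hx h1, mul_div_cancel_right₀ _ h1.ne'⟩
  rw [← himg, lintegral_image_eq_lintegral_abs_deriv_mul measurableSet_Ioi
    (f' := fun _ => 1 / (1 - t))
    (fun x _ => ((hasDerivAt_id' x).div_const (1 - t)).hasDerivWithinAt)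
    (fun x _ y _ h => by simpa [div_left_inj' h1.ne'] using h), himg]
  refine setLIntegral_congr_fun measurableSet_Ioi fun g hg => ?_
  replace hg : 0 < g := hg
  rw [← mul_assoc, ← mul_assoc, ← ENNReal.ofReal_mul (abs_nonneg _), ← ENNReal.ofReal_mul',
    mul_div_cancel₀ _ h1.ne', abs_of_pos (by positivity), Real.div_rpow hg.le h1.le]
  swap
  · positivity
  congr 2
  have h2 : Real.exp (-(r * (g / (1 - t)))) =
      Real.exp (-(r * g)) * Real.exp (-(r * t / (1 - t)) * g) := by
    rw [← Real.exp_add]; congr 1; field_simp; ring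
  have h3 : (1 - t) ^ (a - 1) = (1 - t) ^ a / (1 - t) := by
    rw [Real.rpow_sub h1, Real.rpow_one]
  rw [h2, h3, Real.rpow_neg h1.le]
  have h4 : 0 < (1 - t) ^ a := by positivity
  field_simp

/-- The cost of scaling a gamma variable by `1 - t`, from the Cauchy–Schwarz inequality. -/
lemma sq_lintegral_gammaMeasure_scaled_le {a r t : ℝ} (ha : 0 < a) (hr : 0 < r) (ht : 0 ≤ t)
    (ht' : t < 1) {f : ℝ → ENNReal} (hf : Measurable f) :
    (∫⁻ g, f ((1 - t) * g) ∂gammaMeasure a r) ^ 2 ≤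
      ENNReal.ofReal ((1 - t ^ 2) ^ (-a)) * ∫⁻ g, f g ^ 2 ∂gammaMeasure a r := by
  have h1 : 0 < 1 - t := by linarith
  rw [lintegral_gammaMeasure_scaled hr ht']
  set D : ℝ → ENNReal := fun g =>
    ENNReal.ofReal ((1 - t) ^ (-a) * Real.exp (-(r * t / (1 - t)) * g)) with hD
  have hDm : Measurable D := by rw [hD]; fun_prop
  have hCS := ENNReal.lintegral_mul_le_Lp_mul_Lq (gammaMeasure a r)
    (Real.HolderConjugate.two_two) hDm.aemeasurable hf.aemeasurable
  have hsq : ∫⁻ g, D g ^ (2 : ℝ) ∂gammaMeasure a r = ENNReal.ofReal ((1 - t ^ 2) ^ (-a)) := by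
    have h2 : ∀ g, D g ^ (2 : ℝ) = ENNReal.ofReal ((1 - t) ^ (-(2 * a))) *
        ENNReal.ofReal (Real.exp (-(2 * (r * t / (1 - t))) * g)) := by
      intro g
      rw [hD]
      simp only
      rw [ENNReal.ofReal_rpow_of_nonneg (by positivity) (by norm_num),
        ← ENNReal.ofReal_mul (by positivity), Real.mul_rpow (by positivity) (by positivity),
        ← Real.rpow_mul h1.le, ← Real.exp_mul]
      congr 3 <;> ring
    simp_rw [h2]
    have hneg : -(2 * (r * t / (1 - t))) < r := by
      have : 0 ≤ r * t / (1 - t) := by positivity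
      linarith
    rw [lintegral_const_mul' _ _ ENNReal.ofReal_ne_top,
      lintegral_exp_gammaMeasure ha hr hneg, ← ENNReal.ofReal_mul (by positivity)]
    have e1 : 1 - -(2 * (r * t / (1 - t))) / r = (1 + t) / (1 - t) := by field_simp; ring
    have e2 : (1 - t) ^ (-(2 * a)) = ((1 - t) ^ 2) ^ (-a) := by
      rw [← Real.rpow_natCast, ← Real.rpow_mul h1.le]; congr 1; push_cast; ring
    rw [e1, e2, ← Real.mul_rpow (by positivity) (by positivity)]
    congr 2
    field_simp
    ring
  simp only [Pi.mul_apply] at hCS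
  rw [hsq] at hCS
  calc _ ≤ (ENNReal.ofReal ((1 - t ^ 2) ^ (-a)) ^ (1 / (2 : ℝ)) *
        (∫⁻ g, f g ^ (2 : ℝ) ∂gammaMeasure a r) ^ (1 / (2 : ℝ))) ^ 2 := by gcongr
    _ = _ := by
      rw [mul_pow, ← ENNReal.rpow_mul_natCast, ← ENNReal.rpow_mul_natCast]
      norm_num

lemma sq_chainStep_le {β κ t : ℝ} (hβ : 0 < β) (hκ : 0 < κ) (ht : 0 ≤ t) (ht' : t < 1) (z : ℝ)
    {f f₀ : ℝ → ENNReal} (hf : Measurable f) {C : ENNReal} (hC : C ≠ ⊤)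
    (h : ∀ T, f T ^ 2 ≤ C * f₀ T) (T : ℝ) :
    chainStep β z κ t f T ^ 2 ≤
      ENNReal.ofReal ((1 - t ^ 2) ^ (-(β / 2 * κ))) * C * chainStep β z κ 0 f₀ T := by
  unfold chainStep
  split_ifs with hT
  · have hm : Measurable fun g => f (g / (z * (1 - T))) := hf.comp (by fun_prop)
    refine (sq_lintegral_gammaMeasure_scaled_le (by positivity) (by positivity) ht ht' hm).trans ?_
    rw [mul_assoc, ← lintegral_const_mul' _ _ hC]
    gcongr with g
    rw [sub_zero, one_mul]
    exact h _
  · simp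

/-- Scaling the gamma variables of the chain costs a factor that is exponential in the sum of the
squares of the relative shifts. -/
lemma sq_chainSurvival_le {β : ℝ} (hβ : 0 < β) (z : ℝ) {m n : ℕ} (hmn : n ≤ m)
    {tR tA c : ℕ → ℝ} (hR : ∀ j, 0 ≤ tR j ∧ tR j < 1) (hA : ∀ j, 0 ≤ tA j ∧ tA j < 1)
    (hc : ∀ j < n, (1 - tR (j + 1) ^ 2) ^ (-(β / 2 * ((n : ℝ) - (j + 1)))) *
      (1 - tA (j + 1) ^ 2) ^ (-(β / 2 * ((m : ℝ) - j))) ≤ Real.exp (c j))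
    {j : ℕ} (hj : j < n) (T : ℝ) :
    chainSurvival β z m n tR tA j T ^ 2 ≤
      ENNReal.ofReal (Real.exp (∑ i ∈ range j, c i)) * chainSurvival β z m n 0 0 j T := by
  induction j generalizing T with
  | zero =>
    simp only [chainSurvival]
    split_ifs <;> simp
  | succ j ih =>
    have h1 : (j : ℝ) + 1 < n := by exact_mod_cast hj
    have h2 : (n : ℝ) ≤ m := by exact_mod_cast hmn
    have hκ1 : 0 < (m : ℝ) - j := by linarith
    have hκ2 : 0 < (n : ℝ) - (j + 1) := by linarith
    have hm := measurable_chainSurvival hβ z hmn tR tA (j := j) (by omega)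
    have hs1 := sq_chainStep_le hβ hκ1 (hA (j + 1)).1 (hA (j + 1)).2 z hm ENNReal.ofReal_ne_top
      (ih (by omega))
    have hs2 := sq_chainStep_le hβ hκ2 (hR (j + 1)).1 (hR (j + 1)).2 z
      (measurable_chainStep hβ hκ1 _ _ hm) (ENNReal.mul_ne_top ENNReal.ofReal_ne_top
        ENNReal.ofReal_ne_top) hs1 T
    refine hs2.trans ?_
    simp only [chainSurvival, Pi.zero_apply]
    gcongr
    have hp1 : 0 ≤ (1 - tR (j + 1) ^ 2) ^ (-(β / 2 * ((n : ℝ) - (j + 1)))) :=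
      Real.rpow_nonneg (by nlinarith [hR (j + 1)]) _
    have hp2 : 0 ≤ (1 - tA (j + 1) ^ 2) ^ (-(β / 2 * ((m : ℝ) - j))) :=
      Real.rpow_nonneg (by nlinarith [hA (j + 1)]) _
    rw [← mul_assoc, ← ENNReal.ofReal_mul hp1, ← ENNReal.ofReal_mul (mul_nonneg hp1 hp2),
      Finset.sum_range_succ, add_comm (∑ i ∈ range _, c i), Real.exp_add]
    exact ENNReal.ofReal_le_ofReal (mul_le_mul_of_nonneg_right (hc j (by omega))
      (Real.exp_pos _).le)

lemma sq_totalSurvival_le {β : ℝ} (hβ : 0 < β) (z : ℝ) {m n : ℕ} (hmn : n ≤ m) (hn : 1 ≤ n)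
    {tR tA c : ℕ → ℝ} (hR : ∀ j, 0 ≤ tR j ∧ tR j < 1) (hA : ∀ j, 0 ≤ tA j ∧ tA j < 1)
    (hc : ∀ j < n, (1 - tR (j + 1) ^ 2) ^ (-(β / 2 * ((n : ℝ) - (j + 1)))) *
      (1 - tA (j + 1) ^ 2) ^ (-(β / 2 * ((m : ℝ) - j))) ≤ Real.exp (c j)) :
    totalSurvival β z m n tR tA ^ 2 ≤
      ENNReal.ofReal (Real.exp (∑ i ∈ range n, c i)) * totalSurvival β z m n 0 0 := by
  have h2 : (n : ℝ) ≤ m := by exact_mod_cast hmn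
  have hm := measurable_chainSurvival hβ z hmn tR tA (j := n - 1) (by omega)
  have hs := sq_chainStep_le hβ (κ := (m : ℝ) - n + 1) (by linarith) (hA n).1 (hA n).2 z hm
    ENNReal.ofReal_ne_top (sq_chainSurvival_le hβ z hmn hR hA hc (j := n - 1) (by omega)) 0
  refine hs.trans ?_
  simp only [totalSurvival, Pi.zero_apply]
  gcongr
  rw [← ENNReal.ofReal_mul (Real.rpow_nonneg (by nlinarith [hA n]) _)]
  refine ENNReal.ofReal_le_ofReal ?_
  obtain ⟨k, rfl⟩ : ∃ k, n = k + 1 := ⟨n - 1, by omega⟩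
  rw [Nat.add_sub_cancel, Finset.sum_range_succ, add_comm (∑ i ∈ range _, c i), Real.exp_add]
  refine mul_le_mul_of_nonneg_right (le_trans (le_of_eq ?_) (hc k (by omega))) (Real.exp_pos _).le
  push_cast
  rw [sub_self, mul_zero, neg_zero, Real.rpow_zero, one_mul]
  congr 2
  ring

end

/-! ### Survival of the chain away from the edge -/

section

open Finset ProbabilityTheory

/-- If survival after a step fails with probability at most `b`, then survival before it fails with
probability at most the mean of `b`. Statements `1 ≤ f + b` are used for `1 - f ≤ b`, as subtraction
is truncated in `ENNReal`. -/
lemma one_le_chainStep_add {β z κ t T : ℝ} (hβ : 0 < β) (hκ : 0 < κ) (hT : T < 1)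
    {f : ℝ → ENNReal} {b : ℝ → ENNReal} (hb : Measurable b) {B : ENNReal}
    (h : ∀ g, 1 ≤ f ((1 - t) * g / (z * (1 - T))) + b g)
    (hB : ∫⁻ g, b g ∂gammaMeasure (β / 2 * κ) (β / 2) ≤ B) :
    1 ≤ chainStep β z κ t f T + B := by
  have := isProbabilityMeasure_gammaMeasure (a := β / 2 * κ) (r := β / 2) (by positivity)
    (by positivity)
  rw [chainStep, if_pos hT]
  calc (1 : ENNReal) = ∫⁻ _, 1 ∂gammaMeasure (β / 2 * κ) (β / 2) := by simp
    _ ≤ ∫⁻ g, (f ((1 - t) * g / (z * (1 - T))) + b g) ∂gammaMeasure (β / 2 * κ) (β / 2) :=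
        lintegral_mono h
    _ = ∫⁻ g, f ((1 - t) * g / (z * (1 - T))) ∂gammaMeasure (β / 2 * κ) (β / 2) +
        ∫⁻ g, b g ∂gammaMeasure (β / 2 * κ) (β / 2) := lintegral_add_right _ hb
    _ ≤ _ := by gcongr

/-- Chernoff bound for a gamma variable of mean at most `M`. -/
lemma lintegral_exp_sub_gammaMeasure_le {β κ M h : ℝ} (hβ : 0 < β) (hκ : 0 < κ) (hM : κ ≤ M)
    (hh : 0 ≤ h) :
    ∫⁻ g, ENNReal.ofReal (Real.exp (β / 4 * min h 1 * (g - M * (1 + h))))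
      ∂gammaMeasure (β / 2 * κ) (β / 2) ≤
        ENNReal.ofReal (Real.exp (-(β * M * h * min h 1 / 8))) := by
  set s := β / 4 * min h 1 with hs
  have hmin0 : 0 ≤ min h 1 := le_min hh zero_le_one
  have hs0 : 0 ≤ s := by positivity
  have h1 : ∀ g : ℝ, ENNReal.ofReal (Real.exp (s * (g - M * (1 + h)))) =
      ENNReal.ofReal (Real.exp (-(s * (M * (1 + h))))) * ENNReal.ofReal (Real.exp (s * g)) := by
    intro g
    rw [← ENNReal.ofReal_mul (Real.exp_pos _).le, ← Real.exp_add]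
    ring_nf
  simp_rw [h1]
  rw [lintegral_const_mul' _ _ ENNReal.ofReal_ne_top]
  refine (mul_le_mul_right (lintegral_exp_gammaMeasure_le hβ hκ hs0 ?_) _).trans ?_
  · rw [hs]
    nlinarith [min_le_right h 1]
  · rw [← ENNReal.ofReal_mul (Real.exp_pos _).le, ← Real.exp_add]
    refine ENNReal.ofReal_le_ofReal (Real.exp_le_exp.2 ?_)
    have h2 : 2 * κ * s ^ 2 / β ≤ 2 * M * s ^ 2 / β := by gcongr
    have h3 : κ * s ≤ M * s := by gcongr
    have h4 : 2 * M * s ^ 2 / β = β * M * min h 1 * min h 1 / 8 := by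
      rw [hs]; field_simp; ring
    have h5 : β * M * min h 1 * min h 1 / 8 ≤ β * M * h * min h 1 / 8 := by
      have : 0 ≤ β * M * min h 1 := by have := hκ.le.trans hM; positivity
      nlinarith [min_le_left h 1]
    have h6 : s * (M * (1 + h)) = M * s + β * M * h * min h 1 / 4 := by rw [hs]; ring
    linarith

/-- A step from below `τ` ends below `τ'` unless the gamma variable exceeds `M * (1 + h)`. -/
lemma one_le_chainStep_add_of_threshold {β z κ M h t T τ τ' δ e : ℝ} (hβ : 0 < β) (hκ : 0 < κ)
    (hM : κ ≤ M) (hh : 0 ≤ h) (hz : 0 < z) (ht : t < 1) (hT : T ≤ τ) (hτ : τ < 1)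
    (hτ' : (1 - t) * (M * (1 + h)) / (z * (1 - τ)) ≤ τ') (he : 0 ≤ e)
    (hδ : Real.exp (-(β * M * h * min h 1 / 8)) ≤ δ) {f : ℝ → ENNReal}
    (hf : ∀ T' ≤ τ', 1 ≤ f T' + ENNReal.ofReal e) :
    1 ≤ chainStep β z κ t f T + ENNReal.ofReal (e + δ) := by
  have := isProbabilityMeasure_gammaMeasure (a := β / 2 * κ) (r := β / 2) (by positivity)
    (by positivity)
  have hδ0 : 0 ≤ δ := (Real.exp_pos _).le.trans hδ
  refine one_le_chainStep_add hβ hκ (hT.trans_lt hτ) (b := fun g => ENNReal.ofReal e +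
    ENNReal.ofReal (Real.exp (β / 4 * min h 1 * (g - M * (1 + h))))) (by fun_prop) (fun g => ?_) ?_
  · rcases le_or_gt g (M * (1 + h)) with hg | hg
    · rw [← add_assoc]
      refine le_add_right (hf _ (le_trans ?_ hτ'))
      have h0 : 0 ≤ M * (1 + h) := mul_nonneg (hκ.le.trans hM) (by linarith)
      have h1 : 0 < 1 - τ := by linarith
      have h2 : 0 < z * (1 - τ) := mul_pos hz h1
      have h3 : z * (1 - τ) ≤ z * (1 - T) := by nlinarith
      calc (1 - t) * g / (z * (1 - T)) ≤ (1 - t) * (M * (1 + h)) / (z * (1 - T)) := by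
            refine div_le_div_of_nonneg_right ?_ (h2.trans_le h3).le
            nlinarith
        _ ≤ _ := by
            refine div_le_div_of_nonneg_left (mul_nonneg (by linarith) h0) h2 h3
    · refine le_add_left (le_add_left ?_)
      rw [← ENNReal.ofReal_one]
      refine ENNReal.ofReal_le_ofReal (Real.one_le_exp ?_)
      have : 0 ≤ min h 1 := le_min hh zero_le_one
      have : 0 ≤ g - M * (1 + h) := by linarith
      positivity
  · rw [lintegral_add_left measurable_const, ENNReal.ofReal_add he hδ0]
    simp only [lintegral_const, measure_univ, mul_one]
    gcongr
    exact (lintegral_exp_sub_gammaMeasure_le hβ hκ hM hh).trans (ENNReal.ofReal_le_ofReal hδ)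

/-- Union bound over the steps: as long as the gamma variables are below `α ^ 2` and `γ ^ 2`
alternately, the chain with parameter `(α + γ) ^ 2` stays below `α / (α + γ)` and `γ / (α + γ)`
alternately. -/
lemma one_le_chainSurvival_add {β z t α γ hA hR δ : ℝ} {m n : ℕ} (hβ : 0 < β) (hmn : n ≤ m)
    (hα : 0 < α) (hγ : 0 < γ) (hhA : 0 ≤ hA) (hhR : 0 ≤ hR) (hα2 : α ^ 2 = m * (1 + hA))
    (hγ2 : γ ^ 2 = n * (1 + hR)) (ht : t < 1) (hz : (1 - t) * (α + γ) ^ 2 ≤ z)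
    (hδA : Real.exp (-(β * m * hA * min hA 1 / 8)) ≤ δ)
    (hδR : Real.exp (-(β * n * hR * min hR 1 / 8)) ≤ δ) {j : ℕ} (hj : j < n) {T : ℝ}
    (hT : T ≤ α / (α + γ)) :
    1 ≤ chainSurvival β z m n (fun _ => t) (fun _ => t) j T + ENNReal.ofReal (2 * j * δ) := by
  have hδ0 : 0 ≤ δ := (Real.exp_pos _).le.trans hδA
  have h0 : 0 < α + γ := by linarith
  have hz0 : 0 < z := lt_of_lt_of_le (mul_pos (by linarith) (by positivity)) hz
  have hτα : α / (α + γ) < 1 := by rw [div_lt_one h0]; linarith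
  have hτγ : γ / (α + γ) < 1 := by rw [div_lt_one h0]; linarith
  have hX : (1 - t) * γ ^ 2 / (z * (1 - α / (α + γ))) ≤ γ / (α + γ) := by
    have e : 1 - α / (α + γ) = γ / (α + γ) := by field_simp; ring
    rw [e, div_le_div_iff₀ (by positivity) h0]
    have : γ * (z * (γ / (α + γ))) * (α + γ) = γ ^ 2 * z := by field_simp
    refine le_of_mul_le_mul_right ?_ h0
    rw [this]
    nlinarith [sq_nonneg γ]
  have hY : (1 - t) * α ^ 2 / (z * (1 - γ / (α + γ))) ≤ α / (α + γ) := by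
    have e : 1 - γ / (α + γ) = α / (α + γ) := by field_simp; ring
    rw [e, div_le_div_iff₀ (by positivity) h0]
    have : α * (z * (α / (α + γ))) * (α + γ) = α ^ 2 * z := by field_simp
    refine le_of_mul_le_mul_right ?_ h0
    rw [this]
    nlinarith [sq_nonneg α]
  induction j generalizing T with
  | zero =>
    simp only [chainSurvival]
    rw [if_pos (hT.trans_lt hτα)]
    exact le_self_add
  | succ j ih =>
    have h1 : (j : ℝ) + 1 < n := by exact_mod_cast hj
    have h2 : (n : ℝ) ≤ m := by exact_mod_cast hmn
    have hj0 : (0 : ℝ) ≤ j := Nat.cast_nonneg j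
    rw [hα2] at hY
    rw [hγ2] at hX
    have step : ∀ T' ≤ γ / (α + γ), 1 ≤ chainStep β z ((m : ℝ) - j) t
        (chainSurvival β z m n (fun _ => t) (fun _ => t) j) T' +
          ENNReal.ofReal (2 * j * δ + δ) := fun T' hT' =>
      one_le_chainStep_add_of_threshold hβ (by linarith) (by linarith) hhA hz0 ht hT' hτγ hY
        (by positivity) hδA fun T'' hT'' => ih (by omega) hT''
    have := one_le_chainStep_add_of_threshold hβ (κ := (n : ℝ) - (j + 1)) (by linarith)
      (by linarith) hhR hz0 ht hT hτα hX (by positivity) hδR step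
    have e : 2 * ((j + 1 : ℕ) : ℝ) * δ = 2 * j * δ + δ + δ := by push_cast; ring
    rw [e]
    exact this

lemma half_le_totalSurvival_of_threshold {β z t α γ hA hR δ : ℝ} {m n : ℕ} (hβ : 0 < β)
    (hmn : n ≤ m) (hn : 1 ≤ n)
    (hα : 0 < α) (hγ : 0 < γ) (hhA : 0 ≤ hA) (hhR : 0 ≤ hR) (hα2 : α ^ 2 = m * (1 + hA))
    (hγ2 : γ ^ 2 = n * (1 + hR)) (ht : t < 1) (hz : (1 - t) * (α + γ) ^ 2 ≤ z)
    (hδA : Real.exp (-(β * m * hA * min hA 1 / 8)) ≤ δ)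
    (hδR : Real.exp (-(β * n * hR * min hR 1 / 8)) ≤ δ) (hδ : 2 * n * δ ≤ 1 / 2) :
    1 / 2 ≤ totalSurvival β z m n (fun _ => t) (fun _ => t) := by
  have hδ0 : 0 ≤ δ := (Real.exp_pos _).le.trans hδA
  have h0 : 0 < α + γ := by linarith
  have h2 : (n : ℝ) ≤ m := by exact_mod_cast hmn
  have hn' : (1 : ℝ) ≤ n := by exact_mod_cast hn
  have hz0 : 0 < z := lt_of_lt_of_le (mul_pos (by linarith) (by positivity)) hz
  have hY : (1 - t) * (m * (1 + hA)) / (z * (1 - 0)) ≤ α / (α + γ) := by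
    rw [← hα2, div_le_div_iff₀ (by linarith) h0]
    have h3 : α * (α + γ) ≤ (α + γ) ^ 2 := by nlinarith
    have h4 : 0 ≤ α * (z - (1 - t) * (α + γ) ^ 2) :=
      mul_nonneg hα.le (by linarith)
    have h5 : 0 ≤ (1 - t) * α * ((α + γ) ^ 2 - α * (α + γ)) :=
      mul_nonneg (mul_nonneg (by linarith) hα.le) (by linarith)
    nlinarith
  have hmain := one_le_chainStep_add_of_threshold (T := 0) hβ (κ := (m : ℝ) - n + 1)
    (by linarith) (by linarith) hhA hz0 ht le_rfl one_pos hY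
    (e := 2 * ((n - 1 : ℕ) : ℝ) * δ) (by positivity) hδA fun T' hT' =>
      one_le_chainSurvival_add hβ hmn hα hγ hhA hhR hα2 hγ2 ht hz hδA hδR (by omega) hT'
  have hle : 2 * ((n - 1 : ℕ) : ℝ) * δ + δ ≤ 1 / 2 := by
    rw [Nat.cast_sub hn]; push_cast; linarith
  have h6 : (1 : ENNReal) ≤ totalSurvival β z m n (fun _ => t) (fun _ => t) + 1 / 2 := by
    refine hmain.trans (add_le_add le_rfl ((ENNReal.ofReal_le_ofReal hle).trans (le_of_eq ?_)))
    rw [ENNReal.ofReal_div_of_pos two_pos]; simp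
  have h7 : (1 : ENNReal) / 2 + 1 / 2 ≤
      totalSurvival β z m n (fun _ => t) (fun _ => t) + 1 / 2 := by
    rwa [ENNReal.add_halves]
  exact (ENNReal.add_le_add_iff_right (by simp)).1 h7

/-- Scaling all gamma variables by `1 - t` is enough for survival when the parameter of the chain
exceeds `(1 - t) * (√m + √n) ^ 2` by a relative amount of order `√(n / m)`. -/
lemma half_le_totalSurvival_crude {β z t : ℝ} {m n : ℕ} (hβ : 1 ≤ β) (hmn : n ≤ m) (hn : 1 ≤ n)
    (ht : t < 1)
    (hz : (1 - t) * ((√(m : ℝ) + √(n : ℝ)) ^ 2 * (1 + 1088 * (√(n : ℝ) / √(m : ℝ)))) ≤ z) :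
    1 / 2 ≤ totalSurvival β z m n (fun _ => t) (fun _ => t) := by
  have h2 : (n : ℝ) ≤ m := by exact_mod_cast hmn
  have hn' : (1 : ℝ) ≤ n := by exact_mod_cast hn
  have hm' : (1 : ℝ) ≤ m := hn'.trans h2
  obtain ⟨u, hu, hmu⟩ : ∃ u : ℝ, 0 < u ∧ (m : ℝ) = u ^ 2 := ⟨√m, by positivity, by
    rw [Real.sq_sqrt (by linarith)]⟩
  obtain ⟨v, hv, hnv⟩ : ∃ v : ℝ, 0 < v ∧ (n : ℝ) = v ^ 2 := ⟨√n, by positivity, by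
    rw [Real.sq_sqrt (by linarith)]⟩
  rw [hmu, hnv, Real.sqrt_sq hu.le, Real.sqrt_sq hv.le] at hz
  have huv : v ≤ u := by nlinarith
  set ρ := v / u with hρ
  have hρ0 : 0 < ρ := by positivity
  have hρ1 : ρ ≤ 1 := (div_le_one hu).2 huv
  have hvρ : v = ρ * u := by rw [hρ]; field_simp
  have hα : 0 < √((m : ℝ) * (1 + 32 * ρ)) := by positivity
  have hγ : 0 < √((n : ℝ) * (1 + 32)) := by positivity
  have hα' : √((m : ℝ) * (1 + 32 * ρ)) ≤ u * (1 + 16 * ρ) := by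
    refine Real.sqrt_le_iff.2 ⟨by positivity, ?_⟩
    rw [hmu, mul_pow]
    gcongr
    nlinarith
  have hγ' : √((n : ℝ) * (1 + 32)) ≤ v * 17 := by
    refine Real.sqrt_le_iff.2 ⟨by positivity, ?_⟩
    rw [hnv]
    nlinarith [sq_nonneg v]
  -- relative excesses of order `√(n / m)` and `1` have probability at most `exp (-4 n)`
  refine half_le_totalSurvival_of_threshold (hA := 32 * ρ) (hR := 32) (δ := Real.exp (-(4 * n)))
    (by linarith) hmn hn hα hγ (by positivity) (by norm_num)
    (Real.sq_sqrt (by positivity)) (Real.sq_sqrt (by positivity)) ht ?_ ?_ ?_ ?_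
  · refine le_trans ?_ hz
    refine mul_le_mul_of_nonneg_left ?_ (by linarith)
    calc (√((m : ℝ) * (1 + 32 * ρ)) + √((n : ℝ) * (1 + 32))) ^ 2
        ≤ (u * (1 + 16 * ρ) + v * 17) ^ 2 := by gcongr
      _ ≤ ((u + v) * (1 + 32 * ρ)) ^ 2 := by
        gcongr
        have : 0 ≤ u * ρ ^ 2 := by positivity
        rw [hvρ]
        nlinarith
      _ ≤ (u + v) ^ 2 * (1 + 1088 * ρ) := by
        rw [mul_pow]
        gcongr
        nlinarith
  · refine Real.exp_le_exp.2 (neg_le_neg ?_)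
    have h4 : (m : ℝ) * ρ ^ 2 = n := by rw [hmu, hnv, hvρ]; ring
    have h5 : (n : ℝ) ≤ m * ρ := by nlinarith
    rcases le_total (32 * ρ) 1 with h | h
    · rw [min_eq_left h]
      have : β * m * (32 * ρ) * (32 * ρ) / 8 = β * (128 * n) := by rw [← h4]; ring
      rw [this]
      nlinarith
    · rw [min_eq_right h]
      have : β * m * (32 * ρ) * 1 / 8 = β * (4 * (m * ρ)) := by ring
      rw [this]
      nlinarith
  · refine Real.exp_le_exp.2 (neg_le_neg ?_)
    rw [min_eq_right (by norm_num)]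
    nlinarith
  · have h6 : Real.exp (-(4 * n)) = Real.exp (-(n : ℝ)) * Real.exp (-(3 * (n : ℝ))) := by
      rw [← Real.exp_add]; ring_nf
    have h7 : (n : ℝ) * Real.exp (-(n : ℝ)) ≤ 1 := by
      rw [Real.exp_neg, ← div_eq_mul_inv, div_le_one (Real.exp_pos _)]
      linarith [Real.add_one_le_exp (n : ℝ)]
    have h8 : Real.exp (-(3 * (n : ℝ))) ≤ 1 / 4 := by
      rw [Real.exp_neg, inv_le_comm₀ (Real.exp_pos _) (by norm_num)]
      have := Real.add_one_le_exp (3 * (n : ℝ))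
      norm_num
      linarith
    rw [h6]
    have h9 := mul_le_mul h7 h8 (Real.exp_pos _).le zero_le_one
    linarith

end

/-! ### An exponential barrier at the edge -/

section

open Finset ProbabilityTheory

/-- An exponential inequality with a quadratic loss in the exponent is corrected by an additive
error which is summable along the chain. -/
lemma exp_neg_le_exp_neg_add {Θ x y h D : ℝ} (hΘ : 0 < Θ) (hh : 0 < h) (hh1 : h ≤ 1)
    (hhx : h ^ 2 ≤ x) (hy : 0 ≤ y) (h1 : y ≤ 1 / 12 → Θ * (y + x / 2 - 6 * y ^ 2) ≤ D)
    (h2 : 1 / 12 ≤ y → Θ / 24 ≤ D) :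
    Real.exp (-D) ≤ Real.exp (-(Θ * y)) + 1152 / (Θ ^ 2 * h) := by
  rcases le_total y (1 / 12) with hy' | hy'
  · have hD := h1 hy'
    rcases le_total (12 * y ^ 2) x with hxy | hxy
    · have : Θ * y ≤ D := le_trans (by nlinarith) hD
      have h3 : Real.exp (-D) ≤ Real.exp (-(Θ * y)) := Real.exp_le_exp.2 (by linarith)
      have : 0 ≤ 1152 / (Θ ^ 2 * h) := by positivity
      linarith
    · have hhy : h ≤ 4 * y := by nlinarith
      have hy0 : 0 < y := by linarith
      set w := 6 * Θ * y ^ 2 with hw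
      have hw0 : 0 ≤ w := by positivity
      have h3 : Real.exp (-D) ≤ Real.exp (-(Θ * y) + w) := Real.exp_le_exp.2 (by
        have : 0 ≤ x := (sq_nonneg h).trans hhx
        nlinarith [mul_nonneg hΘ.le this])
      have h4 : Real.exp w ≤ 1 + w * Real.exp w := by
        have := Real.add_one_le_exp (-w)
        have h5 : Real.exp w * Real.exp (-w) = 1 := by rw [← Real.exp_add]; simp
        nlinarith [Real.exp_pos w]
      have h6 : Real.exp (-(Θ * y) + w) ≤ Real.exp (-(Θ * y / 2)) := Real.exp_le_exp.2 (by
        rw [hw]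
        have : 0 ≤ Θ * y * (1 / 12 - y) := by
          have : 0 ≤ 1 / 12 - y := by linarith
          positivity
        nlinarith)
      -- `(Θ y / 2) ^ 3 / 6 ≤ exp (Θ y / 2)`, and `y ≥ h / 4` since the quadratic loss dominates
      have h7 : w * Real.exp (-(Θ * y / 2)) ≤ 1152 / (Θ ^ 2 * h) := by
        have h8 := Real.pow_div_factorial_le_exp (x := Θ * y / 2) (by positivity) 3
        norm_num [Nat.factorial] at h8
        rw [Real.exp_neg, ← div_eq_mul_inv, div_le_div_iff₀ (Real.exp_pos _) (by positivity)]
        calc w * (Θ ^ 2 * h) ≤ w * (Θ ^ 2 * (4 * y)) := by gcongr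
          _ = 1152 * ((Θ * y / 2) ^ 3 / 6) := by rw [hw]; ring
          _ ≤ _ := by gcongr
      calc Real.exp (-D) ≤ Real.exp (-(Θ * y) + w) := h3
        _ = Real.exp (-(Θ * y)) * Real.exp w := Real.exp_add _ _
        _ ≤ Real.exp (-(Θ * y)) * (1 + w * Real.exp w) := by gcongr
        _ = Real.exp (-(Θ * y)) + w * Real.exp (-(Θ * y) + w) := by rw [Real.exp_add]; ring
        _ ≤ Real.exp (-(Θ * y)) + w * Real.exp (-(Θ * y / 2)) := by gcongr
        _ ≤ _ := by linarith
  · have h3 : Real.exp (-D) ≤ Real.exp (-(Θ / 24)) := Real.exp_le_exp.2 (by linarith [h2 hy'])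
    have h4 : Real.exp (-(Θ / 24)) ≤ 1152 / (Θ ^ 2 * h) := by
      have h8 := Real.pow_div_factorial_le_exp (x := Θ / 24) (by positivity) 2
      norm_num [Nat.factorial] at h8
      rw [Real.exp_neg, inv_eq_one_div, div_le_div_iff₀ (Real.exp_pos _) (by positivity)]
      calc 1 * (Θ ^ 2 * h) ≤ 1 * (Θ ^ 2 * 1) := by gcongr
        _ = 1152 * ((Θ / 24) ^ 2 / 2) := by ring
        _ ≤ _ := by gcongr
    have := Real.exp_pos (-(Θ * y))
    linarith

/-- An exponential barrier is transported by one step of the chain. -/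
lemma one_le_chainStep_add_exp {β z κ t T Θ b w e s : ℝ} (hβ : 0 < β) (hκ : 0 < κ) (hT : T < 1)
    (he : 0 ≤ e) {f : ℝ → ENNReal}
    (hf : ∀ T', 1 ≤ f T' + ENNReal.ofReal (Real.exp (-(Θ * (b - T' * w))) + e))
    (hs : s = Θ * w * (1 - t) / (z * (1 - T))) (hs0 : 0 ≤ s) (hs' : s ≤ β / 4) :
    1 ≤ chainStep β z κ t f T +
      ENNReal.ofReal (Real.exp (-(Θ * b) + κ * s + 2 * κ * s ^ 2 / β) + e) := by
  have := isProbabilityMeasure_gammaMeasure (a := β / 2 * κ) (r := β / 2) (by positivity)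
    (by positivity)
  refine one_le_chainStep_add hβ hκ hT (by fun_prop) (fun g => hf _) ?_
  have h1 : ∀ g : ℝ, ENNReal.ofReal
      (Real.exp (-(Θ * (b - (1 - t) * g / (z * (1 - T)) * w))) + e) =
      ENNReal.ofReal (Real.exp (-(Θ * b))) * ENNReal.ofReal (Real.exp (s * g)) +
        ENNReal.ofReal e := by
    intro g
    rw [ENNReal.ofReal_add (Real.exp_pos _).le he, ← ENNReal.ofReal_mul (Real.exp_pos _).le,
      ← Real.exp_add, hs]
    congr 3
    ring
  simp_rw [h1]
  rw [lintegral_add_right _ measurable_const, lintegral_const_mul' _ _ ENNReal.ofReal_ne_top,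
    ENNReal.ofReal_add (Real.exp_pos _).le he]
  simp only [lintegral_const, measure_univ, mul_one]
  gcongr
  refine (mul_le_mul_right (lintegral_exp_gammaMeasure_le hβ hκ hs0 hs') _).trans (le_of_eq ?_)
  rw [← ENNReal.ofReal_mul (Real.exp_pos _).le, ← Real.exp_add]
  ring_nf

/-- Drift of the barrier near it, in the step with the larger shape parameter. The terms `2 x` and
`x / 8` bound the shift of the mean and the variance term. -/
lemma large_drift_near {x q y : ℝ} (hx0 : 0 ≤ x) (hx : x ≤ 1 / 32) (hq : y = q - 5 * x)
    (hy0 : 0 ≤ y) (hy : y ≤ 1 / 12) :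
    y + x / 2 - 6 * y ^ 2 ≤ (q - 2 * x) / (1 + q) - x / 8 := by
  have e : q = 5 * x + y := by linarith
  have e1 : 0 ≤ x * (1 / 32 - x) := mul_nonneg hx0 (by linarith)
  have e2 : 0 ≤ x * (1 / 12 - y) := mul_nonneg hx0 (by linarith)
  have h1 : y + x - y ^ 2 ≤ (q - 2 * x) / (1 + q) := by
    rw [e, le_div_iff₀ (by linarith)]
    have e3 : 0 ≤ y ^ 2 * x := by positivity
    have e4 : 0 ≤ y ^ 3 := by positivity
    linarith
  linarith [sq_nonneg y]

lemma large_drift_far {x q : ℝ} (hx0 : 0 ≤ x) (hx : x ≤ 1 / 32) (hq : 1 / 12 ≤ q - 5 * x) :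
    24⁻¹ ≤ (q - 2 * x) / (1 + q) - x / 8 := by
  have : 1 / 20 ≤ (q - 2 * x) / (1 + q) := by
    rw [le_div_iff₀ (by linarith)]
    linarith
  linarith

/-- Drift of the barrier near it, in the step with the smaller shape parameter: the gain `8 x` of
the mean pays for the offset `5 x`, for the variance term `x / 8`, and for the growth of the rate by
the factor `1 + r / 64`. -/
lemma small_drift_near {x p r : ℝ} (hx0 : 0 ≤ x) (hr0 : 0 ≤ r) (hr1 : r ≤ 1)
    (hr2 : r ^ 2 ≤ x) (hp : 0 ≤ p) (hp' : p ≤ 1 / 12) :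
    (1 + r / 64) * (p + x * (1 + r / 64) / 2 - 6 * p ^ 2) ≤
      (p + 8 * x) / (1 + p) - 5 * x - x / 8 := by
  have e0 : 0 ≤ x * (1 / 12 - p) := mul_nonneg hx0 (by linarith)
  have h11 : p + 2 * x - p ^ 2 ≤ (p + 8 * x) / (1 + p) - 5 * x - x / 8 := by
    have : p + 8 * x - p ^ 2 - 8 * x * p ≤ (p + 8 * x) / (1 + p) := by
      rw [le_div_iff₀ (by linarith)]
      have : 0 ≤ p ^ 2 * (p + 8 * x) := by positivity
      linarith
    linarith
  refine le_trans ?_ h11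
  have h12 : p * r ≤ p ^ 2 + r ^ 2 := by nlinarith [sq_nonneg (p - r)]
  have h13 : x * r ≤ x := by nlinarith
  have h14 : x * r ^ 2 ≤ x := by nlinarith
  have h15 : 0 ≤ p ^ 2 * r := by positivity
  linarith [sq_nonneg p]

lemma small_drift_far {x p : ℝ} (hx0 : 0 ≤ x) (hx : x ≤ 1 / 32) (hp : 1 / 12 ≤ p) :
    1 / 13 ≤ (p + 8 * x) / (1 + p) - 5 * x - x / 8 := by
  have : 1 / 13 + 5 * x + x / 8 ≤ (p + 8 * x) / (1 + p) := by
    rw [le_div_iff₀ (by linarith)]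
    have : 0 ≤ (p - 1 / 12) * (12 / 13 - 6 * x) := mul_nonneg (by linarith) (by linarith)
    have h2 : 0 ≤ p * x := mul_nonneg (by linarith) hx0
    linarith
  linarith

set_option maxHeartbeats 1000000 in
/-- Transport of the exponential barrier through the step with the larger shape parameter. Before
the step the position `T` is measured by `q = 1 - T (u + v) / v`, after it by
`p = u / v - T (u + v) / v`, where `1 - T` equals `u / (u + v) * (1 + v / u * q)` respectively
`v / (u + v) * (1 + p)`; the step maps `q` to `p ≈ q / (1 + v / u * q)` up to noise. The mean of the
step may move the barrier by `-2 x`, which the offset `5 x` compensates. -/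
lemma barrier_step_large {β u v η h x Θ κ z e : ℝ} (hβ : 0 < β) (hv : 0 < v) (hvu : v ≤ u)
    (hz : z = (u + v) ^ 2 * (1 - v / u * η)) (hη : 0 ≤ η) (hη' : η ≤ 1 / 64) (hηx : η ≤ x)
    (hx : x ≤ 1 / 32) (hh : 0 < h) (hh1 : h ≤ 1) (hhx : h ^ 2 ≤ x) (hΘ : Θ = β * v ^ 2 * x / 32)
    (hκ : 0 < κ) (hκ' : κ ≤ u ^ 2) (he : 0 ≤ e) {f : ℝ → ENNReal}
    (hf : ∀ T, 1 ≤ f T + ENNReal.ofReal (Real.exp (-(Θ * (u / v - T * ((u + v) / v)))) + e))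
    (T : ℝ) :
    1 ≤ chainStep β z κ 0 f T + ENNReal.ofReal
      (Real.exp (-(Θ * (1 - T * ((u + v) / v) - 5 * x))) + (1152 / (Θ ^ 2 * h) + e)) := by
  have hu : 0 < u := hv.trans_le hvu
  have hx0 : 0 < x := lt_of_lt_of_le (by positivity) hhx
  have hΘ0 : 0 < Θ := by rw [hΘ]; positivity
  have hC : 0 ≤ 1152 / (Θ ^ 2 * h) := by positivity
  obtain ⟨q, hq⟩ : ∃ q, q = 1 - T * ((u + v) / v) := ⟨_, rfl⟩
  rw [← hq]
  -- behind the barrier the bound is trivial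
  rcases le_total q (5 * x) with hq5 | hq5
  · refine le_add_left ?_
    rw [← ENNReal.ofReal_one]
    refine ENNReal.ofReal_le_ofReal ?_
    have : 1 ≤ Real.exp (-(Θ * (q - 5 * x))) := Real.one_le_exp (by nlinarith)
    linarith
  have hq0 : 0 < q := by linarith
  obtain ⟨ρ, hρ⟩ : ∃ ρ, ρ = v / u := ⟨_, rfl⟩
  have hρ0 : 0 < ρ := by rw [hρ]; positivity
  have hρ1 : ρ ≤ 1 := by rw [hρ]; exact (div_le_one hu).2 hvu
  have hvρ : v = ρ * u := by rw [hρ]; field_simp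
  rw [← hρ] at hz
  have hσ : ρ * η ≤ η := mul_le_of_le_one_left hη hρ1
  have hσ0 : 0 ≤ ρ * η := by positivity
  have hTq : 1 - T = u / (u + v) * (1 + ρ * q) := by
    rw [hq, hρ]; field_simp; ring
  have hρq : 0 ≤ ρ * q := by positivity
  have hρq' : ρ * q ≤ q := mul_le_of_le_one_left hq0.le hρ1
  have hT1 : T < 1 := by
    have : 0 < 1 - T := by rw [hTq]; positivity
    linarith
  have hσ1 : 0 < 1 - ρ * η := by linarith
  obtain ⟨s, hs⟩ : ∃ s, s = Θ * ((u + v) / v) * (1 - 0) / (z * (1 - T)) := ⟨_, rfl⟩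
  have hs1 : s = Θ / (v * u * ((1 - ρ * η) * (1 + ρ * q))) := by
    rw [hs, hTq, hz]; field_simp; ring
  have hP : 63 / 64 ≤ (1 - ρ * η) * (1 + ρ * q) := by linarith [mul_nonneg hσ1.le hρq]
  have hP0 : 0 < (1 - ρ * η) * (1 + ρ * q) := by linarith
  have hs0 : 0 ≤ s := by rw [hs1]; positivity
  have hs2 : s ≤ Θ / (v * u * (63 / 64)) := by rw [hs1]; gcongr
  have hs3 : s ≤ β / 4 := by
    refine hs2.trans ?_
    rw [div_le_div_iff₀ (by positivity) (by norm_num), hΘ]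
    have h3 : v ^ 2 ≤ v * u := by nlinarith
    have h4 : β * v ^ 2 * x ≤ β * (v * u) * (1 / 32) := by gcongr
    linarith [mul_nonneg hβ.le (mul_nonneg hv.le hu.le)]
  have hstep := one_le_chainStep_add_exp hβ hκ hT1 he hf hs hs0 hs3
  refine hstep.trans (add_le_add le_rfl (ENNReal.ofReal_le_ofReal ?_))
  rw [← add_assoc]
  refine add_le_add ?_ le_rfl
  -- the rate `Θ = β v ^ 2 x / 32` is chosen so that the variance term is a fraction of `Θ x`
  have hnoise : 2 * κ * s ^ 2 / β ≤ Θ * (x / 8) := by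
    have h5 : 2 * κ * s ^ 2 / β ≤ 2 * u ^ 2 * (Θ / (v * u * (63 / 64))) ^ 2 / β := by gcongr
    refine h5.trans ?_
    have h6 : 2 * u ^ 2 * (Θ / (v * u * (63 / 64))) ^ 2 / β = Θ * (x / 16 * (64 / 63) ^ 2) := by
      rw [hΘ]; field_simp; ring
    rw [h6]
    refine mul_le_mul_of_nonneg_left ?_ hΘ0.le
    norm_num
    linarith
  have hmean : κ * s ≤ Θ * (u / v) - Θ * ((q - 2 * x) / (1 + q)) := by
    have h7 : κ * s ≤ u ^ 2 * s := by gcongr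
    refine h7.trans ?_
    have h8 : u ^ 2 * s = Θ * (1 / (ρ * ((1 - ρ * η) * (1 + ρ * q)))) := by
      rw [hs1, hvρ]; field_simp
    have h9 : u / v = 1 / ρ := by rw [hρ]; field_simp
    rw [h8, h9, ← mul_sub]
    refine mul_le_mul_of_nonneg_left ?_ hΘ0.le
    have h10 : 1 / (ρ * ((1 - ρ * η) * (1 + ρ * q))) ≤ (1 + 2 * (ρ * η)) / (ρ * (1 + ρ * q)) := by
      rw [div_le_div_iff₀ (by positivity) (by positivity)]
      have : 1 ≤ (1 + 2 * (ρ * η)) * (1 - ρ * η) := by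
        linarith [mul_nonneg hσ0 (show 0 ≤ 1 / 2 - ρ * η by linarith)]
      have h11 : 0 ≤ ρ * (1 + ρ * q) := by positivity
      linarith [mul_le_mul_of_nonneg_left this h11]
    have h12 : (1 + 2 * (ρ * η)) / (ρ * (1 + ρ * q)) = 1 / ρ - (q - 2 * η) / (1 + ρ * q) := by
      field_simp; ring
    have h13 : (q - 2 * x) / (1 + q) ≤ (q - 2 * η) / (1 + ρ * q) := by
      refine div_le_div₀ (by linarith) (by linarith) (by positivity) (by linarith)
    linarith
  have hexp : Real.exp (-(Θ * (u / v)) + κ * s + 2 * κ * s ^ 2 / β) ≤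
      Real.exp (-(Θ * ((q - 2 * x) / (1 + q) - x / 8))) := Real.exp_le_exp.2 (by
    rw [mul_sub]; linarith)
  refine hexp.trans (exp_neg_le_exp_neg_add hΘ0 hh hh1 hhx (by linarith) (fun hy => ?_)
    fun hy => ?_)
  · exact mul_le_mul_of_nonneg_left (large_drift_near hx0.le hx rfl (by linarith) hy) hΘ0.le
  · rw [div_eq_mul_inv]
    exact mul_le_mul_of_nonneg_left (large_drift_far hx0.le hx hy) hΘ0.le

set_option maxHeartbeats 1000000 in
/-- Transport of the exponential barrier through the step with the smaller shape parameter, in the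
coordinates of `barrier_step_large`. The hypothesis `hκt` is a gain of `8 x` in the mean: it
comes from the decrease of the shape parameters along the chain, or from the tilt `t`. -/
lemma barrier_step_small {β u v η h x x' Θ Θ' κ z t e : ℝ} (hβ : 0 < β) (hv : 0 < v) (hvu : v ≤ u)
    (hz : z = (u + v) ^ 2 * (1 - v / u * η)) (hη : 0 ≤ η) (hη' : η ≤ 1 / 64)
    (hx : x' ≤ 1 / 32) (hh : 0 < h) (hh1 : h ≤ 1) (hhx : h ^ 2 ≤ x) (hΘ : Θ = β * v ^ 2 * x / 32)
    (hΘ' : Θ' = β * v ^ 2 * x' / 32) (hxx' : x' = x + 1 / (64 * v ^ 2)) (hvx : 1 ≤ v ^ 2 * x)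
    (hvx3 : 1 ≤ (v ^ 2) ^ 2 * x ^ 3) (ht0 : 0 ≤ t) (ht1 : t ≤ 1)
    (hκ : 0 < κ) (hκ' : κ ≤ v ^ 2) (hκt : (1 - t) * κ ≤ v ^ 2 * ((1 - 8 * x) * (1 - η)))
    (he : 0 ≤ e) {f : ℝ → ENNReal}
    (hf : ∀ T, 1 ≤ f T + ENNReal.ofReal (Real.exp (-(Θ * (1 - T * ((u + v) / v) - 5 * x))) + e))
    (T : ℝ) :
    1 ≤ chainStep β z κ t f T + ENNReal.ofReal
      (Real.exp (-(Θ' * (u / v - T * ((u + v) / v)))) + (1152 / (Θ' ^ 2 * h) + e)) := by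
  have hu : 0 < u := hv.trans_le hvu
  have hx0 : 0 < x := lt_of_lt_of_le (by positivity) hhx
  have hδ : 0 < 1 / (64 * v ^ 2) := by positivity
  have hΘ0 : 0 < Θ := by rw [hΘ]; positivity
  have hx'0 : 0 < x' := by linarith
  have hΘ'0 : 0 < Θ' := by rw [hΘ']; positivity
  have hC : 0 ≤ 1152 / (Θ' ^ 2 * h) := by positivity
  obtain ⟨p, hp⟩ : ∃ p, p = u / v - T * ((u + v) / v) := ⟨_, rfl⟩
  rw [← hp]
  rcases le_total p 0 with hp0 | hp0
  · refine le_add_left ?_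
    rw [← ENNReal.ofReal_one]
    refine ENNReal.ofReal_le_ofReal ?_
    have : 1 ≤ Real.exp (-(Θ' * p)) := Real.one_le_exp (by nlinarith)
    linarith
  have hσ0 : 0 ≤ v / u * η := by positivity
  have hσ : v / u * η ≤ η := mul_le_of_le_one_left hη ((div_le_one hu).2 hvu)
  obtain ⟨σ, hσdef⟩ : ∃ σ, σ = v / u * η := ⟨_, rfl⟩
  rw [← hσdef] at hz hσ hσ0
  have hTp : 1 - T = v / (u + v) * (1 + p) := by
    rw [hp]; field_simp; ring
  have hT1 : T < 1 := by
    have : 0 < 1 - T := by rw [hTp]; positivity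
    linarith
  have hσ1 : 0 < 1 - σ := by linarith
  obtain ⟨s, hs⟩ : ∃ s, s = Θ * ((u + v) / v) * (1 - t) / (z * (1 - T)) := ⟨_, rfl⟩
  have hs1 : s = Θ * (1 - t) / (v ^ 2 * ((1 - σ) * (1 + p))) := by
    rw [hs, hTp, hz]; field_simp
  have hP : 63 / 64 ≤ (1 - σ) * (1 + p) := by linarith [mul_nonneg hσ1.le hp0]
  have hP0 : 0 < (1 - σ) * (1 + p) := by linarith
  have ht2 : 0 ≤ 1 - t := by linarith
  have hs0 : 0 ≤ s := by rw [hs1]; positivity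
  have hs2 : s ≤ Θ * 1 / (v ^ 2 * (63 / 64)) := by rw [hs1]; gcongr; linarith
  have hs3 : s ≤ β / 4 := by
    refine hs2.trans ?_
    rw [div_le_div_iff₀ (by positivity) (by norm_num), hΘ]
    have h4 : β * v ^ 2 * x ≤ β * v ^ 2 * (1 / 32) := by gcongr; linarith
    linarith [mul_nonneg hβ.le (sq_nonneg v)]
  have hstep := one_le_chainStep_add_exp (b := 1 - 5 * x) (w := (u + v) / v) hβ hκ hT1 he
    (fun T' => by convert hf T' using 6; ring) hs hs0 hs3
  refine hstep.trans (add_le_add le_rfl (ENNReal.ofReal_le_ofReal ?_))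
  rw [← add_assoc]
  refine add_le_add ?_ le_rfl
  have hnoise : 2 * κ * s ^ 2 / β ≤ Θ * (x / 8) := by
    have h5 : 2 * κ * s ^ 2 / β ≤ 2 * v ^ 2 * (Θ * 1 / (v ^ 2 * (63 / 64))) ^ 2 / β := by gcongr
    refine h5.trans ?_
    have h6 : 2 * v ^ 2 * (Θ * 1 / (v ^ 2 * (63 / 64))) ^ 2 / β =
        Θ * (x / 16 * (64 / 63) ^ 2) := by
      rw [hΘ]; field_simp; ring
    rw [h6]
    refine mul_le_mul_of_nonneg_left ?_ hΘ0.le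
    norm_num
    linarith
  have hmean : κ * s ≤ Θ * 1 - Θ * ((p + 8 * x) / (1 + p)) := by
    have h8 : κ * s = Θ * ((1 - t) * κ / (v ^ 2 * ((1 - σ) * (1 + p)))) := by
      rw [hs1]; ring
    rw [h8, ← mul_sub]
    refine mul_le_mul_of_nonneg_left ?_ hΘ0.le
    have h9 : 1 - (p + 8 * x) / (1 + p) = (1 - 8 * x) / (1 + p) := by field_simp; ring
    rw [h9, div_le_div_iff₀ (by positivity) (by positivity)]
    have h10 : 0 ≤ 1 - 8 * x := by linarith
    calc (1 - t) * κ * (1 + p) ≤ v ^ 2 * ((1 - 8 * x) * (1 - η)) * (1 + p) := by gcongr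
      _ ≤ v ^ 2 * ((1 - 8 * x) * (1 - σ)) * (1 + p) := by gcongr
      _ = _ := by ring
  have hexp : Real.exp (-(Θ * (1 - 5 * x)) + κ * s + 2 * κ * s ^ 2 / β) ≤
      Real.exp (-(Θ * ((p + 8 * x) / (1 + p) - 5 * x - x / 8))) := Real.exp_le_exp.2 (by
    linarith)
  refine hexp.trans (exp_neg_le_exp_neg_add (x := x') hΘ'0 hh hh1 (by linarith) hp0 (fun hy => ?_)
    fun hy => ?_)
  · obtain ⟨r, hr⟩ : ∃ r, r = 1 / (v ^ 2 * x) := ⟨_, rfl⟩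
    have hr0 : 0 < r := by rw [hr]; positivity
    have hr1 : r ≤ 1 := by rw [hr]; exact (div_le_one (by positivity)).2 hvx
    have hr2 : r ^ 2 ≤ x := by
      rw [hr, div_pow, div_le_iff₀ (by positivity)]
      linarith [show x * (v ^ 2 * x) ^ 2 = (v ^ 2) ^ 2 * x ^ 3 by ring]
    have hx' : x' = x * (1 + r / 64) := by rw [hxx', hr]; field_simp
    have hΘr : Θ' = Θ * (1 + r / 64) := by rw [hΘ', hΘ, hx']; ring
    rw [hΘr, mul_assoc, hx']
    exact mul_le_mul_of_nonneg_left (small_drift_near hx0.le hr0.le hr1 hr2 hp0 hy) hΘ0.le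
  · have h12 : Θ' ≤ Θ * (65 / 64) := by
      have : x' ≤ x * (65 / 64) := by
        have : 1 / (64 * v ^ 2) ≤ x / 64 := by
          rw [div_le_div_iff₀ (by positivity) (by norm_num)]
          linarith
        linarith
      rw [hΘ', hΘ]
      calc β * v ^ 2 * x' / 32 ≤ β * v ^ 2 * (x * (65 / 64)) / 32 := by gcongr
        _ = _ := by ring
    have h13 := mul_le_mul_of_nonneg_left (small_drift_far hx0.le (by linarith) hy) hΘ0.le
    linarith

end

/-! ### Survival of the chain at the edge -/

section

open Finset ProbabilityTheory

/-- The exponential barrier along the whole chain, where `z` lies below the edge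
`(√m + √n) ^ 2` by the relative amount `√(n / m) * h ^ 2`. The term `j / (64 n)` of `x j` reflects
the decrease of the shape parameters, which supersedes the tilt once `j ≥ 32 n h ^ 2`. -/
lemma one_le_chainSurvival_add_exp {β z h : ℝ} {m n : ℕ} {tR : ℕ → ℝ} {x Θ : ℕ → ℝ} (hβ : 0 < β)
    (hmn : n ≤ m) (hh : 0 < h) (hh' : h ≤ 1 / 8) (hnh : 1 ≤ n * h ^ 3)
    (hz : z = (√(m : ℝ) + √(n : ℝ)) ^ 2 * (1 - √(n : ℝ) / √(m : ℝ) * h ^ 2))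
    (hx : ∀ j, x j = h ^ 2 + j / (64 * n)) (hΘ : ∀ j, Θ j = β * n * x j / 32)
    (htR : ∀ j : ℕ, tR j = if (j : ℝ) < 32 * n * h ^ 2 then 32 * h ^ 2 else 0) (j : ℕ)
    (hj : j < n) (T : ℝ) :
    1 ≤ chainSurvival β z m n tR (fun _ => 0) j T + ENNReal.ofReal
      (Real.exp (-(Θ j * (√(m : ℝ) / √(n : ℝ) - T * ((√(m : ℝ) + √(n : ℝ)) / √(n : ℝ))))) +
        ∑ i ∈ range j, 2304 / (Θ i ^ 2 * h)) := by
  have hn : (0 : ℝ) < n := by exact_mod_cast (by omega : 0 < n)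
  have hnm : (n : ℝ) ≤ m := by exact_mod_cast hmn
  have hη : h ^ 2 ≤ 1 / 64 := by nlinarith
  have hη0 : 0 < h ^ 2 := by positivity
  have hv : 0 < √(n : ℝ) := Real.sqrt_pos.2 hn
  have hvu : √(n : ℝ) ≤ √(m : ℝ) := Real.sqrt_le_sqrt hnm
  have hv2 : √(n : ℝ) ^ 2 = n := Real.sq_sqrt hn.le
  have hu2 : √(m : ℝ) ^ 2 = m := Real.sq_sqrt (hn.le.trans hnm)
  have hx0 : ∀ j, h ^ 2 ≤ x j := fun j => by
    rw [hx]
    have : (0 : ℝ) ≤ j / (64 * n) := by positivity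
    linarith
  have hx1 : ∀ j, j ≤ n → x j ≤ 1 / 32 := fun j hj => by
    have h1 : (j : ℝ) ≤ n := by exact_mod_cast hj
    have : (j : ℝ) / (64 * n) ≤ 1 / 64 := by
      rw [div_le_div_iff₀ (by positivity) (by norm_num)]; linarith
    rw [hx]
    linarith
  induction j generalizing T with
  | zero =>
    rcases lt_or_ge T 1 with hT | hT
    · simp only [chainSurvival, if_pos hT]
      exact le_self_add
    · refine le_add_left ?_
      rw [← ENNReal.ofReal_one]
      refine ENNReal.ofReal_le_ofReal ?_
      have hx00 := hη0.trans_le (hx0 0)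
      have hΘ0 : 0 ≤ Θ 0 := by rw [hΘ]; positivity
      have h1 : √(m : ℝ) / √(n : ℝ) - T * ((√(m : ℝ) + √(n : ℝ)) / √(n : ℝ)) ≤ 0 := by
        have e : (√(m : ℝ) + √(n : ℝ)) / √(n : ℝ) = √(m : ℝ) / √(n : ℝ) + 1 := by field_simp
        have : 0 ≤ √(m : ℝ) / √(n : ℝ) := by positivity
        rw [e]
        nlinarith
      have : 1 ≤ Real.exp (-(Θ 0 *
          (√(m : ℝ) / √(n : ℝ) - T * ((√(m : ℝ) + √(n : ℝ)) / √(n : ℝ))))) :=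
        Real.one_le_exp (by nlinarith)
      simpa using this
  | succ j ih =>
    have hj1 : (j : ℝ) + 1 < n := by exact_mod_cast hj
    have hj0 : (0 : ℝ) ≤ j := Nat.cast_nonneg j
    have hxj := hη0.trans_le (hx0 j)
    have hΘj : 0 < Θ j := by rw [hΘ]; positivity
    have hh1 : h ≤ 1 := by linarith
    have herr : 0 ≤ ∑ i ∈ range j, 2304 / (Θ i ^ 2 * h) :=
      Finset.sum_nonneg fun i _ => by positivity
    have hA := barrier_step_large (κ := (m : ℝ) - j) (x := x j) (Θ := Θ j) hβ hv hvu hz hη0.le hη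
      (hx0 j) (hx1 j (by omega)) hh hh1 (hx0 j) (by rw [hΘ, hv2]) (by linarith)
      (by rw [hu2]; linarith) herr (ih (by omega))
    have hnx : n * x j = n * h ^ 2 + j / 64 := by rw [hx]; field_simp
    have hnη : 1 ≤ n * h ^ 2 := hnh.trans (by
      have : h ^ 3 ≤ h ^ 2 := pow_le_pow_of_le_one hh.le hh1 (by norm_num)
      gcongr)
    have hR := barrier_step_small (κ := (n : ℝ) - (j + 1)) (x := x j) (x' := x (j + 1)) (Θ := Θ j)
      (Θ' := Θ (j + 1)) (t := tR (j + 1)) hβ hv hvu hz hη0.le hη (hx1 _ (by omega)) hh hh1 (hx0 j)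
      (by rw [hΘ, hv2]) (by rw [hΘ, hv2])
      (by rw [hx, hx, hv2]; push_cast; ring)
      (by rw [hv2, hnx]; linarith [div_nonneg hj0 (by norm_num : (0 : ℝ) ≤ 64)])
      (by
        rw [hv2]
        calc (1 : ℝ) ≤ (n * h ^ 3) ^ 2 := one_le_pow₀ hnh
          _ = (n : ℝ) ^ 2 * (h ^ 2) ^ 3 := by ring
          _ ≤ _ := by gcongr; exact hx0 j)
      (by rw [htR]; split_ifs <;> linarith) (by rw [htR]; split_ifs <;> linarith)
      (by linarith) (by rw [hv2]; linarith)
      (by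
        rw [hv2]
        have e : n * ((1 - 8 * x j) * (1 - h ^ 2)) =
          n - 8 * (n * x j) - n * h ^ 2 + 8 * (n * x j) * h ^ 2 := by ring
        have e1 : 0 ≤ 8 * (n * x j) * h ^ 2 := by positivity
        rw [e, htR]
        push_cast
        split_ifs with hlt
        · have e2 : 0 ≤ (j + 1) * (1 - 32 * h ^ 2) :=
            mul_nonneg (by linarith) (by linarith)
          linarith
        · push Not at hlt
          linarith)
      (by positivity) hA T
    refine hR.trans (add_le_add le_rfl (ENNReal.ofReal_le_ofReal ?_))
    rw [Finset.sum_range_succ]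
    have hmono : 1152 / (Θ (j + 1) ^ 2 * h) ≤ 1152 / (Θ j ^ 2 * h) := by
      have : Θ j ≤ Θ (j + 1) := by
        rw [hΘ, hΘ, hx, hx]
        gcongr
        exact Nat.le_succ j
      gcongr
    have e : 2304 / (Θ j ^ 2 * h) = 1152 / (Θ j ^ 2 * h) + 1152 / (Θ j ^ 2 * h) := by ring
    linarith

lemma sum_inv_sq_le {a : ℝ} (ha : 1 < a) (k : ℕ) :
    ∑ i ∈ range k, 1 / (a + i) ^ 2 ≤ 1 / (a - 1) := by
  suffices h : ∑ i ∈ range k, 1 / (a + i) ^ 2 ≤ 1 / (a - 1) - 1 / (a + k - 1) by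
    have hk : (0 : ℝ) ≤ k := Nat.cast_nonneg k
    have : 0 ≤ 1 / (a + k - 1) := div_nonneg zero_le_one (by linarith)
    linarith
  induction k with
  | zero => simp
  | succ k ih =>
    have hk : (0 : ℝ) ≤ k := Nat.cast_nonneg k
    have h0 : 0 < a + k - 1 := by linarith
    have h1 : 0 < a + k := by linarith
    have h2 : 1 / (a + k) ^ 2 ≤ 1 / (a + k - 1) - 1 / (a + k) := by
      rw [div_sub_div _ _ h0.ne' h1.ne', div_le_div_iff₀ (by positivity) (by positivity)]
      nlinarith
    rw [Finset.sum_range_succ]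
    push_cast
    rw [show a + ((k : ℝ) + 1) - 1 = a + k by ring]
    linarith

/-- If the gamma variables of smaller shape are tilted in the `32 n h ^ 2` steps with the largest
shape parameters, then the chain survives with probability at least `1 / 2`. -/
lemma half_le_totalSurvival_edge {β z h : ℝ} {m n : ℕ} {tR : ℕ → ℝ} (hβ : 1 ≤ β)
    (hmn : n ≤ m) (hn : 1 ≤ n) (hh : 0 < h) (hh' : h ≤ 1 / 8) (hnh : 2 * 10 ^ 9 ≤ n * h ^ 3)
    (hz : z = (√(m : ℝ) + √(n : ℝ)) ^ 2 * (1 - √(n : ℝ) / √(m : ℝ) * h ^ 2))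
    (htR : ∀ j : ℕ, tR j = if (j : ℝ) < 32 * n * h ^ 2 then 32 * h ^ 2 else 0) :
    1 / 2 ≤ totalSurvival β z m n tR (fun _ => 0) := by
  have hn0 : (0 : ℝ) < n := by exact_mod_cast hn
  have hn1 : ((n - 1 : ℕ) : ℝ) = n - 1 := by rw [Nat.cast_sub hn]; simp
  have hnm : (n : ℝ) ≤ m := by exact_mod_cast hmn
  have hβ0 : 0 < β := by linarith
  have hh1 : h ≤ 1 := by linarith
  have hη : h ^ 2 ≤ 1 / 64 := by nlinarith
  have hη0 : 0 < h ^ 2 := by positivity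
  have hv : 0 < √(n : ℝ) := Real.sqrt_pos.2 hn0
  have hvu : √(n : ℝ) ≤ √(m : ℝ) := Real.sqrt_le_sqrt hnm
  have hv2 : √(n : ℝ) ^ 2 = n := Real.sq_sqrt hn0.le
  have hu2 : √(m : ℝ) ^ 2 = m := Real.sq_sqrt (hn0.le.trans hnm)
  obtain ⟨x, hx⟩ : ∃ x : ℕ → ℝ, ∀ j : ℕ, x j = h ^ 2 + (j : ℝ) / (64 * n) :=
    ⟨fun j => h ^ 2 + (j : ℝ) / (64 * n), fun _ => rfl⟩
  obtain ⟨Θ, hΘ⟩ : ∃ Θ : ℕ → ℝ, ∀ j : ℕ, Θ j = β * n * x j / 32 := ⟨_, fun _ => rfl⟩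
  have hx0 : ∀ j, h ^ 2 ≤ x j := fun j => by
    rw [hx]
    have : (0 : ℝ) ≤ j / (64 * n) := by positivity
    linarith
  have hΘ1 : ∀ j, (64 * n * h ^ 2 + j) / 2048 ≤ Θ j := fun j => by
    have e : (64 * n * h ^ 2 + j) / 2048 = 1 * n * x j / 32 := by
      rw [hx]; field_simp; ring
    have := hη0.trans_le (hx0 j)
    rw [e, hΘ]
    gcongr
  have hΘ0 : ∀ j, 0 < Θ j := fun j => lt_of_lt_of_le (by positivity) (hΘ1 j)
  have hx1 : x (n - 1) ≤ 1 / 32 := by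
    have : ((n - 1 : ℕ) : ℝ) / (64 * n) ≤ 1 / 64 := by
      rw [div_le_div_iff₀ (by positivity) (by norm_num), hn1]; linarith
    rw [hx]
    linarith
  have hnη : n * h ^ 3 ≤ n * h ^ 2 := by
    have : h ^ 3 ≤ h ^ 2 := pow_le_pow_of_le_one hh.le hh1 (by norm_num)
    gcongr
  have herr : 0 ≤ ∑ i ∈ range (n - 1), 2304 / (Θ i ^ 2 * h) :=
    Finset.sum_nonneg fun i _ => by have := hΘ0 i; positivity
  have hfin := barrier_step_large (κ := (m : ℝ) - n + 1) (x := x (n - 1)) (Θ := Θ (n - 1)) hβ0 hv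
    hvu hz hη0.le hη (hx0 _) hx1 hh hh1 (hx0 _) (by rw [hΘ, hv2]) (by linarith)
    (by rw [hu2]; have : (1 : ℝ) ≤ n := by exact_mod_cast hn
        linarith) herr
    (one_le_chainSurvival_add_exp hβ0 hmn hh hh' (by linarith) hz hx hΘ htR (n - 1) (by omega)) 0
  -- the errors are at most of order `1 / (h (64 n h ^ 2 + i) ^ 2)`, and their sum at most of
  -- order `1 / (n h ^ 3)`
  have hsum : ∑ i ∈ range n, 2304 / (Θ i ^ 2 * h) ≤ 1 / 6 := by
    have ha : 1 < 64 * n * h ^ 2 := by linarith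
    calc ∑ i ∈ range n, 2304 / (Θ i ^ 2 * h)
        ≤ ∑ i ∈ range n, 2304 * 2048 ^ 2 / h * (1 / (64 * n * h ^ 2 + i) ^ 2) := by
          refine Finset.sum_le_sum fun i _ => ?_
          have h1 : 2304 / (Θ i ^ 2 * h) ≤ 2304 / (((64 * n * h ^ 2 + i) / 2048) ^ 2 * h) := by
            gcongr
            exact hΘ1 i
          refine h1.trans (le_of_eq ?_)
          field_simp
      _ ≤ 2304 * 2048 ^ 2 / h * (1 / (64 * n * h ^ 2 - 1)) := by
          rw [← Finset.mul_sum]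
          exact mul_le_mul_of_nonneg_left (sum_inv_sq_le ha n) (by positivity)
      _ ≤ 2304 * 2048 ^ 2 / h * (1 / (32 * n * h ^ 2)) := by
          have : 32 * n * h ^ 2 ≤ 64 * n * h ^ 2 - 1 := by linarith
          gcongr
      _ = 301989888 / (n * h ^ 3) := by field_simp; norm_num
      _ ≤ 301989888 / (2 * 10 ^ 9) := by gcongr
      _ ≤ 1 / 6 := by norm_num
  have hlast : ∑ i ∈ range n, 2304 / (Θ i ^ 2 * h) =
      ∑ i ∈ range (n - 1), 2304 / (Θ i ^ 2 * h) + 2304 / (Θ (n - 1) ^ 2 * h) := by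
    conv_lhs => rw [← Nat.sub_add_cancel hn, Finset.sum_range_succ]
  have hexp : Real.exp (-(Θ (n - 1) * (1 - 0 * ((√(m : ℝ) + √(n : ℝ)) / √(n : ℝ)) -
      5 * x (n - 1)))) ≤ 1 / 4 := by
    have h1 : 3 ≤ Θ (n - 1) * (1 - 0 * ((√(m : ℝ) + √(n : ℝ)) / √(n : ℝ)) - 5 * x (n - 1)) := by
      have h2 := hΘ1 (n - 1)
      have h3 : (0 : ℝ) ≤ ((n - 1 : ℕ) : ℝ) := Nat.cast_nonneg _
      have h4 : 6 ≤ Θ (n - 1) := by linarith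
      nlinarith
    rw [Real.exp_neg, inv_le_comm₀ (Real.exp_pos _) (by norm_num)]
    refine le_trans ?_ (Real.add_one_le_exp _)
    norm_num at h1 ⊢
    linarith
  have hle : Real.exp (-(Θ (n - 1) * (1 - 0 * ((√(m : ℝ) + √(n : ℝ)) / √(n : ℝ)) -
      5 * x (n - 1)))) + (1152 / (Θ (n - 1) ^ 2 * h) +
        ∑ i ∈ range (n - 1), 2304 / (Θ i ^ 2 * h)) ≤ 1 / 2 := by
    have h1 : 1152 / (Θ (n - 1) ^ 2 * h) ≤ 2304 / (Θ (n - 1) ^ 2 * h) := by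
      have := hΘ0 (n - 1)
      gcongr
      norm_num
    linarith
  have h6 : (1 : ENNReal) ≤ totalSurvival β z m n tR (fun _ => 0) + 1 / 2 := by
    refine hfin.trans (add_le_add le_rfl ((ENNReal.ofReal_le_ofReal hle).trans (le_of_eq ?_)))
    rw [ENNReal.ofReal_div_of_pos two_pos]; simp
  have h7 : (1 : ENNReal) / 2 + 1 / 2 ≤ totalSurvival β z m n tR (fun _ => 0) + 1 / 2 := by
    rwa [ENNReal.add_halves]
  exact (ENNReal.add_le_add_iff_right (by simp)).1 h7

lemma one_sub_sq_rpow_neg_le {t a L : ℝ} (ht0 : 0 ≤ t) (ht : t < 1) (hL : 1 ≤ L * (1 - t ^ 2))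
    (ha : 0 ≤ a) : (1 - t ^ 2) ^ (-a) ≤ Real.exp (a * (L * t ^ 2)) := by
  have h1 : 0 < 1 - t ^ 2 := by nlinarith
  have h2 := Real.one_sub_inv_le_log_of_pos h1
  have h3 : (1 - t ^ 2)⁻¹ ≤ L := by
    rw [inv_eq_one_div, div_le_iff₀ h1]; exact hL
  have h4 : 1 - (1 - t ^ 2)⁻¹ = -((1 - t ^ 2)⁻¹ * t ^ 2) := by field_simp; ring
  have h5 : (1 - t ^ 2)⁻¹ * t ^ 2 ≤ L * t ^ 2 := by gcongr
  rw [Real.rpow_def_of_pos h1]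
  refine Real.exp_le_exp.2 ?_
  nlinarith

/-- A tilted chain that survives with probability `1 / 2` bounds the survival probability of the
chain itself. -/
lemma ofReal_exp_le_totalSurvival {β z : ℝ} (hβ : 0 < β) {m n : ℕ} (hmn : n ≤ m) (hn : 1 ≤ n)
    {tR tA : ℕ → ℝ} (hR : ∀ j, 0 ≤ tR j ∧ tR j < 1) (hA : ∀ j, 0 ≤ tA j ∧ tA j < 1) {c : ℕ → ℝ}
    (hc : ∀ j < n, (1 - tR (j + 1) ^ 2) ^ (-(β / 2 * ((n : ℝ) - (j + 1)))) *
      (1 - tA (j + 1) ^ 2) ^ (-(β / 2 * ((m : ℝ) - j))) ≤ Real.exp (c j)) {B : ℝ}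
    (hB : ∑ i ∈ range n, c i ≤ B) (hhalf : 1 / 2 ≤ totalSurvival β z m n tR tA) :
    ENNReal.ofReal (Real.exp (-B) / 4) ≤ totalSurvival β z m n 0 0 := by
  have h1 := sq_totalSurvival_le hβ z hmn hn hR hA hc
  have h2 : ENNReal.ofReal (1 / 4) ≤ ENNReal.ofReal (Real.exp B) * totalSurvival β z m n 0 0 :=
    calc ENNReal.ofReal (1 / 4) = (1 / 2) ^ 2 := by
          rw [show (1 / 4 : ℝ) = (1 / 2) ^ 2 by norm_num, ENNReal.ofReal_pow (by norm_num),
            ENNReal.ofReal_div_of_pos two_pos]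
          simp
      _ ≤ totalSurvival β z m n tR tA ^ 2 := by gcongr
      _ ≤ _ := h1
      _ ≤ _ := by gcongr
  calc ENNReal.ofReal (Real.exp (-B) / 4)
      = ENNReal.ofReal (Real.exp (-B)) * ENNReal.ofReal (1 / 4) := by
        rw [← ENNReal.ofReal_mul (Real.exp_pos _).le]; ring_nf
    _ ≤ ENNReal.ofReal (Real.exp (-B)) *
          (ENNReal.ofReal (Real.exp B) * totalSurvival β z m n 0 0) := by gcongr
    _ = _ := by
        rw [← mul_assoc, ← ENNReal.ofReal_mul (Real.exp_pos _).le, ← Real.exp_add]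
        simp

/-- The tilt by `32 h ^ 2` in `32 n h ^ 2` steps costs `exp (-C β n ^ 2 h ^ 6)`. -/
lemma ofReal_exp_le_totalSurvival_edge {β z h : ℝ} {m n : ℕ} (hβ : 1 ≤ β)
    (hmn : n ≤ m) (hn : 1 ≤ n) (hh : 0 < h) (hh' : h ≤ 1 / 8) (hnh : 2 * 10 ^ 9 ≤ n * h ^ 3)
    (hz : z = (√(m : ℝ) + √(n : ℝ)) ^ 2 * (1 - √(n : ℝ) / √(m : ℝ) * h ^ 2)) :
    ENNReal.ofReal (Real.exp (-(32768 * (β * (n ^ 2 * h ^ 6)))) / 4) ≤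
      totalSurvival β z m n 0 0 := by
  have hη : h ^ 2 ≤ 1 / 64 := by nlinarith
  have hη0 : 0 < h ^ 2 := by positivity
  have hβ0 : 0 < β := by linarith
  refine ofReal_exp_le_totalSurvival hβ0 hmn hn
    (tR := fun j => if (j : ℝ) < 32 * n * h ^ 2 then 32 * h ^ 2 else 0) (tA := fun _ => 0)
    (c := fun j => if (j : ℝ) + 1 < 32 * n * h ^ 2 then 1024 * β * n * h ^ 4 else 0)
    (fun j => ?_) (fun _ => by norm_num) (fun j hj => ?_) ?_
    (half_le_totalSurvival_edge hβ hmn hn hh hh' hnh hz fun _ => rfl)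
  · split_ifs <;> constructor <;> linarith
  · have hj1 : (j : ℝ) + 1 ≤ n := by exact_mod_cast hj
    push_cast
    split_ifs with hlt
    · have h1 := one_sub_sq_rpow_neg_le (t := 32 * h ^ 2) (a := β / 2 * ((n : ℝ) - (j + 1)))
        (L := 2) (by positivity) (by linarith) (by nlinarith)
        (mul_nonneg (by positivity) (by linarith))
      norm_num at h1 ⊢
      refine h1.trans (Real.exp_le_exp.2 ?_)
      have h2 : 0 ≤ β * h ^ 4 * (j + 1) := by positivity
      nlinarith
    · simp
  · rw [Finset.sum_ite, Finset.sum_const_zero, add_zero, Finset.sum_const, nsmul_eq_mul]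
    have h1 : (#{j ∈ range n | ((j : ℕ) : ℝ) + 1 < 32 * n * h ^ 2} : ℝ) ≤ 32 * n * h ^ 2 := by
      have h2 : {j ∈ range n | ((j : ℕ) : ℝ) + 1 < 32 * n * h ^ 2} ⊆
          range ⌊32 * n * h ^ 2⌋₊ := by
        intro j hj
        rw [Finset.mem_filter] at hj
        rw [Finset.mem_range]
        refine Nat.lt_of_succ_le (Nat.le_floor ?_)
        push_cast
        exact hj.2.le
      have h3 := Finset.card_le_card h2
      rw [Finset.card_range] at h3
      exact (Nat.cast_le.2 h3).trans (Nat.floor_le (by positivity))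
    calc _ ≤ 32 * n * h ^ 2 * (1024 * β * n * h ^ 4) := by gcongr
      _ = _ := by ring

/-- The tilt of all steps by `t` costs `exp (-L β t ^ 2 m n)`, since the shape parameters add up to
`m n`. -/
lemma ofReal_exp_le_totalSurvival_crude {β z t L : ℝ} {m n : ℕ} (hβ : 1 ≤ β) (hmn : n ≤ m)
    (hn : 1 ≤ n) (ht0 : 0 ≤ t) (ht : t < 1) (hL : 1 ≤ L * (1 - t ^ 2))
    (hz : (1 - t) * ((√(m : ℝ) + √(n : ℝ)) ^ 2 * (1 + 1088 * (√(n : ℝ) / √(m : ℝ)))) ≤ z) :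
    ENNReal.ofReal (Real.exp (-(L * (β * (t ^ 2 * (m * n))))) / 4) ≤
      totalSurvival β z m n 0 0 := by
  have hβ0 : 0 < β := by linarith
  have hnm : (n : ℝ) ≤ m := by exact_mod_cast hmn
  have hL0 : 0 ≤ L := by
    by_contra hneg
    push Not at hneg
    have h1 : 0 < 1 - t ^ 2 := by nlinarith
    linarith [mul_neg_of_neg_of_pos hneg h1]
  refine ofReal_exp_le_totalSurvival hβ0 hmn hn (tR := fun _ => t) (tA := fun _ => t)
    (c := fun _ => L * (β * (t ^ 2 * m))) (fun _ => ⟨ht0, ht⟩) (fun _ => ⟨ht0, ht⟩)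
    (fun j hj => ?_) (le_of_eq ?_) (half_le_totalSurvival_crude hβ hmn hn ht hz)
  · have hj1 : (j : ℝ) + 1 ≤ n := by exact_mod_cast hj
    have hj0 : (0 : ℝ) ≤ j := Nat.cast_nonneg j
    have h1 := one_sub_sq_rpow_neg_le (a := β / 2 * ((n : ℝ) - (j + 1))) ht0 ht hL
      (mul_nonneg (by positivity) (by linarith))
    have h2 := one_sub_sq_rpow_neg_le (a := β / 2 * ((m : ℝ) - j)) ht0 ht hL
      (mul_nonneg (by positivity) (by linarith))
    refine (mul_le_mul h1 h2 (Real.rpow_nonneg (by nlinarith) _) (Real.exp_pos _).le).trans ?_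
    rw [← Real.exp_add]
    refine Real.exp_le_exp.2 ?_
    have h3 : 0 ≤ L * (β * t ^ 2) := by positivity
    calc β / 2 * ((n : ℝ) - (j + 1)) * (L * t ^ 2) + β / 2 * ((m : ℝ) - j) * (L * t ^ 2)
        = L * (β * t ^ 2) * (((n : ℝ) - (j + 1) + (m - j)) / 2) := by ring
      _ ≤ L * (β * t ^ 2) * m := by gcongr; linarith
      _ = _ := by ring
  · simp only [Finset.sum_const, Finset.card_range, nsmul_eq_mul]
    ring

end

/-! ### The largest point of the Laguerre ensemble -/

section

open Finset ProbabilityTheory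

/-- The survival probability of the chain with parameter `z` is a lower bound for the probability
that all points lie below `z`: the weight of `{λ_max < z}` is `C` times the survival probability,
and the total weight is at most `C`, as the limit for large `z`. -/
lemma le_laguerreEnsemble_real {β : ℝ} (hβ : 0 < β) {m n : ℕ} (hmn : n ≤ m) (hn : 1 ≤ n)
    {y z z' : ℝ} (hz : 0 < z) (hzz' : z ≤ z')
    (hy : ENNReal.ofReal y ≤ totalSurvival β z m n 0 0) :
    y ≤ (laguerreEnsemble β m n).real {x | x ⟨n - 1, Nat.sub_lt hn Nat.one_pos⟩ ≤ z'} := by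
  obtain ⟨C, hC0, hCt, hC⟩ := exists_laguerreWeight_lt_eq hβ hmn hn
  obtain ⟨l, hl⟩ : ∃ l : Fin n, l = ⟨n - 1, Nat.sub_lt hn Nat.one_pos⟩ := ⟨_, rfl⟩
  rw [← hl] at hC ⊢
  have huniv : (Set.univ : Set (Fin n → ℝ)) = ⋃ N : ℕ, {x | x l < (N : ℝ) + 1} := by
    refine (Set.eq_univ_of_forall fun x => ?_).symm
    obtain ⟨N, hN⟩ := exists_nat_gt (x l)
    exact Set.mem_iUnion.2 ⟨N, show x l < (N : ℝ) + 1 by linarith⟩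
  have hmono : Monotone fun N : ℕ => {x : Fin n → ℝ | x l < (N : ℝ) + 1} := by
    intro a b hab x hx
    have : (a : ℝ) ≤ b := by exact_mod_cast hab
    have hx' : x l < (a : ℝ) + 1 := hx
    exact show x l < (b : ℝ) + 1 by linarith
  have htotal : laguerreWeight β m n Set.univ ≤ C := by
    rw [huniv, hmono.measure_iUnion]
    refine iSup_le fun N => ?_
    rw [hC _ (by positivity)]
    exact mul_le_of_le_one_right' (totalSurvival_le_one hβ _ hmn hn 0 0)
  have hsub : {x : Fin n → ℝ | x l < z} ⊆ {x | x l ≤ z'} := fun x hx => (le_of_lt hx).trans hzz'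
  have hlow : ENNReal.ofReal y ≤ laguerreEnsemble β m n {x | x l ≤ z'} :=
    calc ENNReal.ofReal y ≤ totalSurvival β z m n 0 0 := hy
      _ = C⁻¹ * (C * totalSurvival β z m n 0 0) := by
        rw [← mul_assoc, ENNReal.inv_mul_cancel hC0 hCt, one_mul]
      _ = C⁻¹ * laguerreWeight β m n {x | x l < z} := by rw [hC z hz]
      _ ≤ (laguerreWeight β m n Set.univ)⁻¹ * laguerreWeight β m n {x | x l ≤ z'} := by
        gcongr
      _ = _ := by rw [laguerreEnsemble, Measure.smul_apply, smul_eq_mul]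
  have htop : laguerreEnsemble β m n {x | x l ≤ z'} ≠ ⊤ := by
    rw [laguerreEnsemble, Measure.smul_apply, smul_eq_mul]
    refine ne_top_of_le_ne_top ENNReal.one_ne_top
      (le_trans ?_ (ENNReal.inv_mul_le_one (laguerreWeight β m n Set.univ)))
    gcongr
    exact Set.subset_univ _
  exact (ENNReal.ofReal_le_iff_le_toReal htop).1 hlow

/-- The bound of the bulk regime, where `ε` is at least of order `√(n / m)`. -/
lemma le_laguerreEnsemble_real_of_large {ε β : ℝ} {m n : ℕ} (hε0 : 0 < ε) (hε : ε < 1 / 6)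
    (hmn : n ≤ m) (hn : 1 ≤ n) (hβ : 1 ≤ β) (h : 544 * (√(n : ℝ) / √(m : ℝ)) ≤ ε) :
    Real.exp (-(20 * (β * (ε ^ 2 * (m * n))))) ≤
      (laguerreEnsemble β m n).real {x | x ⟨n - 1, Nat.sub_lt hn Nat.one_pos⟩ ≤
        (√(m : ℝ) + √(n : ℝ)) ^ 2 * (1 - ε)} := by
  have hn0 : (1 : ℝ) ≤ n := by exact_mod_cast hn
  have hnm : (n : ℝ) ≤ m := by exact_mod_cast hmn
  have hm0 : (0 : ℝ) < m := by linarith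
  have hS : 0 < (√(m : ℝ) + √(n : ℝ)) ^ 2 := by positivity
  have hmain := ofReal_exp_le_totalSurvival_crude (t := 3 * ε) (L := 2)
    (z := (√(m : ℝ) + √(n : ℝ)) ^ 2 * (1 - ε)) hβ hmn hn (by linarith) (by linarith)
    (by nlinarith) (by
      calc (1 - 3 * ε) * ((√(m : ℝ) + √(n : ℝ)) ^ 2 * (1 + 1088 * (√(n : ℝ) / √(m : ℝ))))
          ≤ (1 - 3 * ε) * ((√(m : ℝ) + √(n : ℝ)) ^ 2 * (1 + 2 * ε)) := by
            have : 0 ≤ 1 - 3 * ε := by linarith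
            gcongr _ * (_ * ?_)
            linarith
        _ = (√(m : ℝ) + √(n : ℝ)) ^ 2 * (1 - ε - 6 * ε ^ 2) := by ring
        _ ≤ _ := mul_le_mul_of_nonneg_left (by linarith [sq_nonneg ε]) hS.le)
  refine le_trans ?_ (le_laguerreEnsemble_real (by linarith) hmn hn
    (mul_pos hS (by linarith)) le_rfl hmain)
  -- the factor `1 / 4` is absorbed because `ε ^ 2 * m * n ≥ n ^ 2 ≥ 1`
  have h1 : 1 ≤ β * (ε ^ 2 * (m * n)) := by
    have h2 : (n : ℝ) / m * (m * n) ≤ ε ^ 2 * (m * n) := by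
      have h3 : √(n : ℝ) / √(m : ℝ) ≤ ε :=
        le_trans (le_mul_of_one_le_left (by positivity) (by norm_num)) h
      have h4 : (n : ℝ) / m = (√(n : ℝ) / √(m : ℝ)) ^ 2 := by
        rw [div_pow, Real.sq_sqrt (by linarith), Real.sq_sqrt hm0.le]
      rw [h4]
      gcongr
    have h5 : (n : ℝ) / m * (m * n) = n ^ 2 := by field_simp
    have h6 : (1 : ℝ) ≤ (n : ℝ) ^ 2 := one_le_pow₀ hn0
    nlinarith
  have h7 : Real.exp (-2) ≤ 1 / 4 := by
    rw [Real.exp_neg, inv_le_comm₀ (Real.exp_pos _) (by norm_num)]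
    have := Real.quadratic_le_exp_of_nonneg (x := 2) (by norm_num)
    norm_num at this ⊢
    linarith
  calc Real.exp (-(20 * (β * (ε ^ 2 * (m * n)))))
      ≤ Real.exp (-(2 * (β * ((3 * ε) ^ 2 * (m * n)))) + -2) := Real.exp_le_exp.2 (by nlinarith)
    _ = Real.exp (-(2 * (β * ((3 * ε) ^ 2 * (m * n))))) * Real.exp (-2) := Real.exp_add _ _
    _ ≤ Real.exp (-(2 * (β * ((3 * ε) ^ 2 * (m * n))))) * (1 / 4) := by gcongr
    _ = _ := by ring

set_option maxHeartbeats 800000 in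
/-- The bound of the edge regime, where `ε` is at most of order `√(n / m)`. -/
lemma exists_le_laguerreEnsemble_real_of_small : ∃ c B : ℝ, 20 ≤ c ∧ 0 < B ∧
    ∀ ε : ℝ, 0 < ε → ε < 1 / 6 → ∀ m n : ℕ, n ≤ m → ∀ hn : 1 ≤ n, ∀ β : ℝ, 1 ≤ β →
      ε ≤ 544 * (√(n : ℝ) / √(m : ℝ)) →
      Real.exp (-(B * β)) * Real.exp (-(c * (β * (ε ^ 3 * (√(m : ℝ) ^ 3 * √(n : ℝ)))))) ≤
        (laguerreEnsemble β m n).real {x | x ⟨n - 1, Nat.sub_lt hn Nat.one_pos⟩ ≤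
          (√(m : ℝ) + √(n : ℝ)) ^ 2 * (1 - ε)} := by
  obtain ⟨K, hK⟩ : ∃ K : ℝ, K = 2 * 10 ^ 9 := ⟨_, rfl⟩
  obtain ⟨D, hD⟩ : ∃ D : ℝ, D = 1400 * 1632 ^ 2 := ⟨_, rfl⟩
  refine ⟨D * 64 ^ 3, D * (512 * K) ^ 2 + 2, by rw [hD]; norm_num, by rw [hD, hK]; norm_num,
    fun ε hε0 hε m n hmn hn β hβ h => ?_⟩
  have hn0 : (1 : ℝ) ≤ n := by exact_mod_cast hn
  have hnm : (n : ℝ) ≤ m := by exact_mod_cast hmn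
  have hm0 : (0 : ℝ) < m := by linarith
  have hβ0 : 0 < β := by linarith
  have hu : 0 < √(m : ℝ) := Real.sqrt_pos.2 hm0
  have hv : 0 < √(n : ℝ) := Real.sqrt_pos.2 (by linarith)
  have hu2 : √(m : ℝ) ^ 2 = m := Real.sq_sqrt hm0.le
  have hv2 : √(n : ℝ) ^ 2 = n := Real.sq_sqrt (by linarith)
  have hvu : √(n : ℝ) ≤ √(m : ℝ) := Real.sqrt_le_sqrt hnm
  have hS : 0 < (√(m : ℝ) + √(n : ℝ)) ^ 2 := by positivity
  obtain ⟨ρ, hρ⟩ : ∃ ρ, ρ = √(n : ℝ) / √(m : ℝ) := ⟨_, rfl⟩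
  have hρ0 : 0 < ρ := by rw [hρ]; positivity
  have hρ1 : ρ ≤ 1 := by rw [hρ]; exact (div_le_one hu).2 hvu
  have hρ2 : ρ ^ 2 * (m * n) = n ^ 2 := by rw [hρ, div_pow, hu2, hv2]; field_simp
  obtain ⟨η, hη⟩ : ∃ η, η = ε / ρ := ⟨_, rfl⟩
  have hη0 : 0 < η := by rw [hη]; positivity
  have hερ : ρ * η = ε := by rw [hη]; field_simp
  have htarget : ε ^ 3 * (√(m : ℝ) ^ 3 * √(n : ℝ)) = n ^ 2 * η ^ 3 := by
    have : (n : ℝ) ^ 2 = √(n : ℝ) ^ 4 := by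
      calc (n : ℝ) ^ 2 = (√(n : ℝ) ^ 2) ^ 2 := by rw [hv2]
        _ = _ := by ring
    rw [hη, hρ, this]; field_simp
  rw [← hρ] at h
  rw [htarget]
  -- it suffices to bound the survival probability at a possibly smaller level
  suffices hmain : ∃ E z, 0 < z ∧ z ≤ (√(m : ℝ) + √(n : ℝ)) ^ 2 * (1 - ε) ∧
      E ≤ D * (64 ^ 3 * (n ^ 2 * η ^ 3) + (512 * K) ^ 2) ∧
      ENNReal.ofReal (Real.exp (-(β * E)) / 4) ≤ totalSurvival β z m n 0 0 by
    obtain ⟨E, z, hz0, hz, hE, hsurv⟩ := hmain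
    refine le_trans ?_ (le_laguerreEnsemble_real hβ0 hmn hn hz0 hz hsurv)
    have h7 : Real.exp (-2) ≤ 1 / 4 := by
      rw [Real.exp_neg, inv_le_comm₀ (Real.exp_pos _) (by norm_num)]
      have := Real.quadratic_le_exp_of_nonneg (x := 2) (by norm_num)
      norm_num at this ⊢
      linarith
    rw [← Real.exp_add]
    calc _ ≤ Real.exp (-(β * E) + -2) := Real.exp_le_exp.2 (by
          have := mul_le_mul_of_nonneg_left hE hβ0.le
          linarith)
      _ = Real.exp (-(β * E)) * Real.exp (-2) := Real.exp_add _ _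
      _ ≤ Real.exp (-(β * E)) * (1 / 4) := by gcongr
      _ = _ := by ring
  by_cases hcase : 512 * K ≤ n ∧ η ≤ 1 / 64
  · -- the barrier applies at the deficit `h ^ 2 = max η ((K / n) ^ (2 / 3))`; passing to a larger
    -- deficit makes the event smaller
    obtain ⟨hnK, hη64⟩ := hcase
    have hK0 : 0 < K := by rw [hK]; norm_num
    obtain ⟨h₁, hh1, hh1'⟩ : ∃ h₁ : ℝ, 0 ≤ h₁ ∧ h₁ ^ 2 = η :=
      ⟨√η, by positivity, Real.sq_sqrt hη0.le⟩
    obtain ⟨h₂, hh2, hh2'⟩ : ∃ h₂ : ℝ, 0 ≤ h₂ ∧ h₂ ^ 3 = K / n :=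
      ⟨(K / n) ^ (1 / 3 : ℝ), by positivity, by
        rw [← Real.rpow_natCast, ← Real.rpow_mul (by positivity)]; norm_num⟩
    have hKn : n * h₂ ^ 3 = K := by rw [hh2']; field_simp
    have hb1 : h₁ ≤ 1 / 8 := by
      refine le_of_pow_le_pow_left₀ two_ne_zero (by norm_num) ?_
      rw [hh1']; norm_num; linarith
    have hb2 : h₂ ≤ 1 / 8 := by
      refine le_of_pow_le_pow_left₀ three_ne_zero (by norm_num) ?_
      rw [hh2', div_le_iff₀ (by linarith)]; norm_num; linarith
    have hmaxlo : h₂ ^ 3 ≤ max h₁ h₂ ^ 3 := by gcongr; exact le_max_right _ _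
    have hmaxlo1 : η ≤ max h₁ h₂ ^ 2 := by rw [← hh1']; gcongr; exact le_max_left _ _
    have hmax0 : 0 < max h₁ h₂ := by
      refine lt_of_lt_of_le ?_ (le_max_right _ _)
      refine lt_of_le_of_ne hh2 fun h0 => ?_
      rw [← h0] at hKn
      norm_num at hKn
      exact hK0.ne hKn
    have hmaxb : max h₁ h₂ ≤ 1 / 8 := max_le hb1 hb2
    have hmax6 : (n : ℝ) ^ 2 * max h₁ h₂ ^ 6 ≤ n ^ 2 * η ^ 3 + K ^ 2 := by
      have e1 : (n : ℝ) ^ 2 * h₁ ^ 6 = n ^ 2 * η ^ 3 := by rw [← hh1']; ring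
      have e2 : (n : ℝ) ^ 2 * h₂ ^ 6 = K ^ 2 := by rw [← hKn]; ring
      rcases max_choice h₁ h₂ with hc | hc
      · rw [hc, e1]; linarith [sq_nonneg K]
      · rw [hc, e2]; linarith [show 0 ≤ (n : ℝ) ^ 2 * η ^ 3 by positivity]
    have hsurv := ofReal_exp_le_totalSurvival_edge (h := max h₁ h₂) hβ hmn hn hmax0 hmaxb
      (by rw [← hK, ← hKn]; gcongr) rfl
    refine ⟨32768 * (n ^ 2 * max h₁ h₂ ^ 6), _, mul_pos hS ?_,
      mul_le_mul_of_nonneg_left ?_ hS.le, ?_, le_trans (le_of_eq ?_) hsurv⟩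
    · rw [← hρ]
      have : max h₁ h₂ ^ 2 ≤ (1 / 8) ^ 2 := by gcongr
      nlinarith
    · rw [← hρ, ← hερ]
      have := mul_le_mul_of_nonneg_left hmaxlo1 hρ0.le
      linarith
    · have : (0 : ℝ) ≤ n ^ 2 * η ^ 3 := by positivity
      rw [hD]
      nlinarith [sq_nonneg K]
    · congr 4; ring
  · -- here `n ^ 2` is at most of order `n ^ 2 * η ^ 3 + 1`, so that a bound `exp (-D β n ^ 2)`,
    -- from a tilt `t` of order `ρ` in every step, is enough
    have hn2 : (n : ℝ) ^ 2 ≤ 64 ^ 3 * (n ^ 2 * η ^ 3) + (512 * K) ^ 2 := by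
      rcases not_and_or.1 hcase with hc | hc
      · push Not at hc
        have : (n : ℝ) ^ 2 ≤ (512 * K) ^ 2 := by gcongr
        linarith [show 0 ≤ (n : ℝ) ^ 2 * η ^ 3 by positivity]
      · push Not at hc
        have h1 : (1 / 64) ^ 3 ≤ η ^ 3 := by gcongr
        have h2 := mul_le_mul_of_nonneg_left h1 (sq_nonneg (n : ℝ))
        linarith [sq_nonneg (512 * K)]
    obtain ⟨t, ht⟩ : ∃ t, t = (ε + 1088 * ρ) / (1 + 1088 * ρ) := ⟨_, rfl⟩
    have hden : 0 < 1 + 1088 * ρ := by linarith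
    have ht0 : 0 ≤ t := by rw [ht]; positivity
    have ht1 : 1 - t = (1 - ε) / (1 + 1088 * ρ) := by rw [ht]; field_simp; ring
    have ht2 : 1 / 1400 ≤ 1 - t := by
      rw [ht1, div_le_div_iff₀ (by norm_num) hden]; linarith
    have htρ : t ≤ 1632 * ρ := by
      rw [ht, div_le_iff₀ hden]; nlinarith
    have hsurv := ofReal_exp_le_totalSurvival_crude (t := t) (L := 1400)
      (z := (√(m : ℝ) + √(n : ℝ)) ^ 2 * (1 - ε)) hβ hmn hn ht0 (by linarith)
      (by linarith [mul_nonneg ht0 (show 0 ≤ 1 - t by linarith)])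
      (by rw [ht1, ← hρ]; exact le_of_eq (by field_simp))
    refine ⟨1400 * (t ^ 2 * (m * n)), _, mul_pos hS (by linarith), le_rfl, ?_,
      le_trans (le_of_eq ?_) hsurv⟩
    · calc 1400 * (t ^ 2 * (m * n)) ≤ 1400 * ((1632 * ρ) ^ 2 * (m * n)) := by gcongr
        _ = D * n ^ 2 := by rw [mul_pow, mul_assoc (1632 ^ 2), hρ2, hD]; ring
        _ ≤ _ := by
          have : 0 ≤ D := by rw [hD]; norm_num
          gcongr
    · congr 4; ring

lemma sq_rpow_three_halves {ε : ℝ} (hε : 0 ≤ ε) : (ε ^ (3 / 2 : ℝ)) ^ 2 = ε ^ 3 := by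
  rw [← Real.rpow_natCast, ← Real.rpow_mul hε, ← Real.rpow_natCast]
  norm_num

lemma sq_rpow_three_quarters {y : ℝ} (hy : 0 ≤ y) : (y ^ (3 / 4 : ℝ)) ^ 2 = √y ^ 3 := by
  rw [Real.sqrt_eq_rpow, ← Real.rpow_natCast, ← Real.rpow_mul hy, ← Real.rpow_natCast,
    ← Real.rpow_mul hy]
  norm_num

lemma sq_rpow_one_quarter {y : ℝ} (hy : 0 ≤ y) : (y ^ (1 / 4 : ℝ)) ^ 2 = √y := by
  rw [Real.sqrt_eq_rpow, ← Real.rpow_natCast, ← Real.rpow_mul hy]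
  norm_num

end

theorem theorem2 :
    ∃ C₀ c c' c'' : ℝ, 0 < C₀ ∧ 0 < c ∧ 0 < c' ∧ 0 < c'' ∧
      -- rectangular case
      (∀ ε : ℝ, 0 < ε → ε < c' → ∀ m n : ℕ, n ≤ m → ∀ hn : 1 ≤ n, ∀ β : ℝ, 1 ≤ β →
        (c'' * (√(n : ℝ) / √(m : ℝ)) ≤ ε →
          Real.exp (-c * β * (ε * √((m : ℝ) * (n : ℝ))) ^ 2) ≤
            (laguerreEnsemble β m n).real
              {x | x ⟨n - 1, Nat.sub_lt hn Nat.one_pos⟩ ≤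
                (√(m : ℝ) + √(n : ℝ)) ^ 2 * (1 - ε)}) ∧
        (ε ≤ c'' * (√(n : ℝ) / √(m : ℝ)) →
          C₀ ^ β * Real.exp (-c * β * (ε ^ (3 / 2 : ℝ) * (m : ℝ) ^ (3 / 4 : ℝ) *
              (n : ℝ) ^ (1 / 4 : ℝ)) ^ 2) ≤
            (laguerreEnsemble β m n).real
              {x | x ⟨n - 1, Nat.sub_lt hn Nat.one_pos⟩ ≤
                (√(m : ℝ) + √(n : ℝ)) ^ 2 * (1 - ε)})) ∧
      -- square case
      (∀ ε : ℝ, 0 < ε → ε < c' → ∀ n : ℕ, ∀ hn : 1 ≤ n, ∀ β : ℝ, 1 ≤ β →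
        C₀ ^ β * Real.exp (-c * β * ((n : ℝ) * ε ^ (3 / 2 : ℝ)) ^ 2) ≤
          (laguerreEnsemble β n n).real
            {x | x ⟨n - 1, Nat.sub_lt hn Nat.one_pos⟩ ≤ 4 * (n : ℝ) * (1 - ε)}) := by
  obtain ⟨c, B, hc, hB, hsmall⟩ := exists_le_laguerreEnsemble_real_of_small
  refine ⟨Real.exp (-B), c, 1 / 6, 544, Real.exp_pos _, by linarith, by norm_num, by norm_num,
    fun ε hε0 hε m n hmn hn β hβ => ⟨fun h => ?_, fun h => ?_⟩, fun ε hε0 hε n hn β hβ => ?_⟩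
  · refine le_trans (Real.exp_le_exp.2 ?_)
      (le_laguerreEnsemble_real_of_large hε0 hε hmn hn hβ h)
    rw [mul_pow, Real.sq_sqrt (by positivity)]
    have : 0 ≤ β * (ε ^ 2 * ((m : ℝ) * n)) := mul_nonneg (by linarith) (by positivity)
    nlinarith
  · refine le_trans (le_of_eq ?_) (hsmall ε hε0 hε m n hmn hn β hβ h)
    rw [← Real.exp_mul, mul_pow, mul_pow, sq_rpow_three_halves hε0.le,
      sq_rpow_three_quarters (Nat.cast_nonneg _), sq_rpow_one_quarter (Nat.cast_nonneg _)]
    ring_nf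
  · have hv : 0 < √(n : ℝ) := Real.sqrt_pos.2 (by exact_mod_cast hn)
    have hv2 : √(n : ℝ) ^ 2 = n := Real.sq_sqrt (Nat.cast_nonneg _)
    have hmain := hsmall ε hε0 hε n n le_rfl hn β hβ (by rw [div_self hv.ne']; linarith)
    have e1 : (√(n : ℝ) + √(n : ℝ)) ^ 2 = 4 * n := by rw [← two_mul, mul_pow, hv2]; norm_num
    have e2 : √(n : ℝ) ^ 3 * √(n : ℝ) = (n : ℝ) ^ 2 := by
      calc √(n : ℝ) ^ 3 * √(n : ℝ) = (√(n : ℝ) ^ 2) ^ 2 := by ring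
        _ = _ := by rw [hv2]
    rw [e1, e2] at hmain
    refine le_trans (le_of_eq ?_) hmain
    rw [← Real.exp_mul, mul_pow, sq_rpow_three_halves hε0.le]
    ring_nf
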